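/- A translation surface is a closed connected surface obtained from finitely many polygons in $\mathbb C$ by gluing sides in pairs by translations, considered up to homeomorphisms that are local translations; the moduli space of such surfaces has, on each stratum, the topology given by period coordinates. The octagon is the surface obtained from the regular octagon of side $1$ with one side $[0,1]$ by gluing opposite sides. A fake octagon is a translation surface, different from the octagon, that has only one singular point and the same absolute periods as the octagon (as a polarized module). Let $\gamma$ be the unique horizontal closed saddle connection of length $1$, oriented from left to right. Its left (right) twin is the horizontal segment of length $1$, starting at the endpoint of $\gamma$ and going to the right, such that the clockwise (counterclockwise) angle from the end of $\gamma$ to it is $\pi$. The left (right) surgery cuts the surface along $\gamma$ and its left (right) twin and glues the two slits the other way. Let $\operatorname{Oct}_0$ be the octagon and, for $n\in\mathbb Z$, let $\operatorname{Oct}_n$ be the surface obtained from it by $n$ left surgeries ($|n|$ right surgeries if $n<0$). $\operatorname{Oct}_n$ has the following description. Put $B'=0$, $D=2+\sqrt2$, $B=1+\frac{\sqrt2}2+\frac{\sqrt2}2i$, $C=B+1$, $E=-\frac{\sqrt2}2+\frac{\sqrt2}2i$, $F=B$, $A'=E+i$, $D'=F+i$. Glue $EB'$ to $CD$ and $EA'$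 to $FD'$ by translations, so that $B'D$ and $A'D'$ become circles of length $2+\sqrt2$ and $1+\sqrt2$; glue the side $EF$ of the rectangle $EFD'A'$ to the side $EF$ of the parallelogram $EB'DC$, whose top side $EC$ consists of $EF$ and $BC$. Let $P_n$ be the point of the circle $B'D$ at position $n+1$ modulo $2+\sqrt2$, and $P'_n$ the point of the circle $A'D'$ at position $n$ modulo $1+\sqrt2$. Then $BC$ is glued to the segment $P_{n-1}P_n$ of length $1$, and the complementary arc of the circle $B'D$, from $P_n$ to $P_{n-1}$, is glued to the circle $A'D'$ cut at $P'_n$. Then: 1. The positions of $P_n$, $n\in\mathbb Z$, are dense in $\mathbb R/(2+\sqrt2)\mathbb Z$. 2. All three systole configurations occur (the systoles are the shortest saddle connections, without orientation): there is an $n$ with $P_n\in(1,1+\frac{1+\sqrt2}2)$ such that the only systole of $\operatorname{Oct}_n$ is the segment $P_nB$; there is an $n$ with $P_n\in(1+\frac{1+\sqrt2}2,2+\frac{1+\sqrt2}2)$ such that $\operatorname{Oct}_n$ has exactly two systoles, the segments $P_{n-1}B$ and $P_nC$; and there is an $n$ with $P_n\in(0,1)\cup(2+\frac{1+\sqrt2}2,2+\sqrt2)$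 such that the only systole of $\operatorname{Oct}_n$ is the segment $P_{n-1}C$. 3. For every $m\in\mathbb Z$, every neighbourhood of $\operatorname{Oct}_m$ in the moduli space contains some $\operatorname{Oct}_n$ with $n\ne m$ that is a fake octagon and is different from $\operatorname{Oct}_m$. In particular, every neighbourhood of the octagon contains a fake octagon $\operatorname{Oct}_n$. -/

import Mathlib

open Set Filter Topology

noncomputable section

namespace TranslationSurface

/-! ### Polygons glued along sides by translations -/

/-- The combinatorics of a gluing of polygons: `n` polygons, the `i`-th one with `sides i`
consecutive sides, and an involution that pairs the sides. -/
structure Pattern where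
  n : ℕ
  sides : Fin n → ℕ
  glue : Equiv.Perm (Σ i : Fin n, Fin (sides i))
  glue_glue : ∀ s, glue (glue s) = s

/-- The sides of all polygons. -/
abbrev Pattern.Side (c : Pattern) : Type := Σ i : Fin c.n, Fin (c.sides i)

/-- The side that follows a given side, counterclockwise in the same polygon. -/
def Pattern.next (c : Pattern) : Equiv.Perm c.Side :=
  Equiv.sigmaCongrRight fun i => finRotate (c.sides i)

/-- Two-dimensional cross product. -/
def cross (a b : ℂ) : ℝ := a.re * b.im - a.im * b.re

/-- `V s` is the initial vertex of the side `s`, so that `s` runs from `V s` to `V (next s)`.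
The vertices of each polygon are distinct and in (weakly) convex position, listed
counterclockwise (vertices of angle `π` are allowed), no polygon is degenerate, and paired
sides differ by a translation, the two polygons lying on opposite sides of the common side. -/
structure Admissible (c : Pattern) (V : c.Side → ℂ) : Prop where
  inj : ∀ i, Function.Injective fun k => V ⟨i, k⟩
  convex : ∀ i k l, 0 ≤ cross (V (c.next ⟨i, k⟩) - V ⟨i, k⟩) (V ⟨i, l⟩ - V ⟨i, k⟩)
  nondeg : ∀ i k, ∃ l, 0 < cross (V (c.next ⟨i, k⟩) - V ⟨i, k⟩) (V ⟨i, l⟩ - V ⟨i, k⟩)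
  glue : ∀ s, V (c.next (c.glue s)) - V (c.glue s) = -(V (c.next s) - V s)

/-- Finitely many convex polygons in `ℂ` whose sides are paired by translations. It carries the
topology in which the combinatorics is locally constant and the vertices move continuously. -/
abbrev Gluing : Type := Σ c : Pattern, {V : c.Side → ℂ // Admissible c V}

namespace Gluing

/-- Initial vertex of a side. -/
def vtx (X : Gluing) (s : X.1.Side) : ℂ := X.2.1 s

/-- Side vector. -/
def vec (X : Gluing) (s : X.1.Side) : ℂ := X.vtx (X.1.next s) - X.vtx s

/-- The `i`-th closed polygon. -/
def poly (X : Gluing) (i : Fin X.1.n) : Set ℂ := convexHull ℝ (range fun k => X.vtx ⟨i, k⟩)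

/-- Disjoint union of the polygons. -/
abbrev PrePt (X : Gluing) : Type := Σ i : Fin X.1.n, X.poly i

/-- `a` lies on some side, and `b` is the corresponding point of the paired side. -/
def Glued (X : Gluing) (a b : X.PrePt) : Prop :=
  ∃ k l, X.1.glue ⟨a.1, k⟩ = ⟨b.1, l⟩ ∧
    (a.2 : ℂ) ∈ segment ℝ (X.vtx ⟨a.1, k⟩) (X.vtx (X.1.next ⟨a.1, k⟩)) ∧
    (b.2 : ℂ) - X.vtx (X.1.next ⟨b.1, l⟩) = (a.2 : ℂ) - X.vtx ⟨a.1, k⟩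

/-- The surface: the quotient space of the polygons under the side pairings. -/
abbrev Pt (X : Gluing) : Type := Quot X.Glued

/-- The point of the surface given by a point of a polygon. -/
def mk (X : Gluing) (i : Fin X.1.n) (x : X.poly i) : X.Pt := Quot.mk _ ⟨i, x⟩

lemma vtx_mem (X : Gluing) (s : X.1.Side) : X.vtx s ∈ X.poly s.1 :=
  subset_convexHull ℝ _ ⟨s.2, rfl⟩

/-- The point of the surface at which the side `s` starts. -/
def start (X : Gluing) (s : X.1.Side) : X.Pt := X.mk s.1 ⟨X.vtx s, X.vtx_mem s⟩

/-- The image in the surface of the straight segment from `a` to `b` in the `i`-th polygon. -/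
def chord (X : Gluing) (i : Fin X.1.n) (a b : ℂ) : Set X.Pt :=
  {q | ∃ x : X.poly i, (x : ℂ) ∈ segment ℝ a b ∧ X.mk i x = q}

/-- `p` and `q` lie in a common polygon, where `q` is reached from `p` by the straight segment with
vector `z`. For `z` small (depending on `p`) this says that the straight segment with vector
`z` that starts at `p` in one of the available directions ends at `q`. -/
def Disp (X : Gluing) (p q : X.Pt) (z : ℂ) : Prop :=
  ∃ i, ∃ x y : X.poly i, X.mk i x = p ∧ X.mk i y = q ∧ (y : ℂ) - x = z

/-- A point is singular unless its cone angle is `2π`, that is, unless every short vector leads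
from it to exactly one point. (At a point of cone angle `2π(d+1)`, every short nonzero vector leads
to exactly `d+1` points.) -/
def Singular (X : Gluing) (p : X.Pt) : Prop :=
  ¬ ∃ ε > 0, ∀ z : ℂ, ‖z‖ < ε → ∃! q, X.Disp p q z

/-- Isomorphism of translation structures: a homeomorphism that is locally a translation. -/
def Iso (X Y : Gluing) : Prop :=
  ∃ f : X.Pt ≃ₜ Y.Pt, ∀ p, ∃ ε > 0, ∀ q z, ‖z‖ < ε → (X.Disp p q z ↔ Y.Disp (f p) (f q) z)

lemma Iso.refl (X : Gluing) : Iso X X :=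
  ⟨Homeomorph.refl _, fun _ => ⟨1, one_pos, fun _ _ _ => Iff.rfl⟩⟩

lemma Iso.symm {X Y : Gluing} : Iso X Y → Iso Y X := by
  rintro ⟨f, hf⟩
  refine ⟨f.symm, fun p => ?_⟩
  obtain ⟨ε, hε, h⟩ := hf (f.symm p)
  refine ⟨ε, hε, fun q z hz => ?_⟩
  simpa using (h (f.symm q) z hz).symm

lemma Iso.trans {X Y Z : Gluing} : Iso X Y → Iso Y Z → Iso X Z := by
  rintro ⟨f, hf⟩ ⟨g, hg⟩
  refine ⟨f.trans g, fun p => ?_⟩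
  obtain ⟨ε, hε, h⟩ := hf p
  obtain ⟨δ, hδ, h'⟩ := hg (f p)
  refine ⟨min ε δ, lt_min hε hδ, fun q z hz => ?_⟩
  exact (h q z (hz.trans_le (min_le_left _ _))).trans
    (h' (f q) z (hz.trans_le (min_le_right _ _)))

/-! ### Saddle connections and systoles -/

/-- `c`, restricted to `[0,1]`, is a saddle connection with holonomy vector `v`: a straight path of
constant velocity `v ≠ 0` that joins singular points and has no singular point inside. -/
def IsSaddleConnection (X : Gluing) (v : ℂ) (c : ℝ → X.Pt) : Prop :=
  v ≠ 0 ∧ X.Singular (c 0) ∧ X.Singular (c 1) ∧ (∀ t ∈ Ioo (0 : ℝ) 1, ¬ X.Singular (c t)) ∧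
    ∀ t ∈ Icc (0 : ℝ) 1, ∀ᶠ s in 𝓝[Icc 0 1] t, X.Disp (c t) (c s) (((s - t : ℝ) : ℂ) * v)

/-- The shortest saddle connections, as subsets of the surface (that is, unoriented). -/
def systoles (X : Gluing) : Set (Set X.Pt) :=
  {S | ∃ v c, X.IsSaddleConnection v c ∧ S = c '' Icc 0 1 ∧
    ∀ v' c', X.IsSaddleConnection v' c' → ‖v‖ ≤ ‖v'‖}

/-! ### Absolute periods and fakes -/

/-- `z` is the period of the path `γ`: the total increment of a developing map along `γ`. -/
def HasPeriod (X : Gluing) {x y : X.Pt} (γ : Path x y) (z : ℂ) : Prop :=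
  ∃ F : unitInterval → ℂ, Continuous F ∧ F 1 - F 0 = z ∧
    ∀ t, ∀ᶠ s in 𝓝 t, X.Disp (γ t) (γ s) (F s - F t)

/-- Same absolute periods, as polarized modules: some homeomorphism identifies the period classes
in `H¹( · ; ℂ)`. It identifies the intersection forms, too: it preserves orientation automatically,
because otherwise one of the two areas would be negative. -/
def Isoperiodic (X Y : Gluing) : Prop :=
  ∃ f : X.Pt ≃ₜ Y.Pt, ∀ (x : X.Pt) (γ : Path x x) (z : ℂ),
    X.HasPeriod γ z → Y.HasPeriod (γ.map f.continuous) z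

/-- `Y` is a fake `X`: different from `X`, with the same absolute periods, and with only one
singular point. -/
def IsFake (X Y : Gluing) : Prop :=
  ¬ Iso X Y ∧ X.Isoperiodic Y ∧ ∃! p, Y.Singular p

/-! ### Saddle connection surgeries -/

/-- Cut along the sides `γ` and `η`, which have the same vector, and glue the other way: what was on
the left of `γ` is glued to what was on the right of `η`, and conversely. -/
def reglue (X : Gluing) (γ η : X.1.Side) (h : X.vec γ = X.vec η) : Gluing :=
  ⟨{ n := X.1.n
     sides := X.1.sides
     glue := Equiv.swap γ η * X.1.glue * Equiv.swap γ η
     glue_glue := fun s => by simp [X.1.glue_glue] },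
   ⟨X.2.1,
    { inj := X.2.2.inj
      convex := X.2.2.convex
      nondeg := X.2.2.nondeg
      glue := fun s => by
        have key : ∀ t, X.vec (Equiv.swap γ η t) = X.vec t := fun t => by
          rcases eq_or_ne t γ with rfl | h1
          · rw [Equiv.swap_apply_left, h]
          · rcases eq_or_ne t η with rfl | h2
            · rw [Equiv.swap_apply_right, h]
            · rw [Equiv.swap_apply_of_ne_of_ne h1 h2]
        have h2 : X.vec (X.1.glue (Equiv.swap γ η s)) = -X.vec (Equiv.swap γ η s) :=
          X.2.2.glue _
        rw [← key (X.1.glue _), key s] at h2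
        exact h2 }⟩⟩

/-- The side `γ` is a closed saddle connection with holonomy `1` (horizontal, of unit length, oriented
from left to right), and it is the only saddle connection with this holonomy. -/
def IsUnitSaddle (X : Gluing) (γ : X.1.Side) : Prop :=
  X.vec γ = 1 ∧ X.start γ = X.start (X.1.next γ) ∧ X.Singular (X.start γ) ∧
    ∀ c, X.IsSaddleConnection 1 c →
      c '' Icc 0 1 = X.chord γ.1 (X.vtx γ) (X.vtx (X.1.next γ))

/-- `η` is the twin of the horizontal side `γ` for which the clockwise angle at the endpoint of `γ`
from the end of `γ` to `η` is `π`. The sides that start at this endpoint are met, when one turns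
clockwise from the end of `γ`, in the order `u 0 = next γ`, `u (j+1) = next (glue (u j))`; the side
`u j` is reached after an angle `π` when `u j` points to the right and all the earlier ones
point into the open upper half plane. -/
def IsLeftTwin (X : Gluing) (γ η : X.1.Side) : Prop :=
  X.vec η = X.vec γ ∧ ∃ j : ℕ, η = (fun s => X.1.next (X.1.glue s))^[j] (X.1.next γ) ∧
    ∀ i < j, 0 < (X.vec ((fun s => X.1.next (X.1.glue s))^[i] (X.1.next γ))).im

/-- The twin on the other side, for which the counterclockwise angle from the end of `γ` is `π`: here
one meets `u 0 = glue (prev (glue γ))`, `u (j+1) = glue (prev (u j))`. -/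
def IsRightTwin (X : Gluing) (γ η : X.1.Side) : Prop :=
  X.vec η = X.vec γ ∧
    ∃ j : ℕ, η = (fun s => X.1.glue (X.1.next.symm s))^[j]
        (X.1.glue (X.1.next.symm (X.1.glue γ))) ∧
      ∀ i < j, (X.vec ((fun s => X.1.glue (X.1.next.symm s))^[i]
        (X.1.glue (X.1.next.symm (X.1.glue γ))))).im < 0

/-- `Y` is obtained from `X` by the left surgery: present `X` by polygons that have the unit horizontal
saddle connection `γ` and its left twin `η`, an embedded segment, among their sides; cut along both,
and paste the other way. -/
def LeftSurgery (X Y : Gluing) : Prop :=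
  ∃ X' : Gluing, Iso X X' ∧ ∃ (γ η : X'.1.Side) (h : X'.vec γ = X'.vec η),
    X'.IsUnitSaddle γ ∧ X'.IsLeftTwin γ η ∧ X'.start η ≠ X'.start (X'.1.next η) ∧
      Iso (X'.reglue γ η h) Y

/-- `Y` is obtained from `X` by the right surgery. -/
def RightSurgery (X Y : Gluing) : Prop :=
  ∃ X' : Gluing, Iso X X' ∧ ∃ (γ η : X'.1.Side) (h : X'.vec γ = X'.vec η),
    X'.IsUnitSaddle γ ∧ X'.IsRightTwin γ η ∧ X'.start η ≠ X'.start (X'.1.next η) ∧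
      Iso (X'.reglue γ η h) Y

lemma connectedSpace_of_common (X : Gluing) (p : X.Pt)
    (h : ∀ i, ∃ x : X.poly i, X.mk i x = p) : ConnectedSpace X.Pt := by
  have hpre : IsPreconnected (⋃ i, range (X.mk i)) := by
    refine isPreconnected_iUnion ⟨p, mem_iInter.2 fun i => h i⟩ fun i => ?_
    have hc : Continuous (X.mk i) := continuous_quot_mk.comp continuous_sigmaMk
    have : PreconnectedSpace (X.poly i) :=
      Subtype.preconnectedSpace (convex_convexHull ℝ _).isPreconnected
    exact isPreconnected_range hc
  have huniv : (⋃ i, range (X.mk i)) = univ := by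
    refine eq_univ_of_forall fun q => ?_
    induction q using Quot.ind with
    | mk a => exact mem_iUnion.2 ⟨a.1, a.2, rfl⟩
  rw [huniv] at hpre
  exact { isPreconnected_univ := hpre, toNonempty := ⟨p⟩ }

end Gluing

/-! ### The moduli space -/

/-- Closed connected translation surfaces, presented by glued polygons. -/
abbrev Surface : Type := {X : Gluing // ConnectedSpace X.Pt}

instance surfaceSetoid : Setoid Surface where
  r X Y := Gluing.Iso X.1 Y.1
  iseqv := ⟨fun X => Gluing.Iso.refl X.1, Gluing.Iso.symm, Gluing.Iso.trans⟩

/-- The moduli space: translation surfaces up to isomorphism. Its topology is the quotient topology,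
in which a surface moves continuously when the sides of glued polygons that present it do;
on each stratum this is the topology of period coordinates. -/
abbrev Moduli : Type := Quotient surfaceSetoid

/-- The point of the moduli space given by a surface. -/
def Surface.cls (X : Surface) : Moduli := Quotient.mk _ X

/-! ### The octagon -/

/-- Pairing of the opposite sides of an octagon. -/
def octagonPattern : Pattern where
  n := 1
  sides := fun _ => 8
  glue := Equiv.sigmaCongrRight fun _ => Equiv.addRight (4 : Fin 8)
  glue_glue := by decide

/-- The eighth root of unity `exp (π I / 4)`. -/
def zeta : ℂ := ⟨√2 / 2, √2 / 2⟩

/-- Vertices of the regular octagon with side `1` whose first side is `[0,1]`. -/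
def octagonVtx (s : octagonPattern.Side) : ℂ := ∑ j ∈ Finset.range (s.2 : Fin 8).val, zeta ^ j

/-- The `k`-th side of the octagon. -/
def octSide (k : Fin 8) : octagonPattern.Side := ⟨(0 : Fin 1), k⟩

lemma octagonVtx_eq (k : Fin 8) : octagonVtx (octSide k) =
    (![⟨0, 0⟩, ⟨1, 0⟩, ⟨1 + √2 / 2, √2 / 2⟩, ⟨1 + √2 / 2, 1 + √2 / 2⟩, ⟨1, 1 + √2⟩, ⟨0, 1 + √2⟩,
      ⟨-(√2 / 2), 1 + √2 / 2⟩, ⟨-(√2 / 2), √2 / 2⟩] : Fin 8 → ℂ) k := by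
  have h2 : √2 * √2 = 2 := Real.mul_self_sqrt (by norm_num)
  have e2 : zeta ^ 2 = ⟨0, 1⟩ := by
    rw [pow_two]; apply Complex.ext <;> simp [zeta]; nlinarith
  have e3 : zeta ^ 3 = ⟨-(√2 / 2), √2 / 2⟩ := by
    rw [pow_succ, e2]; apply Complex.ext <;> simp [zeta]
  have e4 : zeta ^ 4 = ⟨-1, 0⟩ := by
    rw [pow_succ, e3]; apply Complex.ext <;> simp [zeta] <;> nlinarith
  have e5 : zeta ^ 5 = ⟨-(√2 / 2), -(√2 / 2)⟩ := by
    rw [pow_succ, e4]; apply Complex.ext <;> simp [zeta]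
  have e6 : zeta ^ 6 = ⟨0, -1⟩ := by
    rw [pow_succ, e5]; apply Complex.ext <;> simp [zeta] <;> nlinarith
  fin_cases k <;>
    simp only [octagonVtx, octSide, Finset.sum_range_succ, Finset.sum_range_zero, e2, e3, e4, e5,
      e6] <;>
    apply Complex.ext <;> simp [zeta] <;> ring

lemma octSide_surj (s : octagonPattern.Side) : ∃ k, s = octSide k := by
  obtain ⟨i, k⟩ := s
  obtain rfl : i = (0 : Fin 1) := Subsingleton.elim (α := Fin 1) _ _
  exact ⟨k, rfl⟩

lemma octagon_next (k : Fin 8) : octagonPattern.next (octSide k) = octSide (k + 1) :=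
  congrArg octSide (finRotate_apply (n := 8) k)

lemma octagon_glue (k : Fin 8) : octagonPattern.glue (octSide k) = octSide (k + 4) := rfl

lemma octagon_admissible : Admissible octagonPattern octagonVtx := by
  have h0 : 0 < √2 := by positivity
  have h2 : √2 * √2 = 2 := Real.mul_self_sqrt (by norm_num)
  have h1 : 1 < √2 := by nlinarith
  constructor
  · intro i
    obtain rfl : i = (0 : Fin 1) := Subsingleton.elim (α := Fin 1) _ _
    intro (k : Fin 8) (l : Fin 8) h
    change octagonVtx (octSide k) = octagonVtx (octSide l) at h
    rw [octagonVtx_eq, octagonVtx_eq] at h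
    have hr := congrArg Complex.re h
    have hi := congrArg Complex.im h
    clear h
    fin_cases k <;> fin_cases l <;> first | rfl | (exfalso; simp at hr hi; try linarith)
  · intro i (k : Fin 8) (l : Fin 8)
    obtain rfl : i = (0 : Fin 1) := Subsingleton.elim (α := Fin 1) _ _
    change 0 ≤ cross (octagonVtx (octagonPattern.next (octSide k)) - octagonVtx (octSide k))
      (octagonVtx (octSide l) - octagonVtx (octSide k))
    rw [octagon_next, octagonVtx_eq, octagonVtx_eq, octagonVtx_eq]
    fin_cases k <;> fin_cases l <;> simp [cross] <;> nlinarith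
  · intro i (k : Fin 8)
    obtain rfl : i = (0 : Fin 1) := Subsingleton.elim (α := Fin 1) _ _
    refine ⟨(k + 2 : Fin 8), ?_⟩
    change 0 < cross (octagonVtx (octagonPattern.next (octSide k)) - octagonVtx (octSide k))
      (octagonVtx (octSide (k + 2)) - octagonVtx (octSide k))
    rw [octagon_next, octagonVtx_eq, octagonVtx_eq, octagonVtx_eq]
    fin_cases k <;> simp [cross] <;> nlinarith
  · intro s
    obtain ⟨k, rfl⟩ := octSide_surj s
    rw [octagon_glue, octagon_next, octagon_next, octagonVtx_eq, octagonVtx_eq, octagonVtx_eq,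
      octagonVtx_eq]
    fin_cases k <;> apply Complex.ext <;> simp <;> ring

/-- The octagon: opposite sides of the regular octagon are glued. -/
def octagon : Surface :=
  ⟨⟨octagonPattern, octagonVtx, octagon_admissible⟩, by
    refine Gluing.connectedSpace_of_common _ (Gluing.start _ (octSide 0)) fun i => ?_
    obtain rfl : i = (0 : Fin 1) := Subsingleton.elim (α := Fin 1) _ _
    exact ⟨_, rfl⟩⟩

/-! ### The surfaces obtained from the octagon -/

/-- Side pairing of a parallelogram (polygon `0`) and a hexagon (polygon `1`). -/
def figGlue (s : Σ i : Fin 2, Fin ((![4, 6] : Fin 2 → ℕ) i)) :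
    Σ i : Fin 2, Fin ((![4, 6] : Fin 2 → ℕ) i) :=
  match s with
  | ⟨0, k⟩ => (![⟨1, (3 : Fin 6)⟩, ⟨0, (3 : Fin 4)⟩, ⟨1, (1 : Fin 6)⟩, ⟨0, (1 : Fin 4)⟩] :
      Fin 4 → Σ i : Fin 2, Fin ((![4, 6] : Fin 2 → ℕ) i)) k
  | ⟨1, k⟩ => (![⟨1, (4 : Fin 6)⟩, ⟨0, (2 : Fin 4)⟩, ⟨1, (5 : Fin 6)⟩, ⟨0, (0 : Fin 4)⟩,
      ⟨1, (0 : Fin 6)⟩, ⟨1, (2 : Fin 6)⟩] :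
      Fin 6 → Σ i : Fin 2, Fin ((![4, 6] : Fin 2 → ℕ) i)) k

lemma figGlue_figGlue : ∀ s, figGlue (figGlue s) = s := by decide

/-- The gluing pattern of the surfaces obtained from the octagon. -/
def figPattern : Pattern where
  n := 2
  sides := ![4, 6]
  glue := ⟨figGlue, figGlue, figGlue_figGlue, figGlue_figGlue⟩
  glue_glue := figGlue_figGlue

/-- The vertex `B`, at the height `√2/2` above the line `B'D`. -/
def ptB : ℂ := ⟨1 + √2 / 2, √2 / 2⟩

/-- The vertex `C`; the segment `BC` has length `1`. -/
def ptC : ℂ := ⟨2 + √2 / 2, √2 / 2⟩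

/-- The vertex `E`; the segment `EF`, where `F` is `B`, has length `1 + √2`. -/
def ptE : ℂ := ⟨-(√2 / 2), √2 / 2⟩

/-- Vertices of the polygons. The origin is `B'`, and `D` is `2 + √2`.
* Polygon `0` is the cylinder `EFD'A'` of circumference `1 + √2` and height `1`, cut open along a
  segment from `E` to `P'`. Here `r` is the position of `P'` on `A'D'`, and the vertices are
  `E`, `F`, `P' + (1 + √2)`, `P'`.
* Polygon `1` is the cylinder `EB'DC` of circumference `2 + √2` and height `√2/2`, cut open along a
  segment from `B` to `Q`. Here `q` is the position of `Q` on `B'D`, `P = Q + 1`, and the vertices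
  are `Q`, `P`, `Q + (2 + √2)`, `B + (2 + √2)`, `C`, `B`.
The slanted sides are glued by the translations `1 + √2` and `2 + √2`. The side `QP` is glued to `BC`, the
other bottom side of polygon `1` (from `P` to `Q`, around the cylinder) to the top side of polygon
`0` (from `P'` to `P'`), and the other top side of polygon `1` to the side `EF` of polygon `0`. -/
def figVtx (q r : ℝ) (s : figPattern.Side) : ℂ :=
  match s with
  | ⟨(0 : Fin 2), k⟩ => (![ptE, ptE + ⟨1 + √2, 0⟩, ptE + ⟨r + (1 + √2), 1⟩, ptE + ⟨r, 1⟩] :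
      Fin 4 → ℂ) k
  | ⟨(1 : Fin 2), k⟩ => (![⟨q, 0⟩, ⟨q + 1, 0⟩, ⟨q + (2 + √2), 0⟩, ptB + ⟨2 + √2, 0⟩, ptC, ptB] :
      Fin 6 → ℂ) k

/-- The `k`-th side of the parallelogram. -/
def parSide (k : Fin 4) : figPattern.Side := ⟨(0 : Fin 2), k⟩

/-- The `k`-th side of the hexagon. -/
def hexSide (k : Fin 6) : figPattern.Side := ⟨(1 : Fin 2), k⟩

lemma parSide_next (k : Fin 4) : figPattern.next (parSide k) = parSide (k + 1) :=
  congrArg parSide (finRotate_apply (n := 4) k)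

lemma hexSide_next (k : Fin 6) : figPattern.next (hexSide k) = hexSide (k + 1) :=
  congrArg hexSide (finRotate_apply (n := 6) k)

lemma figVtx_par (q r : ℝ) (k : Fin 4) : figVtx q r (parSide k) =
    (![ptE, ptE + ⟨1 + √2, 0⟩, ptE + ⟨r + (1 + √2), 1⟩, ptE + ⟨r, 1⟩] : Fin 4 → ℂ) k := rfl

lemma figVtx_hex (q r : ℝ) (k : Fin 6) : figVtx q r (hexSide k) =
    (![⟨q, 0⟩, ⟨q + 1, 0⟩, ⟨q + (2 + √2), 0⟩, ptB + ⟨2 + √2, 0⟩, ptC, ptB] : Fin 6 → ℂ) k := rfl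

lemma figPattern_glue_par (k : Fin 4) : figPattern.glue (parSide k) =
    (![hexSide 3, parSide 3, hexSide 1, parSide 1] : Fin 4 → figPattern.Side) k := rfl

lemma figPattern_glue_hex (k : Fin 6) : figPattern.glue (hexSide k) =
    (![hexSide 4, parSide 2, hexSide 5, parSide 0, hexSide 0, hexSide 2] :
      Fin 6 → figPattern.Side) k := rfl

lemma fin_two (i : Fin 2) : i = 0 ∨ i = 1 := by fin_cases i <;> simp

lemma fig_admissible (q r : ℝ) : Admissible figPattern (figVtx q r) := by
  have h0 : 0 < √2 := by positivity
  have h2 : √2 * √2 = 2 := Real.mul_self_sqrt (by norm_num)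
  constructor
  · intro i
    obtain rfl | rfl := fin_two i
    · intro (k : Fin 4) (l : Fin 4) h
      change figVtx q r (parSide k) = figVtx q r (parSide l) at h
      rw [figVtx_par, figVtx_par] at h
      have hr := congrArg Complex.re h
      have hi := congrArg Complex.im h
      clear h
      fin_cases k <;> fin_cases l <;>
        first | rfl | (exfalso; simp [ptE] at hr hi; try linarith)
    · intro (k : Fin 6) (l : Fin 6) h
      change figVtx q r (hexSide k) = figVtx q r (hexSide l) at h
      rw [figVtx_hex, figVtx_hex] at h
      have hr := congrArg Complex.re h
      have hi := congrArg Complex.im h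
      clear h
      fin_cases k <;> fin_cases l <;>
        first | rfl | (exfalso; simp [ptB, ptC] at hr hi; try linarith)
  · intro i
    obtain rfl | rfl := fin_two i
    · intro (k : Fin 4) (l : Fin 4)
      change 0 ≤ cross (figVtx q r (figPattern.next (parSide k)) - figVtx q r (parSide k))
        (figVtx q r (parSide l) - figVtx q r (parSide k))
      rw [parSide_next, figVtx_par, figVtx_par, figVtx_par]
      fin_cases k <;> fin_cases l <;> simp [cross, ptE] <;> nlinarith
    · intro (k : Fin 6) (l : Fin 6)
      change 0 ≤ cross (figVtx q r (figPattern.next (hexSide k)) - figVtx q r (hexSide k))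
        (figVtx q r (hexSide l) - figVtx q r (hexSide k))
      rw [hexSide_next, figVtx_hex, figVtx_hex, figVtx_hex]
      fin_cases k <;> fin_cases l <;> simp [cross, ptB, ptC] <;> nlinarith
  · intro i
    obtain rfl | rfl := fin_two i
    · intro (k : Fin 4)
      refine ⟨(k + 2 : Fin 4), ?_⟩
      change 0 < cross (figVtx q r (figPattern.next (parSide k)) - figVtx q r (parSide k))
        (figVtx q r (parSide (k + 2)) - figVtx q r (parSide k))
      rw [parSide_next, figVtx_par, figVtx_par, figVtx_par]
      fin_cases k <;> simp [cross, ptE] <;> nlinarith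
    · intro (k : Fin 6)
      refine ⟨(k + 3 : Fin 6), ?_⟩
      change 0 < cross (figVtx q r (figPattern.next (hexSide k)) - figVtx q r (hexSide k))
        (figVtx q r (hexSide (k + 3)) - figVtx q r (hexSide k))
      rw [hexSide_next, figVtx_hex, figVtx_hex, figVtx_hex]
      fin_cases k <;> simp [cross, ptB, ptC] <;> nlinarith
  · rintro ⟨i, k⟩
    obtain rfl | rfl := fin_two i
    · change Fin 4 at k
      change figVtx q r (figPattern.next (figPattern.glue (parSide k))) -
        figVtx q r (figPattern.glue (parSide k)) =
          -(figVtx q r (figPattern.next (parSide k)) - figVtx q r (parSide k))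
      rw [figPattern_glue_par, parSide_next]
      fin_cases k <;> apply Complex.ext <;>
        simp [parSide_next, hexSide_next, figVtx_par, figVtx_hex, ptE, ptB, ptC] <;> ring
    · change Fin 6 at k
      change figVtx q r (figPattern.next (figPattern.glue (hexSide k))) -
        figVtx q r (figPattern.glue (hexSide k)) =
          -(figVtx q r (figPattern.next (hexSide k)) - figVtx q r (hexSide k))
      rw [figPattern_glue_hex, hexSide_next]
      fin_cases k <;> apply Complex.ext <;>
        simp [parSide_next, hexSide_next, figVtx_par, figVtx_hex, ptE, ptB, ptC] <;> ring

lemma fig_connected (q r : ℝ) :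
    ConnectedSpace (Gluing.Pt ⟨figPattern, figVtx q r, fig_admissible q r⟩) := by
  refine Gluing.connectedSpace_of_common _ (Gluing.start _ (parSide 0)) fun i => ?_
  obtain rfl | rfl := fin_two i
  · exact ⟨_, rfl⟩
  · refine ⟨⟨figVtx q r (hexSide 4), subset_convexHull ℝ _ ⟨(4 : Fin 6), rfl⟩⟩,
      Eq.symm (Quot.sound ?_)⟩
    exact ⟨(0 : Fin 4), (3 : Fin 6), rfl, left_mem_segment ℝ _ _, by
      change figVtx q r (hexSide 4) - figVtx q r (figPattern.next (hexSide 3)) =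
        figVtx q r (parSide 0) - figVtx q r (parSide 0)
      rw [hexSide_next, sub_self]; exact sub_self _⟩

/-- The surface with `P` at `q + 1` and `P'` at `r`. -/
def fig (q r : ℝ) : Surface := ⟨⟨figPattern, figVtx q r, fig_admissible q r⟩, fig_connected q r⟩

lemma circ_pos : 0 < 2 + √2 := by positivity

lemma circ_pos' : 0 < 1 + √2 := by positivity

/-- The position of `Pₙ` on `B'D = [0, 2 + √2]`, with `0` and `2 + √2` identified: it is `n + 1` modulo
`2 + √2`. -/
def posP (n : ℤ) : ℝ := toIcoMod circ_pos 0 (n + 1)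

/-- The position of `Pₙ'` on `A'D' = [0, 1 + √2]`, with `0` and `1 + √2` identified: it is `n` modulo
`1 + √2`. -/
def posP' (n : ℤ) : ℝ := toIcoMod circ_pos' 0 n

/-- The explicit gluing pattern of the `n`-th surface; the point `Q` is `Pₙ₋₁`. -/
def Oct (n : ℤ) : Surface := fig (posP (n - 1)) (posP' n)

/-- The segment `Pₙ₋₁B` in `Oct n`. -/
def segQB (n : ℤ) : Set (Oct n).1.Pt := (Oct n).1.chord (1 : Fin 2) (posP (n - 1) : ℝ) ptB

/-- The segment `Pₙ₋₁C` in `Oct n`. -/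
def segQC (n : ℤ) : Set (Oct n).1.Pt := (Oct n).1.chord (1 : Fin 2) (posP (n - 1) : ℝ) ptC

/-- The segment `PₙB` in `Oct n`. -/
def segPB (n : ℤ) : Set (Oct n).1.Pt := (Oct n).1.chord (1 : Fin 2) (posP (n - 1) + 1 : ℝ) ptB

/-- The segment `PₙC` in `Oct n`. -/
def segPC (n : ℤ) : Set (Oct n).1.Pt := (Oct n).1.chord (1 : Fin 2) (posP (n - 1) + 1 : ℝ) ptC

end TranslationSurface

end

open TranslationSurface

/-!
All surfaces involved have the same shape: two horizontal cylinders, of heights `1` and `√2 / 2` and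
circumferences `1 + √2` and `2 + √2`, glued along their boundaries with two twist parameters `r` and
`q`. The structure `Cyl Y q r` records that `Y` is such a surface. It presents `Y` as a universal
quotient of two closed strips, whose identifications are those of `Respects q r`, rather than as a
particular set of polygons. Universality makes two surfaces with the same parameters isomorphic
(`Cyl.exists_iso`), and the parameters matter only modulo the circumferences (`Cyl.shift`). So
isomorphisms need no cutting and pasting of polygons: the octagon, the surface `fig q r`, and the
same surface cut along other slits are compared through their strips, which are put together from
their polygons by `Cyl.ofSlabs`.

*Surgeries.* A surface with parameters `q`, `r`, cut so that both twins of the unit saddle connection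
are sides of the polygons, becomes after the left surgery a surface with parameters `q + 1`, `r + 1`,
and after the right surgery one with parameters `q - 1`, `r - 1` (`leftCylAux`, `rightCylAux`). The
octagon has parameters `0`, `0` (`octagonCyl`), and `Oct n` has parameters `n`, `n`.

*Singular points and systoles.* A predicate on the strips that respects the identifications descends
to the surface. This determines which points of the strips represent the vertex, and shows that the
vertex is the only singular point (`Cyl.singular_iff`). A saddle connection of length less than `1`
is too short to run along the boundaries or to cross the strip of height `1`, so it crosses the strip
of height `√2 / 2` (`Cyl.saddle_short`). The short saddle connections are therefore found from `q` alone. The three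
systole configurations occur for `n = 1, 2, 3`, with `Pₙ` at the positions `2`, `3` and `2 - √2`.

*Absolute periods.* Raising both parameters by `1` is realized by a homeomorphism that shears both
cylinders by one unit along the long gluing between them, composed with a Dehn twist about the unit
saddle connection, which is a closed curve (`Cyl.twist`). The Dehn twist rotates the loops that
surround the saddle connection by an amount decreasing from a full turn to zero. In local coordinates
the homeomorphism is `w ↦ w + H w` with one continuous function `H` on the whole surface, because the
full turn along the unit saddle connection cancels the unit shift of the shear. Such a homeomorphism
preserves the holonomy of every closed curve (`Cyl.isoperiodic_of_locDisp`). Hence every `Oct n` with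
`n ≥ 0` has the absolute periods of the octagon.

*Recurrence.* Rational approximation of `√2` gives arbitrarily large `N` that are simultaneously close
to multiples of `2 + √2` and of `1 + √2` (`exists_almost_period`), as both numbers divide `2` in
`ℤ[√2]`. The vertices of `fig q r` depend continuously on `q` and `r`, so `Oct (m + N)` is close to
`Oct m`. The two surfaces differ, because the real parts of the short saddle connections move with `q`
(`Cyl.exists_not_iso`), and `Oct (m + N)` is not the octagon, because it has saddle connections
shorter than `1`. Density of the positions of `Pₙ` is the irrationality of `2 + √2`.
-/

noncomputable section

namespace TranslationSurface

/-! ### Convex polygons: distinct sides meet only at vertices -/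

lemma exists_real_of_cross_eq_zero {u x a : ℂ} (hu : u ≠ 0) (h : cross u (x - a) = 0) :
    ∃ t : ℝ, x = a + t * u := by
  refine ⟨((x - a) * (starRingEnd ℂ) u).re / Complex.normSq u, ?_⟩
  have hn : Complex.normSq u ≠ 0 := by simpa using hu
  rw [cross] at h
  have hn' := Complex.normSq_apply u
  apply Complex.ext
  · simp at h ⊢; field_simp; rw [hn']; linear_combination (-u.im) * h
  · simp at h ⊢; field_simp; rw [hn']; linear_combination u.re * h

section Polygon

variable {n : ℕ} {V : Fin n → ℂ} (inj : Function.Injective V)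
  (convex : ∀ k l, 0 ≤ cross (V (finRotate n k) - V k) (V l - V k))
  (nondeg : ∀ k, ∃ l, 0 < cross (V (finRotate n k) - V k) (V l - V k))

include nondeg in
/-- Sides on a common supporting line have the same direction. -/
lemma pos_of_collinear {k : Fin n} {u a : ℂ} {s t : ℝ} (hu : ∀ l, 0 ≤ cross u (V l - a))
    (hk : V k = a + s * u) (hm : V (finRotate n k) = a + t * u) : s < t := by
  obtain ⟨l, hl⟩ := nondeg k
  have h1 := hu l
  have e : cross (V (finRotate n k) - V k) (V l - V k) = (t - s) * cross u (V l - a) := by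
    rw [hk, hm]; simp [cross]; ring
  rw [e] at hl
  by_contra hst
  have : (t - s) * cross u (V l - a) ≤ 0 := mul_nonpos_of_nonpos_of_nonneg (by linarith) h1
  linarith

include inj convex nondeg in
/-- On a line that carries a side, no vertex lies in the open interior of a side: of all vertices
that do, the first one `w` has a predecessor on the line, and either this predecessor or the
initial vertex of the side around `w` is an earlier one. -/
lemma no_vertex_inside {u a : ℂ} (hu0 : u ≠ 0) (hu : ∀ l, 0 ≤ cross u (V l - a)) (w m : Fin n)
    (x y z : ℝ) (hm : V m = a + x * u) (hw : V w = a + y * u)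
    (hm' : V (finRotate n m) = a + z * u) (hxy : x < y) (hyz : y < z) : False := by
  classical
  have uniq : ∀ s t : ℝ, a + s * u = a + t * u → s = t := fun s t h => by
    have h' : ((s : ℂ)) * u = t * u := add_left_cancel h
    exact_mod_cast mul_right_cancel₀ hu0 h'
  let W : Set (Fin n) := {w | ∃ m, ∃ x y z : ℝ, V m = a + x * u ∧ V w = a + y * u ∧
    V (finRotate n m) = a + z * u ∧ x < y ∧ y < z}
  have hpos : ∀ w y, V w = a + (y : ℝ) * u →
      (((V w - a) * (starRingEnd ℂ) u).re = y * Complex.normSq u) := by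
    intro w y h
    rw [h, Complex.normSq_apply]; simp; ring
  have hN : 0 < Complex.normSq u := Complex.normSq_pos.2 hu0
  obtain ⟨w, hwW, hmin⟩ := (Set.toFinite W).exists_minimalFor
    (fun w => ((V w - a) * (starRingEnd ℂ) u).re) W ⟨w, m, x, y, z, hm, hw, hm', hxy, hyz⟩
  obtain ⟨m, x, y, z, hm, hw, hm', hxy, hyz⟩ := hwW
  have hmin' : ∀ w' ∈ W, ∀ y', V w' = a + (y' : ℝ) * u → y ≤ y' := by
    intro w' hw' y' h'
    by_contra hlt
    push Not at hlt
    have := hmin hw' (by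
      simp only [hpos w y hw, hpos w' y' h']
      exact mul_le_mul_of_nonneg_right hlt.le hN.le)
    simp only [hpos w y hw, hpos w' y' h'] at this
    nlinarith
  obtain ⟨e, rfl⟩ := (finRotate n).surjective w
  have h1 := convex e m
  have h2 := convex e (finRotate n m)
  have hc : cross (V (finRotate n e) - V e) u = 0 := by
    have e1 : cross (V (finRotate n e) - V e) (V m - V e) =
        (x - y) * cross (V (finRotate n e) - V e) u := by
      rw [hm, hw]; simp [cross]; ring
    have e2 : cross (V (finRotate n e) - V e) (V (finRotate n m) - V e) =
        (z - y) * cross (V (finRotate n e) - V e) u := by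
      rw [hm', hw]; simp [cross]; ring
    rw [e1] at h1; rw [e2] at h2
    apply le_antisymm
    · by_contra h; push Not at h; nlinarith
    · by_contra h; push Not at h; nlinarith
  have hc' : cross u (V e - a) = 0 := by
    rw [hw] at hc; simp [cross] at hc ⊢; linarith
  obtain ⟨t, ht⟩ := exists_real_of_cross_eq_zero hu0 hc'
  have hty : t < y := pos_of_collinear nondeg hu ht hw
  rcases lt_trichotomy x t with h | h | h
  · have := hmin' e ⟨m, x, t, z, hm, ht, hm', h, by linarith⟩ t ht
    linarith
  · have : e = m := inj (by rw [ht, hm, h])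
    rw [this] at hw
    have := uniq _ _ (hw.symm.trans hm')
    linarith
  · have := hmin' m ⟨e, t, x, y, ht, hm, hw, h, hxy⟩ x hm
    linarith

include inj convex nondeg in
lemma sides_inter {k l : Fin n} (hkl : k ≠ l) {x : ℂ}
    (hx : x ∈ segment ℝ (V k) (V (finRotate n k)))
    (hx' : x ∈ segment ℝ (V l) (V (finRotate n l))) : x = V k ∨ x = V (finRotate n k) := by
  by_contra hne
  push Not at hne
  obtain ⟨α, τ, hα, hτ, h1, rfl⟩ := hx
  obtain ⟨β, σ, hβ, hσ, h2, e⟩ := hx'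
  set a := V k with ha
  set u := V (finRotate n k) - V k with hu
  have hu' : ∀ l, 0 ≤ cross u (V l - a) := convex k
  have hb : V (finRotate n k) = a + (1 : ℝ) * u := by simp [hu, ha]
  have ha0 : V k = a + (0 : ℝ) * u := by simp [ha]
  have hu0 : u ≠ 0 := by
    intro h
    obtain ⟨l, hl⟩ := nondeg k
    rw [← hu, h] at hl; simp [cross] at hl
  have hxe : α • a + τ • V (finRotate n k) = a + τ * u := by
    rw [hb, show α = 1 - τ by linarith]; simp; ring
  rw [hxe] at hne e
  have hτ0 : 0 < τ := lt_of_le_of_ne hτ fun h => hne.1 (by simp [← h])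
  have hτ1 : τ < 1 := lt_of_le_of_ne (by linarith) fun h => hne.2 (by rw [hb, h])
  have hcr : β * cross u (V l - a) + σ * cross u (V (finRotate n l) - a) = 0 := by
    have : cross u ((β • V l + σ • V (finRotate n l)) - a) = 0 := by
      rw [e]; simp [cross]; ring
    rw [← this]
    simp [cross]
    linear_combination (u.re * a.im - u.im * a.re) * (-h2)
  have p1 := hu' l
  have p2 := hu' (finRotate n l)
  have q1 := mul_nonneg hβ p1
  have q2 := mul_nonneg hσ p2
  have bad : ∀ m : Fin n, ∀ y : ℝ, V m = a + y * u → 0 < y → y < 1 → False := fun m y h h0 h1 =>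
    no_vertex_inside inj convex nondeg hu0 hu' m k 0 y 1 ha0 h hb h0 h1
  rcases hβ.eq_or_lt with hβ0 | hβ0
  · have hs : σ = 1 := by linarith
    rw [← hβ0, hs] at e; simp at e
    exact bad _ _ e hτ0 hτ1
  rcases hσ.eq_or_lt with hσ0 | hσ0
  · have hs : β = 1 := by linarith
    rw [← hσ0, hs] at e; simp at e
    exact bad _ _ e hτ0 hτ1
  have c1 : cross u (V l - a) = 0 := by
    have : β * cross u (V l - a) = 0 := by linarith
    simpa [hβ0.ne'] using this
  have c2 : cross u (V (finRotate n l) - a) = 0 := by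
    have : σ * cross u (V (finRotate n l) - a) = 0 := by linarith
    simpa [hσ0.ne'] using this
  obtain ⟨y, hy⟩ := exists_real_of_cross_eq_zero hu0 c1
  obtain ⟨z, hz⟩ := exists_real_of_cross_eq_zero hu0 c2
  have hyz : y < z := pos_of_collinear nondeg hu' hy hz
  have ht : τ = β * y + σ * z := by
    rw [hy, hz] at e
    have e' : ((β * y + σ * z : ℝ) : ℂ) * u = (τ : ℂ) * u := by
      have : ((β + σ : ℝ) : ℂ) = 1 := by rw [h2]; simp
      push_cast at this ⊢
      simp only [Complex.real_smul] at e
      linear_combination e - a * this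
    exact (by exact_mod_cast mul_right_cancel₀ hu0 e' : β * y + σ * z = τ).symm
  have l1 : y < τ := by rw [ht]; nlinarith
  have l2 : τ < z := by rw [ht]; nlinarith
  have y0 : y ≤ 0 := by
    by_contra h; push Not at h
    exact bad l y hy h (l1.trans hτ1)
  rcases y0.eq_or_lt with h | h
  · exact hkl (inj (by rw [hy, h, ← ha0]))
  · exact no_vertex_inside inj convex nondeg hu0 hu' k l y 0 z hy ha0 hz h (hτ0.trans l2)

end Polygon

namespace Gluing

/-! ### The fibres of the quotient map -/

/-- A point of the disjoint union of the polygons that is a vertex of its polygon. -/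
def IsVtx (X : Gluing) (a : X.PrePt) : Prop := ∃ k, (a.2 : ℂ) = X.vtx ⟨a.1, k⟩

/-- Position of a point of a polygon in the plane. -/
def pos (X : Gluing) (a : X.PrePt) : ℂ := a.2

lemma mk_surj (X : Gluing) (p : X.Pt) : ∃ i x, X.mk i x = p := by
  induction p using Quot.ind with
  | mk a => exact ⟨a.1, a.2, rfl⟩

lemma Glued.symm {X : Gluing} {a b : X.PrePt} (h : X.Glued a b) : X.Glued b a := by
  obtain ⟨k, l, hg, ⟨α, τ, hα, hτ, h1, e⟩, hb⟩ := h
  have hv := X.2.2.glue ⟨a.1, k⟩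
  rw [hg] at hv
  change X.vtx (X.1.next ⟨b.1, l⟩) - X.vtx ⟨b.1, l⟩ =
    -(X.vtx (X.1.next ⟨a.1, k⟩) - X.vtx ⟨a.1, k⟩) at hv
  have h1' : (α : ℂ) + τ = 1 := by exact_mod_cast h1
  simp only [Complex.real_smul] at e
  refine ⟨l, k, by rw [← hg, X.1.glue_glue], ⟨τ, α, hτ, hα, by linarith, ?_⟩, ?_⟩
  · simp only [Complex.real_smul]
    linear_combination (-1 : ℂ) * hb + e - (τ : ℂ) * hv +
      (X.vtx (X.1.next ⟨b.1, l⟩) - X.vtx ⟨a.1, k⟩) * h1'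
  · linear_combination (-1 : ℂ) * hb - hv

lemma side_inter (X : Gluing) (i : Fin X.1.n) {k l : Fin (X.1.sides i)} (hkl : k ≠ l) {x : ℂ}
    (hx : x ∈ segment ℝ (X.vtx ⟨i, k⟩) (X.vtx (X.1.next ⟨i, k⟩)))
    (hx' : x ∈ segment ℝ (X.vtx ⟨i, l⟩) (X.vtx (X.1.next ⟨i, l⟩))) :
    x = X.vtx ⟨i, k⟩ ∨ x = X.vtx (X.1.next ⟨i, k⟩) :=
  sides_inter (X.2.2.inj i) (X.2.2.convex i) (X.2.2.nondeg i) hkl hx hx'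

lemma Glued.isVtx {X : Gluing} {a b : X.PrePt} (h : X.Glued a b) (ha : X.IsVtx a) :
    X.IsVtx b := by
  obtain ⟨k, l, hg, hs, hb⟩ := h
  have hv := X.2.2.glue ⟨a.1, k⟩
  rw [hg] at hv
  change X.vtx (X.1.next ⟨b.1, l⟩) - X.vtx ⟨b.1, l⟩ =
    -(X.vtx (X.1.next ⟨a.1, k⟩) - X.vtx ⟨a.1, k⟩) at hv
  have key : (a.2 : ℂ) = X.vtx ⟨a.1, k⟩ ∨ (a.2 : ℂ) = X.vtx (X.1.next ⟨a.1, k⟩) := by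
    obtain ⟨m, hm⟩ := ha
    by_cases hkm : k = m
    · left; rw [hm, hkm]
    · refine X.side_inter a.1 hkm hs ?_
      rw [hm]; exact left_mem_segment ℝ _ _
  rcases key with h | h
  · exact ⟨finRotate _ l, by rw [h] at hb; exact sub_eq_zero.1 (hb.trans (sub_self _))⟩
  · refine ⟨l, ?_⟩
    rw [h] at hb
    linear_combination hb + hv

/-- A point that is not a vertex is glued to at most one point, as distinct sides of a polygon meet only
at vertices. -/
lemma Glued.unique {X : Gluing} {a b c : X.PrePt} (hb : X.Glued a b) (hc : X.Glued a c)
    (ha : ¬ X.IsVtx a) : b = c := by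
  obtain ⟨k, l, hg, hs, hb⟩ := hb
  obtain ⟨k', l', hg', hs', hc⟩ := hc
  by_cases hk : k = k'
  · subst hk
    rw [hg] at hg'
    obtain ⟨j, y⟩ := b
    obtain ⟨j', y'⟩ := c
    simp only at hb hc hg hg'
    obtain ⟨rfl, h⟩ := Sigma.mk.inj_iff.1 hg'
    obtain rfl := eq_of_heq h
    congr 1
    apply Subtype.ext
    linear_combination hb - hc
  · rcases X.side_inter a.1 hk hs hs' with h | h
    · exact absurd ⟨_, h⟩ ha
    · exact absurd ⟨_, h⟩ ha

/-- Away from the vertices the gluing is already an equivalence relation. -/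
lemma eq_or_glued {X : Gluing} {a b : X.PrePt} (h : (Quot.mk X.Glued a) = Quot.mk X.Glued b) :
    a = b ∨ X.Glued a b ∨ (X.IsVtx a ∧ X.IsVtx b) := by
  replace h := Quot.eqvGen_exact h
  induction h with
  | rel a b h => exact Or.inr (Or.inl h)
  | refl a => exact Or.inl rfl
  | symm a b h ih =>
    rcases ih with h | h | h
    · exact Or.inl h.symm
    · exact Or.inr (Or.inl h.symm)
    · exact Or.inr (Or.inr h.symm)
  | trans a b c h h' ih ih' =>
    rcases ih with rfl | h1 | h1 <;>
      rcases ih' with rfl | h2 | h2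
    · exact Or.inl rfl
    · exact Or.inr (Or.inl h2)
    · exact Or.inr (Or.inr h2)
    · exact Or.inr (Or.inl h1)
    · by_cases hv : X.IsVtx b
      · exact Or.inr (Or.inr ⟨h1.symm.isVtx hv, h2.isVtx hv⟩)
      · exact Or.inl (h1.symm.unique h2 hv)
    · exact Or.inr (Or.inr ⟨h1.symm.isVtx h2.1, h2.2⟩)
    · exact Or.inr (Or.inr h1)
    · exact Or.inr (Or.inr ⟨h1.1, h2.isVtx h1.2⟩)
    · exact Or.inr (Or.inr ⟨h1.1, h2.2⟩)

lemma finite_vtx (X : Gluing) : {a | X.IsVtx a}.Finite := by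
  refine (finite_range fun s : X.1.Side => (⟨s.1, ⟨X.vtx s, X.vtx_mem s⟩⟩ : X.PrePt)).subset ?_
  rintro ⟨i, x⟩ ⟨k, hk⟩
  exact ⟨⟨i, k⟩, by
    have : (⟨X.vtx ⟨i, k⟩, X.vtx_mem ⟨i, k⟩⟩ : X.poly i) = x := Subtype.ext hk.symm
    exact congrArg (Sigma.mk i) this⟩

lemma finite_fibre (X : Gluing) (p : X.Pt) : {a : X.PrePt | Quot.mk X.Glued a = p}.Finite := by
  induction p using Quot.ind with
  | mk a =>
  have hs : {b | X.Glued a b ∧ ¬ X.IsVtx a}.Subsingleton := fun b hb c hc => hb.1.unique hc.1 hb.2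
  refine (((finite_singleton a).union hs.finite).union X.finite_vtx).subset fun b hb => ?_
  rcases eq_or_glued (hb : Quot.mk X.Glued b = Quot.mk X.Glued a) with h | h | h
  · exact Or.inl (Or.inl h)
  · by_cases hv : X.IsVtx a
    · exact Or.inr (h.symm.isVtx hv)
    · exact Or.inl (Or.inr ⟨h.symm, hv⟩)
  · exact Or.inr h.1

/-! ### The topology of the surface -/

instance (X : Gluing) (i : Fin X.1.n) : CompactSpace (X.poly i) :=
  isCompact_iff_compactSpace.1 ((finite_range _).isCompact_convexHull ℝ)

lemma continuous_pos (X : Gluing) : Continuous X.pos :=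
  continuous_sigma fun _ => continuous_subtype_val

lemma isClopen_idx (X : Gluing) (i : Fin X.1.n) : IsClopen {a : X.PrePt | a.1 = i} := by
  have : {a : X.PrePt | a.1 = i} = range (Sigma.mk i) := by
    ext ⟨j, x⟩
    constructor
    · rintro rfl; exact ⟨x, rfl⟩
    · rintro ⟨y, hy⟩; exact (congrArg Sigma.fst hy).symm
  rw [this]
  exact ⟨isClosed_range_sigmaMk, isOpen_range_sigmaMk⟩

lemma isClosed_glued (X : Gluing) : IsClosed {ab : X.PrePt × X.PrePt | X.Glued ab.1 ab.2} := by
  have : {ab : X.PrePt × X.PrePt | X.Glued ab.1 ab.2} = ⋃ s : X.1.Side,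
      {ab | ab.1.1 = s.1 ∧ ab.2.1 = (X.1.glue s).1 ∧
        X.pos ab.1 ∈ segment ℝ (X.vtx s) (X.vtx (X.1.next s)) ∧
        X.pos ab.2 - X.vtx (X.1.next (X.1.glue s)) = X.pos ab.1 - X.vtx s} := by
    ext ⟨a, b⟩
    simp only [mem_ofPred_eq, mem_iUnion]
    constructor
    · rintro ⟨k, l, hg, hs, hb⟩
      exact ⟨⟨a.1, k⟩, rfl, by rw [hg], hs, by rw [hg]; exact hb⟩
    · obtain ⟨i, x⟩ := a
      obtain ⟨j, y⟩ := b
      rintro ⟨⟨i', k⟩, h1, h2, hs, hb⟩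
      simp only at h1 h2
      subst h1
      subst h2
      exact ⟨k, _, rfl, hs, hb⟩
  rw [this]
  refine isClosed_iUnion_of_finite fun s => ?_
  have c1 : Continuous fun ab : X.PrePt × X.PrePt => X.pos ab.1 := X.continuous_pos.comp continuous_fst
  have c2 : Continuous fun ab : X.PrePt × X.PrePt => X.pos ab.2 := X.continuous_pos.comp continuous_snd
  refine ((X.isClopen_idx s.1).1.preimage continuous_fst).inter
    (((X.isClopen_idx _).1.preimage continuous_snd).inter (IsClosed.inter ?_ ?_))
  · have hc : IsClosed (segment ℝ (X.vtx s) (X.vtx (X.1.next s))) := by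
      rw [← convexHull_pair]
      exact (((finite_singleton _).insert _).isCompact_convexHull ℝ).isClosed
    exact hc.preimage c1
  · exact isClosed_eq (by fun_prop) (by fun_prop)

/-- The identifications form a closed relation, because all but finitely many of them are gluings of
sides. -/
lemma isClosed_ker (X : Gluing) :
    IsClosed {ab : X.PrePt × X.PrePt | Quot.mk X.Glued ab.1 = Quot.mk X.Glued ab.2} := by
  have : {ab : X.PrePt × X.PrePt | Quot.mk X.Glued ab.1 = Quot.mk X.Glued ab.2} =
      ({ab | ab.1 = ab.2} ∪ {ab | X.Glued ab.1 ab.2}) ∪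
        (({a | X.IsVtx a} ×ˢ {a | X.IsVtx a}) ∩
          {ab | Quot.mk X.Glued ab.1 = Quot.mk X.Glued ab.2}) := by
    ext ⟨a, b⟩
    constructor
    · intro h
      rcases eq_or_glued h with h' | h' | h'
      · exact Or.inl (Or.inl h')
      · exact Or.inl (Or.inr h')
      · exact Or.inr ⟨h', h⟩
    · rintro ((h | h) | h)
      · exact congrArg _ h
      · exact Quot.sound h
      · exact h.2
  rw [this]
  exact ((isClosed_eq continuous_fst continuous_snd).union X.isClosed_glued).union
    ((X.finite_vtx.prod X.finite_vtx).inter_of_left _).isClosed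

lemma isClosedMap_quot (X : Gluing) : IsClosedMap (Quot.mk X.Glued) := by
  intro C hC
  refine isQuotientMap_quot_mk.isClosed_preimage.1 ?_
  have : Quot.mk X.Glued ⁻¹' (Quot.mk X.Glued '' C) = Prod.snd ''
      ((C ×ˢ univ) ∩ {ab : X.PrePt × X.PrePt | Quot.mk X.Glued ab.1 = Quot.mk X.Glued ab.2}) := by
    ext b
    constructor
    · rintro ⟨a, ha, h⟩; exact ⟨⟨a, b⟩, ⟨⟨ha, trivial⟩, h⟩, rfl⟩
    · rintro ⟨⟨a, b'⟩, ⟨⟨ha, -⟩, h⟩, rfl⟩; exact ⟨a, ha, h⟩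
  rw [this]
  exact ((((hC.prod isClosed_univ).inter X.isClosed_ker).isCompact).image continuous_snd).isClosed

/-- Every neighbourhood of a fibre contains the preimage of a neighbourhood. -/
lemma nhds_of_fibre (X : Gluing) {p : X.Pt} {O : Set X.PrePt} (hO : IsOpen O)
    (h : ∀ a, Quot.mk X.Glued a = p → a ∈ O) : ∃ V, IsOpen V ∧ p ∈ V ∧
      ∀ a, Quot.mk X.Glued a ∈ V → a ∈ O := by
  refine ⟨(Quot.mk X.Glued '' Oᶜ)ᶜ, (X.isClosedMap_quot _ hO.isClosed_compl).isOpen_compl, ?_, ?_⟩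
  · rintro ⟨a, ha, rfl⟩; exact ha (h a rfl)
  · intro a ha; by_contra hn; exact ha ⟨a, hn, rfl⟩

instance (X : Gluing) : T2Space X.Pt := by
  refine ⟨fun p q hpq => ?_⟩
  have hd : Disjoint {a : X.PrePt | Quot.mk X.Glued a = p} {a | Quot.mk X.Glued a = q} :=
    disjoint_left.2 fun a h h' => hpq (h.symm.trans h')
  obtain ⟨U, V, hU, hV, h1, h2, h3⟩ := SeparatedNhds.of_finite (X.finite_fibre p)
    (X.finite_fibre q) hd
  obtain ⟨U', hU', hp, hU2⟩ := X.nhds_of_fibre hU h1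
  obtain ⟨V', hV', hq, hV2⟩ := X.nhds_of_fibre hV h2
  refine ⟨U', V', hU', hV', hp, hq, disjoint_left.2 fun x hx hx' => ?_⟩
  induction x using Quot.ind with
  | mk a => exact disjoint_left.1 h3 (hU2 a hx) (hV2 a hx')

/-- A property of short vectors that holds near each point of a fibre holds uniformly. -/
lemma exists_uniform (X : Gluing) (p : X.Pt) {P : X.PrePt → ℂ → Prop}
    (h : ∀ a : X.PrePt, Quot.mk X.Glued a = p → ∃ ε > 0, ∀ z, ‖z‖ < ε → P a z) :
    ∃ ε > 0, ∀ a : X.PrePt, Quot.mk X.Glued a = p → ∀ z, ‖z‖ < ε → P a z := by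
  have : ∀ᶠ z in 𝓝 (0 : ℂ), ∀ a ∈ {a : X.PrePt | Quot.mk X.Glued a = p}, P a z := by
    rw [Filter.eventually_all_finite (X.finite_fibre p)]
    intro a ha
    obtain ⟨ε, hε, h⟩ := h a ha
    filter_upwards [Metric.ball_mem_nhds (0 : ℂ) hε] with z hz
    exact h z (by simpa using hz)
  obtain ⟨ε, hε, h⟩ := Metric.eventually_nhds_iff.1 this
  exact ⟨ε, hε, fun a ha z hz => h (by simpa using hz) a ha⟩

/-- The points reached by short vectors form a basis of neighbourhoods. -/
lemma mem_nhds_iff_disp (X : Gluing) {p : X.Pt} {U : Set X.Pt} :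
    U ∈ 𝓝 p ↔ ∃ ε > 0, ∀ q z, ‖z‖ < ε → X.Disp p q z → q ∈ U := by
  constructor
  · intro hU
    obtain ⟨ε, hε, h⟩ := X.exists_uniform p
      (P := fun a z => ∀ y : X.poly a.1, (y : ℂ) - a.2 = z → X.mk a.1 y ∈ U) (by
        rintro ⟨i, x⟩ rfl
        have hc : Continuous (X.mk i) := continuous_quot_mk.comp continuous_sigmaMk
        obtain ⟨ε, hε, h⟩ := Metric.mem_nhds_iff.1 (hc.continuousAt.preimage_mem_nhds hU)
        refine ⟨ε, hε, fun z hz y hy => h ?_⟩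
        rw [Metric.mem_ball, Subtype.dist_eq, dist_eq_norm, hy]
        exact hz)
    refine ⟨ε, hε, fun q z hz ⟨i, x, y, hx, hy, hxy⟩ => ?_⟩
    rw [← hy]
    exact h ⟨i, x⟩ hx z hz y hxy
  · rintro ⟨ε, hε, h⟩
    let O : Set X.PrePt := ⋃ a ∈ {a : X.PrePt | Quot.mk X.Glued a = p},
      {b | b.1 = a.1} ∩ {b | ‖X.pos b - X.pos a‖ < ε}
    have hO : IsOpen O := isOpen_biUnion fun a _ => (X.isClopen_idx a.1).2.inter
      (isOpen_lt ((X.continuous_pos.sub continuous_const).norm) continuous_const)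
    obtain ⟨V, hV, hp, hV2⟩ := X.nhds_of_fibre hO fun a ha =>
      mem_biUnion (show a ∈ {a : X.PrePt | Quot.mk X.Glued a = p} from ha)
        ⟨rfl, by simpa using hε⟩
    refine mem_of_superset (hV.mem_nhds hp) fun q hq => ?_
    induction q using Quot.ind with
    | mk b =>
    obtain ⟨a, ha, h1, h2⟩ := mem_iUnion₂.1 (hV2 b hq)
    obtain ⟨i, x⟩ := a
    obtain ⟨j, y⟩ := b
    obtain rfl : j = i := h1
    exact h _ ((y : ℂ) - x) h2 ⟨j, x, y, ha, rfl, rfl⟩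

/-! ### Isomorphisms -/

/-- A homeomorphism that is locally a translation. -/
def IsTranslation {X Y : Gluing} (f : X.Pt ≃ₜ Y.Pt) : Prop :=
  ∀ p, ∃ ε > 0, ∀ q z, ‖z‖ < ε → (X.Disp p q z ↔ Y.Disp (f p) (f q) z)

lemma IsTranslation.iso {X Y : Gluing} {f : X.Pt ≃ₜ Y.Pt} (h : IsTranslation f) : Iso X Y := ⟨f, h⟩

lemma IsTranslation.symm {X Y : Gluing} {f : X.Pt ≃ₜ Y.Pt} (h : IsTranslation f) :
    IsTranslation f.symm := by
  intro p
  obtain ⟨ε, hε, h⟩ := h (f.symm p)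
  refine ⟨ε, hε, fun q z hz => ?_⟩
  simpa using (h (f.symm q) z hz).symm

/-- A bijection that, together with its inverse, preserves short displacements is an isomorphism:
continuity is automatic. -/
lemma exists_isTranslation {X Y : Gluing} (f : X.Pt ≃ Y.Pt)
    (hf : ∀ p, ∃ ε > 0, ∀ q z, ‖z‖ < ε → X.Disp p q z → Y.Disp (f p) (f q) z)
    (hg : ∀ p, ∃ ε > 0, ∀ q z, ‖z‖ < ε → Y.Disp p q z → X.Disp (f.symm p) (f.symm q) z) :
    ∃ F : X.Pt ≃ₜ Y.Pt, (∀ p, F p = f p) ∧ IsTranslation F := by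
  have key : ∀ {X Y : Gluing} (f : X.Pt → Y.Pt)
      (_ : ∀ p, ∃ ε > 0, ∀ q z, ‖z‖ < ε → X.Disp p q z → Y.Disp (f p) (f q) z), Continuous f := by
    intro X Y f hf
    refine continuous_iff_continuousAt.2 fun p U hU => ?_
    obtain ⟨ε, hε, h⟩ := Y.mem_nhds_iff_disp.1 hU
    obtain ⟨δ, hδ, h'⟩ := hf p
    refine X.mem_nhds_iff_disp.2 ⟨min ε δ, lt_min hε hδ, fun q z hz hd => ?_⟩
    exact h _ z (hz.trans_le (min_le_left _ _)) (h' q z (hz.trans_le (min_le_right _ _)) hd)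
  refine ⟨⟨f, key f hf, key f.symm hg⟩, fun _ => rfl, fun p => ?_⟩
  obtain ⟨ε, hε, h⟩ := hf p
  obtain ⟨δ, hδ, h'⟩ := hg (f p)
  refine ⟨min ε δ, lt_min hε hδ, fun q z hz => ⟨h q z (hz.trans_le (min_le_left _ _)), fun hd => ?_⟩⟩
  simpa using h' (f q) z (hz.trans_le (min_le_right _ _)) hd

lemma IsTranslation.singular {X Y : Gluing} {f : X.Pt ≃ₜ Y.Pt} (h : IsTranslation f) {p : X.Pt}
    (hp : Y.Singular (f p)) : X.Singular p := by
  rintro ⟨ε, hε, hs⟩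
  refine hp ?_
  obtain ⟨δ, hδ, h⟩ := h p
  refine ⟨min ε δ, lt_min hε hδ, fun z hz => ?_⟩
  obtain ⟨q, hq, hu⟩ := hs z (hz.trans_le (min_le_left _ _))
  have hz' := hz.trans_le (min_le_right _ _)
  refine ⟨f q, (h q z hz').1 hq, fun q' hq' => ?_⟩
  obtain ⟨q', rfl⟩ := f.surjective q'
  exact congrArg f (hu q' ((h q' z hz').2 hq'))

lemma IsTranslation.singular_iff {X Y : Gluing} {f : X.Pt ≃ₜ Y.Pt} (h : IsTranslation f)
    {p : X.Pt} : Y.Singular (f p) ↔ X.Singular p :=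
  ⟨h.singular, fun hp => h.symm.singular (by simpa using hp)⟩

/-! ### Straight paths -/

/-- Paths of constant velocity. -/
def Straight (X : Gluing) (v : ℂ) (S : Set ℝ) (c : ℝ → X.Pt) : Prop :=
  ∀ t ∈ S, ∀ᶠ s in 𝓝[S] t, X.Disp (c t) (c s) (((s - t : ℝ) : ℂ) * v)

lemma eventually_small (v : ℂ) (S : Set ℝ) (t : ℝ) {ε : ℝ} (hε : 0 < ε) :
    ∀ᶠ s in 𝓝[S] t, ‖((s - t : ℝ) : ℂ) * v‖ < ε := by
  have : ContinuousAt (fun s : ℝ => ‖((s - t : ℝ) : ℂ) * v‖) t := by fun_prop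
  refine (this.eventually_lt continuousAt_const (by simpa using hε)).filter_mono nhdsWithin_le_nhds

lemma Straight.mono {X : Gluing} {v : ℂ} {S T : Set ℝ} {c : ℝ → X.Pt} (h : X.Straight v S c)
    (hT : T ⊆ S) : X.Straight v T c :=
  fun t ht => (h t (hT ht)).filter_mono (nhdsWithin_mono _ hT)

lemma Straight.continuousOn {X : Gluing} {v : ℂ} {S : Set ℝ} {c : ℝ → X.Pt}
    (h : X.Straight v S c) : ContinuousOn c S := by
  intro t ht U hU
  obtain ⟨ε, hε, hU⟩ := X.mem_nhds_iff_disp.1 hU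
  refine mem_map.2 ?_
  filter_upwards [h t ht, eventually_small v S t hε] with s h1 h2
  exact hU _ _ h2 h1

/-- Straight paths that avoid the singular points are determined by one of their points. -/
lemma Straight.eqOn {X : Gluing} {v : ℂ} {S : Set ℝ} {c c' : ℝ → X.Pt} (hc : X.Straight v S c)
    (hc' : X.Straight v S c') (hS : IsPreconnected S) (hns : ∀ t ∈ S, ¬ X.Singular (c t)) {t₀ : ℝ}
    (ht₀ : t₀ ∈ S) (h₀ : c t₀ = c' t₀) : EqOn c c' S := by
  have := Subtype.preconnectedSpace hS
  have hcl : IsClopen {t : S | c t = c' t} := by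
    refine ⟨isClosed_eq (continuousOn_iff_continuous_domRestrict.1 hc.continuousOn)
      (continuousOn_iff_continuous_domRestrict.1 hc'.continuousOn), isOpen_iff_mem_nhds.2 fun t ht => ?_⟩
    have ht : c t = c' t := ht
    obtain ⟨ε, hε, hu⟩ := not_not.1 (hns t t.2)
    refine (eventually_nhds_subtype_iff S t fun s => c s = c' s).2 ?_
    filter_upwards [hc t t.2, hc' t t.2, eventually_small v S t hε] with s h1 h2 h3
    rw [← ht] at h2
    exact (hu _ h3).unique h1 h2
  have huniv := hcl.eq_univ ⟨⟨t₀, ht₀⟩, h₀⟩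
  intro t ht
  have : (⟨t, ht⟩ : S) ∈ {t : S | c t = c' t} := huniv ▸ mem_univ _
  exact this

lemma IsTranslation.straight {X Y : Gluing} {f : X.Pt ≃ₜ Y.Pt} (h : IsTranslation f) {v : ℂ}
    {S : Set ℝ} {c : ℝ → X.Pt} (hc : X.Straight v S c) : Y.Straight v S (f ∘ c) := by
  intro t ht
  obtain ⟨ε, hε, h⟩ := h (c t)
  filter_upwards [hc t ht, eventually_small v S t hε] with s h1 h2
  exact (h _ _ h2).1 h1

lemma IsSaddleConnection.straight {X : Gluing} {v : ℂ} {c : ℝ → X.Pt}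
    (h : X.IsSaddleConnection v c) : X.Straight v (Icc 0 1) c := h.2.2.2.2

lemma IsTranslation.saddle {X Y : Gluing} {f : X.Pt ≃ₜ Y.Pt} (h : IsTranslation f) {v : ℂ}
    {c : ℝ → X.Pt} (hc : X.IsSaddleConnection v c) : Y.IsSaddleConnection v (f ∘ c) :=
  ⟨hc.1, h.singular_iff.2 hc.2.1, h.singular_iff.2 hc.2.2.1,
    fun t ht hs => hc.2.2.2.1 t ht (h.singular_iff.1 hs), h.straight hc.straight⟩

lemma IsSaddleConnection.reverse {X : Gluing} {v : ℂ} {c : ℝ → X.Pt}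
    (h : X.IsSaddleConnection v c) : X.IsSaddleConnection (-v) fun t => c (1 - t) := by
  refine ⟨neg_ne_zero.2 h.1, by simpa using h.2.2.1, by simpa using h.2.1,
    fun t ht => h.2.2.2.1 _ ⟨by linarith [ht.2], by linarith [ht.1]⟩, fun t ht => ?_⟩
  have ht' : 1 - t ∈ Icc (0 : ℝ) 1 := ⟨by linarith [ht.2], by linarith [ht.1]⟩
  have hT : Tendsto (fun s : ℝ => 1 - s) (𝓝[Icc 0 1] t) (𝓝[Icc 0 1] (1 - t)) := by
    refine tendsto_nhdsWithin_iff.2 ⟨?_, ?_⟩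
    · exact (Continuous.tendsto (by fun_prop) t).mono_left nhdsWithin_le_nhds
    · filter_upwards [self_mem_nhdsWithin] with s hs
      exact ⟨by linarith [hs.2], by linarith [hs.1]⟩
  filter_upwards [hT.eventually (h.straight _ ht')] with s hs
  convert hs using 1
  push_cast; ring

lemma reverse_image {T : Type*} (c : ℝ → T) :
    (fun t => c (1 - t)) '' Icc (0 : ℝ) 1 = c '' Icc 0 1 := by
  ext p
  constructor
  · rintro ⟨t, ht, rfl⟩; exact ⟨1 - t, ⟨by linarith [ht.2], by linarith [ht.1]⟩, rfl⟩
  · rintro ⟨t, ht, rfl⟩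
    exact ⟨1 - t, ⟨by linarith [ht.2], by linarith [ht.1]⟩, by simp⟩

/-! ### Periods -/

lemma Isoperiodic.trans {X Y Z : Gluing} : X.Isoperiodic Y → Y.Isoperiodic Z → X.Isoperiodic Z := by
  rintro ⟨f, hf⟩ ⟨g, hg⟩
  exact ⟨f.trans g, fun x γ z h => hg _ _ _ (hf x γ z h)⟩

lemma Iso.isoperiodic {X Y : Gluing} : Iso X Y → X.Isoperiodic Y := by
  rintro ⟨f, hf⟩
  refine ⟨f, fun x γ z ⟨F, hF, hz, h⟩ => ⟨F, hF, hz, fun t => ?_⟩⟩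
  obtain ⟨ε, hε, hf⟩ := hf (γ t)
  have : ∀ᶠ s in 𝓝 t, ‖F s - F t‖ < ε :=
    ((hF.sub continuous_const).norm.continuousAt (x := t)).eventually_lt continuousAt_const
      (by simpa using hε)
  filter_upwards [h t, this] with s h1 h2
  exact (hf _ _ h2).1 h1

end Gluing

/-! ### Surfaces made of two horizontal cylinders -/

/-- Heights of the two horizontal cylinders. -/
def ht : Fin 2 → ℝ := ![1, √2 / 2]

/-- Circumferences of the two horizontal cylinders. -/
def circ : Fin 2 → ℝ := ![1 + √2, 2 + √2]

@[simp] lemma ht_zero : ht 0 = 1 := rfl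
@[simp] lemma ht_one : ht 1 = √2 / 2 := rfl
@[simp] lemma circ_zero : circ 0 = 1 + √2 := rfl
@[simp] lemma circ_one : circ 1 = 2 + √2 := rfl

/-- The strips that cover the two closed cylinders. -/
def strip (j : Fin 2) : Set ℂ := {w | 0 ≤ w.im ∧ w.im ≤ ht j}

lemma sqrt_two_bounds : 1.414 < √2 ∧ √2 < 1.415 :=
  ⟨Real.lt_sqrt_of_sq_lt (by norm_num), (Real.sqrt_lt' (by norm_num)).2 (by norm_num)⟩

lemma sqrt_two_sq : √2 * √2 = 2 := Real.mul_self_sqrt (by norm_num)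

lemma ht_pos (j : Fin 2) : 0 < ht j := by
  have := sqrt_two_bounds
  obtain rfl | rfl := fin_two j <;> simp

lemma circ_pos_all (j : Fin 2) : 0 < circ j := by
  obtain rfl | rfl := fin_two j <;> simp <;> positivity

lemma mk_zero_mem (j : Fin 2) (x : ℝ) : (⟨x, 0⟩ : ℂ) ∈ strip j := ⟨le_rfl, (ht_pos j).le⟩

lemma mk_ht_mem (j : Fin 2) (x : ℝ) : (⟨x, ht j⟩ : ℂ) ∈ strip j := ⟨(ht_pos j).le, le_rfl⟩

lemma strip_add_real {j : Fin 2} {w : ℂ} (hw : w ∈ strip j) (x : ℝ) : w + x ∈ strip j := by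
  simpa [strip] using hw

/-- The identifications of the boundary points of the two strips, for the parameters `q` and `r` of
`fig q r`: the lower side `[q, q+1]` of strip `1` is glued to its upper side `BC`, the rest of
its lower boundary to the upper boundary of strip `0`, and the rest of its upper boundary to the
lower boundary of strip `0`. The origin of strip `0` is the vertex `E`. -/
structure Respects {T : Type} (q r : ℝ) (g : Fin 2 → ℂ → T) : Prop where
  per : ∀ j, ∀ w ∈ strip j, g j (w + circ j) = g j w
  mid : ∀ u ∈ Icc (0 : ℝ) 1, g 1 ⟨q + u, 0⟩ = g 1 ⟨1 + √2 / 2 + u, √2 / 2⟩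
  top : ∀ u ∈ Icc (0 : ℝ) (1 + √2), g 1 ⟨q + 1 + u, 0⟩ = g 0 ⟨r + u, 1⟩
  bot : ∀ u ∈ Icc (0 : ℝ) (1 + √2), g 1 ⟨2 + √2 / 2 + u, √2 / 2⟩ = g 0 ⟨u, 0⟩

lemma Respects.per_int {T : Type} {q r : ℝ} {g : Fin 2 → ℂ → T} (h : Respects q r g) (j : Fin 2)
    {w : ℂ} (hw : w ∈ strip j) (k : ℤ) : g j (w + k * circ j) = g j w := by
  induction k using Int.induction_on with
  | zero => simp
  | succ k ih =>
    rw [← ih, ← h.per j (w + (k : ℤ) * circ j) (by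
      have := strip_add_real hw (k * circ j); push_cast at this ⊢; exact this)]
    congr 1; push_cast; ring
  | pred k ih =>
    rw [← ih, ← h.per j (w + ((-k - 1 : ℤ) : ℂ) * circ j) (by
      have := strip_add_real hw ((-k - 1) * circ j); push_cast at this ⊢; exact this)]
    congr 1; push_cast; ring

lemma Respects.per_mk {T : Type} {q r : ℝ} {g : Fin 2 → ℂ → T} (h : Respects q r g) (j : Fin 2)
    {x y : ℝ} (hw : (⟨x, y⟩ : ℂ) ∈ strip j) (k : ℤ) : g j ⟨x + k * circ j, y⟩ = g j ⟨x, y⟩ := by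
  rw [← h.per_int j hw k]
  congr 1
  apply Complex.ext <;> simp

lemma Respects.shift_q {T : Type} {q r : ℝ} {g : Fin 2 → ℂ → T} (h : Respects q r g) (k : ℤ) :
    Respects (q + k * (2 + √2)) r g where
  per := h.per
  mid u hu := by
    rw [← h.mid u hu, ← h.per_mk 1 (x := q + u) (mk_zero_mem _ _) k]
    congr 2; simp; ring
  top u hu := by
    rw [← h.top u hu, ← h.per_mk 1 (x := q + 1 + u) (mk_zero_mem _ _) k]
    congr 2; simp; ring
  bot := h.bot

lemma Respects.shift_r {T : Type} {q r : ℝ} {g : Fin 2 → ℂ → T} (h : Respects q r g) (k : ℤ) :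
    Respects q (r + k * (1 + √2)) g where
  per := h.per
  mid := h.mid
  top u hu := by
    rw [h.top u hu, ← h.per_mk 0 (x := r + u) (y := 1) (mk_ht_mem 0 _) k]
    congr 2; simp; ring
  bot := h.bot

open Gluing

/-- A presentation of the surface `Y` as the quotient of two horizontal strips, with parameters `q`
and `r`. The polygons of `Y` are covered by closed pieces that translation places in the strips, and
`Y` is universal among the quotients that respect the identifications. -/
structure Cyl (Y : Gluing) (q r : ℝ) where
  G : Fin 2 → ℂ → Y.Pt
  resp : Respects q r G
  κ : Type
  fin : Finite κ
  idx : κ → Fin Y.1.n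
  D : κ → Set ℂ
  τ : κ → ℂ
  str : κ → Fin 2
  closed : ∀ a, IsClosed (D a)
  cover : ∀ i (x : Y.poly i), ∃ a, idx a = i ∧ (x : ℂ) ∈ D a
  piece : ∀ a (x : Y.poly (idx a)), (x : ℂ) ∈ D a →
    (x + τ a) ∈ strip (str a) ∧ G (str a) (x + τ a) = Y.mk _ x
  disp : ∀ j, ∀ w ∈ strip j, ∃ ε > 0, ∀ z, ‖z‖ < ε → w + z ∈ strip j →
    Y.Disp (G j w) (G j (w + z)) z
  univ : ∀ {T : Type} (g : Fin 2 → ℂ → T), Respects q r g →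
    ∃ f : Y.Pt → T, ∀ j, ∀ w ∈ strip j, f (G j w) = g j w

namespace Cyl

variable {Y Y' : Gluing} {q r : ℝ}

/-- The parameters matter only modulo the circumferences. -/
def shift (C : Cyl Y q r) (k l : ℤ) : Cyl Y (q + k * (2 + √2)) (r + l * (1 + √2)) :=
  { C with
    resp := (C.resp.shift_q k).shift_r l
    univ := fun g hg => C.univ g (by
      have := (hg.shift_q (-k)).shift_r (-l)
      convert this using 1 <;> push_cast <;> ring) }

lemma surj (C : Cyl Y q r) (p : Y.Pt) : ∃ j, ∃ w ∈ strip j, C.G j w = p := by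
  obtain ⟨i, x, rfl⟩ := Y.mk_surj p
  obtain ⟨a, rfl, ha⟩ := C.cover i x
  exact ⟨_, _, C.piece a x ha⟩

/-- Short displacements come from displacements in the strips. -/
lemma exists_strip (C : Cyl Y q r) (p : Y.Pt) (P : Fin 2 → ℂ → ℂ → Prop)
    (hP : ∀ j, ∀ w ∈ strip j, C.G j w = p → ∃ ε > 0, ∀ z, ‖z‖ < ε → P j w z) :
    ∃ ε > 0, ∀ p' z, ‖z‖ < ε → Y.Disp p p' z → ∃ j, ∃ w ∈ strip j, w + z ∈ strip j ∧
      C.G j w = p ∧ C.G j (w + z) = p' ∧ P j w z := by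
  have := C.fin
  obtain ⟨ε, hε, h⟩ := Y.exists_uniform p
    (P := fun a z => ∀ y : Y.poly a.1, (y : ℂ) - a.2 = z → ∃ j, ∃ w ∈ strip j, w + z ∈ strip j ∧
      C.G j w = p ∧ C.G j (w + z) = Y.mk a.1 y ∧ P j w z) (by
    rintro ⟨i, x⟩ hx
    have hx : Y.mk i x = p := hx
    have hev : ∀ᶠ z in 𝓝 (0 : ℂ), ∀ b : C.κ, C.idx b = i →
        ((x : ℂ) ∈ C.D b → P (C.str b) (x + C.τ b) z) ∧ ((x : ℂ) ∉ C.D b → (x + z) ∉ C.D b) := by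
      rw [Filter.eventually_all]
      intro b
      by_cases hi : C.idx b = i
      · subst hi
        by_cases hb : (x : ℂ) ∈ C.D b
        · obtain ⟨h1, h2⟩ := C.piece b x hb
          obtain ⟨ε, hε, h⟩ := hP _ _ h1 (h2.trans hx)
          filter_upwards [Metric.ball_mem_nhds (0 : ℂ) hε] with z hz _
          exact ⟨fun _ => h z (by simpa using hz), fun h => absurd hb h⟩
        · have hc : ContinuousAt (fun z : ℂ => (x : ℂ) + z) 0 := by fun_prop
          have := hc.eventually ((C.closed b).isOpen_compl.mem_nhds (by simpa using hb))
          filter_upwards [this] with z hz _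
          exact ⟨fun h => absurd h hb, fun _ => hz⟩
      · filter_upwards with z h using absurd h hi
    obtain ⟨ε, hε, h⟩ := Metric.eventually_nhds_iff.1 hev
    refine ⟨ε, hε, fun z hz y hy => ?_⟩
    simp only at y hy ⊢
    obtain ⟨b, rfl, hb⟩ := C.cover i y
    have hyz : (y : ℂ) = x + z := by rw [← hy]; ring
    obtain ⟨h1, h2⟩ := h (by simpa using hz) b rfl
    have hxb : (x : ℂ) ∈ C.D b := by
      by_contra hn
      exact h2 hn (hyz ▸ hb)
    obtain ⟨a1, a2⟩ := C.piece b x hxb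
    obtain ⟨b1, b2⟩ := C.piece b y hb
    have e : (x : ℂ) + C.τ b + z = y + C.τ b := by rw [hyz]; ring
    exact ⟨_, _, a1, by rw [e]; exact b1, a2.trans hx, by rw [e]; exact b2, h1 hxb⟩)
  refine ⟨ε, hε, fun p' z hz ⟨i, x, y, hx, hy, hxy⟩ => ?_⟩
  obtain ⟨j, w, h1, h2, h3, h4, h5⟩ := h ⟨i, x⟩ hx z hz y hxy
  exact ⟨j, w, h1, h2, h3, h4.trans hy, h5⟩

/-- Surfaces presented by the same cylinders are isomorphic. -/
theorem exists_iso (C : Cyl Y q r) (C' : Cyl Y' q r) : ∃ F : Y.Pt ≃ₜ Y'.Pt, IsTranslation F ∧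
    ∀ j, ∀ w ∈ strip j, F (C.G j w) = C'.G j w := by
  obtain ⟨f, hf⟩ := C.univ C'.G C'.resp
  obtain ⟨g, hg⟩ := C'.univ C.G C.resp
  have hgf : ∀ p, g (f p) = p := fun p => by
    obtain ⟨j, w, hw, rfl⟩ := C.surj p
    rw [hf j w hw, hg j w hw]
  have hfg : ∀ p, f (g p) = p := fun p => by
    obtain ⟨j, w, hw, rfl⟩ := C'.surj p
    rw [hg j w hw, hf j w hw]
  have key : ∀ {Y Y' : Gluing} (C : Cyl Y q r) (C' : Cyl Y' q r) (f : Y.Pt → Y'.Pt)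
      (_ : ∀ j, ∀ w ∈ strip j, f (C.G j w) = C'.G j w) (p : Y.Pt), ∃ ε > 0, ∀ p' z, ‖z‖ < ε →
      Y.Disp p p' z → Y'.Disp (f p) (f p') z := by
    intro Y Y' C C' f hf p
    obtain ⟨ε, hε, h⟩ := C.exists_strip p
      (fun j w z => w + z ∈ strip j → Y'.Disp (C'.G j w) (C'.G j (w + z)) z)
      (fun j w hw _ => C'.disp j w hw)
    refine ⟨ε, hε, fun p' z hz hd => ?_⟩
    obtain ⟨j, w, h1, h2, rfl, rfl, h5⟩ := h p' z hz hd
    rw [hf j w h1, hf j _ h2]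
    exact h5 h2
  obtain ⟨F, hF, hF'⟩ := exists_isTranslation ⟨f, g, hgf, hfg⟩ (key C C' f hf) (key C' C g hg)
  exact ⟨F, hF', fun j w hw => (hF _).trans (hf j w hw)⟩

lemma iso (C : Cyl Y q r) (C' : Cyl Y' q r) : Iso Y Y' := by
  obtain ⟨F, hF, -⟩ := C.exists_iso C'
  exact hF.iso

/-! ### Which points of the strips are identified -/

/-- A predicate on the strips that respects the identifications descends to the surface, and so can
tell points apart. -/
lemma detect (C : Cyl Y q r) {g : Fin 2 → ℂ → Prop} (hg : Respects q r g) {j j' : Fin 2} {w w' : ℂ}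
    (hw : w ∈ strip j) (hw' : w' ∈ strip j') (h : C.G j w = C.G j' w') (h' : g j w) : g j' w' := by
  obtain ⟨f, hf⟩ := C.univ g hg
  rw [← hf j' w' hw', ← h, hf j w hw]
  exact h'

lemma int_mul_eq {a L : ℝ} {k : ℤ} (h : a = k * L) (h1 : -L < a) (h2 : a < L) : k = 0 := by
  have hL : 0 < L := by linarith
  have h3 : (k : ℝ) < 1 := by
    by_contra hn; push Not at hn; nlinarith
  have h4 : (-1 : ℝ) < k := by
    by_contra hn; push Not at hn; nlinarith
  have h3' : k < 1 := by exact_mod_cast h3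
  have h4' : -1 < k := by exact_mod_cast h4
  omega

/-- Translates of a point by multiples of the circumference. -/
def Orb (j : Fin 2) (w : ℂ) (i : Fin 2) (x : ℂ) : Prop := i = j ∧ ∃ k : ℤ, x = w + k * circ j

lemma orb_per {j i : Fin 2} {w x : ℂ} : Orb j w i (x + circ i) ↔ Orb j w i x := by
  constructor
  · rintro ⟨rfl, k, hk⟩
    exact ⟨rfl, k - 1, by push_cast; linear_combination hk⟩
  · rintro ⟨rfl, k, hk⟩
    exact ⟨rfl, k + 1, by push_cast; linear_combination hk⟩

lemma orb_im {j i : Fin 2} {w x : ℂ} (h : Orb j w i x) : x.im = w.im := by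
  obtain ⟨-, k, rfl⟩ := h; simp

lemma orb_self (j : Fin 2) (w : ℂ) : Orb j w j w := ⟨rfl, 0, by simp⟩

lemma orb_mk {j i : Fin 2} {x y x' y' : ℝ} : Orb j ⟨x, y⟩ i ⟨x', y'⟩ ↔
    i = j ∧ y' = y ∧ ∃ k : ℤ, x' - x = k * circ j := by
  constructor
  · rintro ⟨h, k, hk⟩
    have h1 := congrArg Complex.re hk
    have h2 := congrArg Complex.im hk
    simp at h1 h2
    exact ⟨h, h2, k, by linarith⟩
  · rintro ⟨h, rfl, k, hk⟩
    refine ⟨h, k, ?_⟩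
    apply Complex.ext <;> simp; linarith

/-- Interior points of the cylinders are identified only by periodicity. -/
lemma interior_orb (C : Cyl Y q r) {j j' : Fin 2} {w w' : ℂ} (h0 : 0 < w.im) (h1 : w.im < ht j)
    (hw' : w' ∈ strip j') (h : C.G j w = C.G j' w') : Orb j w j' w' := by
  refine C.detect (g := Orb j w) ⟨fun i x hx => propext orb_per, fun u hu => propext ?_,
    fun u hu => propext ?_, fun u hu => propext ?_⟩ ⟨h0.le, h1.le⟩ hw' h (orb_self j w)
  all_goals
    refine iff_of_false (fun h => ?_) (fun h => ?_) <;>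
    · have e := orb_im h
      obtain ⟨rfl, -⟩ := h
      simp at e h1
      linarith

lemma mid_orb (C : Cyl Y q r) {u : ℝ} (h0 : 0 < u) (h1 : u < 1) {j : Fin 2} {w : ℂ}
    (hw : w ∈ strip j) (h : C.G 1 ⟨q + u, 0⟩ = C.G j w) :
    Orb 1 ⟨q + u, 0⟩ j w ∨ Orb 1 ⟨1 + √2 / 2 + u, √2 / 2⟩ j w := by
  have hs := sqrt_two_bounds
  refine C.detect (g := fun j w => Orb 1 ⟨q + u, 0⟩ j w ∨ Orb 1 ⟨1 + √2 / 2 + u, √2 / 2⟩ j w)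
    ⟨fun i x hx => propext (or_congr orb_per orb_per), fun v hv => propext ?_,
    fun v hv => propext (iff_of_false ?_ ?_), fun v hv => propext (iff_of_false ?_ ?_)⟩
    (mk_zero_mem _ _) hw h (Or.inl (orb_self _ _))
  · simp only [orb_mk]
    constructor
    · rintro (⟨-, -, k, hk⟩ | ⟨-, h, -⟩)
      · exact Or.inr ⟨trivial, trivial, k, by linarith⟩
      · linarith
    · rintro (⟨-, h, -⟩ | ⟨-, -, k, hk⟩)
      · linarith
      · exact Or.inl ⟨trivial, trivial, k, by linarith⟩
  · simp only [orb_mk]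
    rintro (⟨-, -, k, hk⟩ | ⟨-, h, -⟩)
    · simp at hk
      have := int_mul_eq hk (by linarith [hv.1, hv.2]) (by linarith [hv.1, hv.2])
      rw [this] at hk; simp at hk; linarith [hv.1]
    · linarith
  · simp [orb_mk]
  · simp only [orb_mk]
    rintro (⟨-, h, -⟩ | ⟨-, -, k, hk⟩)
    · linarith
    · simp at hk
      have := int_mul_eq hk (by linarith [hv.1, hv.2]) (by linarith [hv.1, hv.2])
      rw [this] at hk; simp at hk; linarith [hv.1]
  · simp [orb_mk]

lemma top_orb (C : Cyl Y q r) {u : ℝ} (h0 : 0 < u) (h1 : u < 1 + √2) {j : Fin 2} {w : ℂ}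
    (hw : w ∈ strip j) (h : C.G 1 ⟨q + 1 + u, 0⟩ = C.G j w) :
    Orb 1 ⟨q + 1 + u, 0⟩ j w ∨ Orb 0 ⟨r + u, 1⟩ j w := by
  have hs := sqrt_two_bounds
  refine C.detect (g := fun j w => Orb 1 ⟨q + 1 + u, 0⟩ j w ∨ Orb 0 ⟨r + u, 1⟩ j w)
    ⟨fun i x hx => propext (or_congr orb_per orb_per), fun v hv => propext (iff_of_false ?_ ?_),
    fun v hv => propext ?_, fun v hv => propext (iff_of_false ?_ ?_)⟩
    (mk_zero_mem _ _) hw h (Or.inl (orb_self _ _))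
  · simp only [orb_mk]
    rintro (⟨-, -, k, hk⟩ | ⟨h, -⟩)
    · simp at hk
      have := int_mul_eq hk (by linarith [hv.1, hv.2]) (by linarith [hv.1, hv.2])
      rw [this] at hk; simp at hk; linarith [hv.2]
    · simp at h
  · simp [orb_mk]
  · simp only [orb_mk]
    constructor
    · rintro (⟨-, -, k, hk⟩ | ⟨h, -⟩)
      · simp at hk
        have := int_mul_eq hk (by linarith [hv.1, hv.2]) (by linarith [hv.1, hv.2])
        rw [this] at hk; simp at hk
        exact Or.inr ⟨trivial, trivial, 0, by simp; linarith⟩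
      · simp at h
    · rintro (⟨h, -⟩ | ⟨-, -, k, hk⟩)
      · simp at h
      · simp at hk
        have := int_mul_eq hk (by linarith [hv.1, hv.2]) (by linarith [hv.1, hv.2])
        rw [this] at hk; simp at hk
        exact Or.inl ⟨trivial, trivial, 0, by simp; linarith⟩
  · simp [orb_mk]
  · simp [orb_mk]

lemma bot_orb (C : Cyl Y q r) {u : ℝ} (h0 : 0 < u) (h1 : u < 1 + √2) {j : Fin 2} {w : ℂ}
    (hw : w ∈ strip j) (h : C.G 0 ⟨u, 0⟩ = C.G j w) :
    Orb 0 ⟨u, 0⟩ j w ∨ Orb 1 ⟨2 + √2 / 2 + u, √2 / 2⟩ j w := by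
  have hs := sqrt_two_bounds
  refine C.detect (g := fun j w => Orb 0 ⟨u, 0⟩ j w ∨ Orb 1 ⟨2 + √2 / 2 + u, √2 / 2⟩ j w)
    ⟨fun i x hx => propext (or_congr orb_per orb_per), fun v hv => propext (iff_of_false ?_ ?_),
    fun v hv => propext (iff_of_false ?_ ?_), fun v hv => propext ?_⟩
    (mk_zero_mem _ _) hw h (Or.inl (orb_self _ _))
  · simp only [orb_mk]; simp
    intro h; linarith
  · simp only [orb_mk]
    rintro (⟨h, -⟩ | ⟨-, -, k, hk⟩)
    · simp at h
    · simp at hk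
      have := int_mul_eq hk (by linarith [hv.1, hv.2]) (by linarith [hv.1, hv.2])
      rw [this] at hk; simp at hk; linarith [hv.2]
  · simp only [orb_mk]; simp
    intro h; linarith
  · simp [orb_mk]
  · simp only [orb_mk]
    constructor
    · rintro (⟨h, -⟩ | ⟨-, -, k, hk⟩)
      · simp at h
      · simp at hk
        have := int_mul_eq hk (by linarith [hv.1, hv.2]) (by linarith [hv.1, hv.2])
        rw [this] at hk; simp at hk
        exact Or.inl ⟨trivial, trivial, 0, by simp; linarith⟩
    · rintro (⟨-, -, k, hk⟩ | ⟨h, -⟩)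
      · simp at hk
        have := int_mul_eq hk (by linarith [hv.1, hv.2]) (by linarith [hv.1, hv.2])
        rw [this] at hk; simp at hk
        exact Or.inr ⟨trivial, trivial, 0, by simp; linarith⟩
      · simp at h

end Cyl

namespace Cyl

variable {Y Y' : Gluing} {q r : ℝ}

lemma eq_of_orb (C : Cyl Y q r) {j i : Fin 2} {w x : ℂ} (hw : w ∈ strip j) (h : Orb j w i x) :
    C.G i x = C.G j w := by
  obtain ⟨rfl, k, rfl⟩ := h
  exact C.resp.per_int i hw k

lemma orb_add {j i : Fin 2} {w x : ℂ} (h : Orb j w i x) (z : ℂ) : Orb j (w + z) i (x + z) := by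
  obtain ⟨rfl, k, rfl⟩ := h
  exact ⟨rfl, k, by ring⟩

/-! ### Singular points -/

/-- The vertex of the cylinder decomposition. -/
def p0 (C : Cyl Y q r) : Y.Pt := C.G 0 ⟨0, 0⟩

/-- The points of the strips that represent the vertex. -/
def Vert (q r : ℝ) (j : Fin 2) (w : ℂ) : Prop :=
  (Orb 0 ⟨0, 0⟩ j w ∨ Orb 1 ⟨q, 0⟩ j w ∨ Orb 1 ⟨q + 1, 0⟩ j w) ∨
    Orb 0 ⟨r, 1⟩ j w ∨ Orb 1 ⟨1 + √2 / 2, √2 / 2⟩ j w ∨ Orb 1 ⟨2 + √2 / 2, √2 / 2⟩ j w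

lemma p0_C (C : Cyl Y q r) : C.G 1 ⟨2 + √2 / 2, √2 / 2⟩ = C.p0 := by
  have := C.resp.bot 0 (by constructor <;> linarith [circ_pos'])
  rwa [add_zero] at this

lemma p0_P (C : Cyl Y q r) : C.G 1 ⟨q + 1, 0⟩ = C.p0 := by
  rw [C.resp.mid 1 (by simp), ← C.p0_C]
  congr 2; ring

lemma p0_P' (C : Cyl Y q r) : C.G 0 ⟨r, 1⟩ = C.p0 := by
  have := C.resp.top 0 (by constructor <;> linarith [circ_pos'])
  rw [add_zero, add_zero] at this
  rw [← this, C.p0_P]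

lemma p0_B (C : Cyl Y q r) : C.G 1 ⟨1 + √2 / 2, √2 / 2⟩ = C.p0 := by
  have h := C.resp.bot (1 + √2) (by constructor <;> linarith [circ_pos'])
  have h1 := C.resp.per_mk 1 (mk_ht_mem 1 (1 + √2 / 2)) 1
  have h2 := C.resp.per_mk 0 (mk_zero_mem 0 0) 1
  simp only [ht_one, circ_one, circ_zero, Int.cast_one, one_mul, zero_add] at h1 h2
  rw [← h1, p0, ← h2, ← h]
  congr 2; ring

lemma p0_Q (C : Cyl Y q r) : C.G 1 ⟨q, 0⟩ = C.p0 := by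
  have := C.resp.mid 0 (by simp)
  rw [add_zero, add_zero] at this
  rw [this, C.p0_B]

lemma eq_p0 (C : Cyl Y q r) {j : Fin 2} {w : ℂ} (h : Vert q r j w) : C.G j w = C.p0 := by
  rcases h with (h | h | h) | h | h | h
  · exact C.eq_of_orb (mk_zero_mem _ _) h
  · rw [C.eq_of_orb (mk_zero_mem _ _) h, C.p0_Q]
  · rw [C.eq_of_orb (mk_zero_mem _ _) h, C.p0_P]
  · exact (C.eq_of_orb (mk_ht_mem 0 _) h).trans C.p0_P'
  · exact (C.eq_of_orb (mk_ht_mem 1 _) h).trans C.p0_B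
  · exact (C.eq_of_orb (mk_ht_mem 1 _) h).trans C.p0_C

lemma exists_residue (x a : ℝ) {l : ℝ} (hl : 0 < l) :
    ∃ (k : ℤ) (u : ℝ), 0 ≤ u ∧ u < l ∧ x - (a + u) = k * l := by
  refine ⟨⌊(x - a) / l⌋, x - a - ⌊(x - a) / l⌋ * l, ?_, ?_, by ring⟩
  · have := Int.floor_le ((x - a) / l)
    rw [le_div_iff₀ hl] at this; linarith
  · have := Int.lt_floor_add_one ((x - a) / l)
    rw [div_lt_iff₀ hl] at this; linarith

/-- The points of the strips: interior points, points of the three horizontal saddle connections, and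
representatives of the vertex. -/
lemma strip_cases (q r : ℝ) {j : Fin 2} {w : ℂ} (hw : w ∈ strip j) :
    (0 < w.im ∧ w.im < ht j) ∨
    (∃ u ∈ Ioo (0 : ℝ) 1, Orb 1 ⟨q + u, 0⟩ j w ∨ Orb 1 ⟨1 + √2 / 2 + u, √2 / 2⟩ j w) ∨
    (∃ u ∈ Ioo (0 : ℝ) (1 + √2), Orb 1 ⟨q + 1 + u, 0⟩ j w ∨ Orb 0 ⟨r + u, 1⟩ j w) ∨
    (∃ u ∈ Ioo (0 : ℝ) (1 + √2), Orb 0 ⟨u, 0⟩ j w ∨ Orb 1 ⟨2 + √2 / 2 + u, √2 / 2⟩ j w) ∨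
    Vert q r j w := by
  obtain ⟨x, y⟩ := w
  obtain ⟨h0, h1⟩ := hw
  simp only at h0 h1
  rcases h0.eq_or_lt with rfl | h0
  · right
    obtain rfl | rfl := fin_two j
    · obtain ⟨k, u, hu, hu', hk⟩ := exists_residue x 0 circ_pos'
      rw [zero_add] at hk
      rcases hu.eq_or_lt with rfl | hu
      · exact Or.inr (Or.inr (Or.inr (Or.inl (Or.inl (orb_mk.2 ⟨rfl, rfl, k, hk⟩)))))
      · exact Or.inr (Or.inr (Or.inl ⟨u, ⟨hu, hu'⟩, Or.inl (orb_mk.2 ⟨rfl, rfl, k, hk⟩)⟩))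
    · obtain ⟨k, u, hu, hu', hk⟩ := exists_residue x q circ_pos
      rcases hu.eq_or_lt with rfl | hu
      · rw [add_zero] at hk
        exact Or.inr (Or.inr (Or.inr (Or.inl (Or.inr (Or.inl (orb_mk.2 ⟨rfl, rfl, k, hk⟩))))))
      · rcases lt_trichotomy u 1 with h | rfl | h
        · exact Or.inl ⟨u, ⟨hu, h⟩, Or.inl (orb_mk.2 ⟨rfl, rfl, k, hk⟩)⟩
        · exact Or.inr (Or.inr (Or.inr (Or.inl (Or.inr (Or.inr (orb_mk.2 ⟨rfl, rfl, k, hk⟩))))))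
        · exact Or.inr (Or.inl ⟨u - 1, ⟨by linarith, by linarith⟩,
            Or.inl (orb_mk.2 ⟨rfl, rfl, k, by rw [← circ_one] at hk; linarith⟩)⟩)
  rcases h1.eq_or_lt with rfl | h1
  · right
    obtain rfl | rfl := fin_two j
    · obtain ⟨k, u, hu, hu', hk⟩ := exists_residue x r circ_pos'
      rcases hu.eq_or_lt with rfl | hu
      · rw [add_zero] at hk
        exact Or.inr (Or.inr (Or.inr (Or.inr (Or.inl (orb_mk.2 ⟨rfl, rfl, k, hk⟩)))))
      · exact Or.inr (Or.inl ⟨u, ⟨hu, hu'⟩, Or.inr (orb_mk.2 ⟨rfl, rfl, k, hk⟩)⟩)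
    · obtain ⟨k, u, hu, hu', hk⟩ := exists_residue x (1 + √2 / 2) circ_pos
      rcases hu.eq_or_lt with rfl | hu
      · rw [add_zero] at hk
        exact Or.inr (Or.inr (Or.inr (Or.inr (Or.inr (Or.inl (orb_mk.2 ⟨rfl, rfl, k, hk⟩))))))
      · rcases lt_trichotomy u 1 with h | rfl | h
        · exact Or.inl ⟨u, ⟨hu, h⟩, Or.inr (orb_mk.2 ⟨rfl, rfl, k, hk⟩)⟩
        · exact Or.inr (Or.inr (Or.inr (Or.inr (Or.inr (Or.inr (orb_mk.2 ⟨rfl, rfl, k,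
            by rw [← circ_one] at hk; linarith⟩))))))
        · exact Or.inr (Or.inr (Or.inl ⟨u - 1, ⟨by linarith, by linarith⟩,
            Or.inr (orb_mk.2 ⟨rfl, rfl, k, by rw [← circ_one] at hk; linarith⟩)⟩))
  · exact Or.inl ⟨h0, h1⟩

lemma vert_of_eq (C : Cyl Y q r) {j : Fin 2} {w : ℂ} (hw : w ∈ strip j) (h : C.G j w = C.p0) :
    Vert q r j w := by
  have hs := sqrt_two_bounds
  have h00 := mk_zero_mem 0 0
  rcases strip_cases q r hw with ⟨h0, h1⟩ | ⟨u, hu, ho⟩ | ⟨u, hu, ho⟩ | ⟨u, hu, ho⟩ | h'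
  · have := orb_im (C.interior_orb h0 h1 h00 h)
    simp at this; linarith
  · have h2 : C.G 1 ⟨q + u, 0⟩ = C.p0 := by
      rw [← h]
      rcases ho with ho | ho
      · exact (C.eq_of_orb (mk_zero_mem _ _) ho).symm
      · rw [C.eq_of_orb (mk_ht_mem 1 _) ho, C.resp.mid u ⟨hu.1.le, hu.2.le⟩]; rfl
    rcases C.mid_orb hu.1 hu.2 h00 h2 with ⟨h3, -⟩ | ⟨h3, -⟩ <;> simp at h3
  · have h2 : C.G 1 ⟨q + 1 + u, 0⟩ = C.p0 := by
      rw [← h]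
      rcases ho with ho | ho
      · exact (C.eq_of_orb (mk_zero_mem _ _) ho).symm
      · rw [C.eq_of_orb (mk_ht_mem 0 _) ho, C.resp.top u ⟨hu.1.le, hu.2.le⟩]; rfl
    rcases C.top_orb hu.1 hu.2 h00 h2 with ⟨h3, -⟩ | h3
    · simp at h3
    · have := orb_im h3
      simp at this
  · have h2 : C.G 0 ⟨u, 0⟩ = C.p0 := by
      rw [← h]
      rcases ho with ho | ho
      · exact (C.eq_of_orb (mk_zero_mem _ _) ho).symm
      · rw [C.eq_of_orb (mk_ht_mem 1 _) ho]; exact (C.resp.bot u ⟨hu.1.le, hu.2.le⟩).symm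
    rcases C.bot_orb hu.1 hu.2 h00 h2 with h3 | ⟨h3, -⟩
    · obtain ⟨-, -, k, hk⟩ := orb_mk.1 h3
      simp at hk
      have h0 := int_mul_eq (k := -k) (L := 1 + √2) (a := u) (by push_cast; linarith)
        (by linarith [hu.1]) hu.2
      obtain rfl : k = 0 := by omega
      simp at hk
      linarith [hu.1]
    · simp at h3
  · exact h'

/-- A point with one representative is not singular. -/
lemma not_singular_interior (C : Cyl Y q r) {j : Fin 2} {w : ℂ} (h0 : 0 < w.im)
    (h1 : w.im < ht j) : ¬ Y.Singular (C.G j w) := by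
  have hw : w ∈ strip j := ⟨h0.le, h1.le⟩
  obtain ⟨ε, hε, h⟩ := C.exists_strip (C.G j w) (fun _ _ _ => True)
    (fun _ _ _ _ => ⟨1, one_pos, fun _ _ => trivial⟩)
  obtain ⟨ε', hε', h'⟩ := C.disp j w hw
  refine not_not.2 ⟨min (min ε ε') (min w.im (ht j - w.im)), by
    have : 0 < ht j - w.im := by linarith
    positivity, fun z hz => ?_⟩
  simp only [lt_min_iff] at hz
  have hi := (abs_lt.1 ((Complex.abs_im_le_norm z).trans_lt hz.2.1))
  have hi' := (abs_lt.1 ((Complex.abs_im_le_norm z).trans_lt hz.2.2))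
  have hwz : w + z ∈ strip j := by constructor <;> simp <;> linarith
  refine ⟨_, h' z hz.1.2 hwz, fun p' hp' => ?_⟩
  obtain ⟨i, x, hx, hxz, hxp, rfl, -⟩ := h p' z hz.1.1 hp'
  exact C.eq_of_orb hwz (orb_add (C.interior_orb h0 h1 hx hxp.symm) z)

/-- A point with two representatives, one on a lower side and one on an upper side that is
identified with it near that point, is not singular. -/
lemma not_singular_two_sided (C : Cyl Y q r) {j₁ j₂ : Fin 2} {x₁ x₂ : ℝ} {p : Y.Pt}
    (h₁ : C.G j₁ ⟨x₁, 0⟩ = p) (h₂ : C.G j₂ ⟨x₂, ht j₂⟩ = p)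
    (ho : ∀ j, ∀ w ∈ strip j, C.G j w = p → Orb j₁ ⟨x₁, 0⟩ j w ∨ Orb j₂ ⟨x₂, ht j₂⟩ j w)
    (hx : ∃ δ > 0, ∀ x : ℝ, |x| < δ → C.G j₁ ⟨x₁ + x, 0⟩ = C.G j₂ ⟨x₂ + x, ht j₂⟩) :
    ¬ Y.Singular p := by
  obtain ⟨δ, hδ, hx⟩ := hx
  obtain ⟨ε, hε, h⟩ := C.exists_strip p (fun _ _ _ => True)
    (fun _ _ _ _ => ⟨1, one_pos, fun _ _ => trivial⟩)
  obtain ⟨ε₁, hε₁, hd₁⟩ := C.disp j₁ _ (mk_zero_mem j₁ x₁)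
  obtain ⟨ε₂, hε₂, hd₂⟩ := C.disp j₂ _ (mk_ht_mem j₂ x₂)
  have hp₁ := ht_pos j₁
  have hp₂ := ht_pos j₂
  refine not_not.2 ⟨min (min (min ε ε₁) (min ε₂ δ)) (min (ht j₁) (ht j₂)), by positivity,
    fun z hz => ?_⟩
  simp only [lt_min_iff] at hz
  obtain ⟨⟨⟨z1, z2⟩, z3, z4⟩, z5, z6⟩ := hz
  have hi := (abs_lt.1 ((Complex.abs_im_le_norm z).trans_lt z5))
  have hi' := (abs_lt.1 ((Complex.abs_im_le_norm z).trans_lt z6))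
  have hre := (Complex.abs_re_le_norm z).trans_lt z4
  have hreal : z.im = 0 → C.G j₁ (⟨x₁, 0⟩ + z) = C.G j₂ (⟨x₂, ht j₂⟩ + z) := by
    intro h0
    convert hx z.re hre using 2 <;> apply Complex.ext <;> simp [h0]
  rcases le_total 0 z.im with h0 | h0
  · have hz1 : (⟨x₁, 0⟩ : ℂ) + z ∈ strip j₁ := by constructor <;> simp <;> linarith
    refine ⟨_, h₁ ▸ hd₁ z z2 hz1, fun p' hp' => ?_⟩
    obtain ⟨i, x, hx, hxz, hxp, rfl, -⟩ := h p' z z1 hp'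
    rcases ho i x hx hxp with ho | ho
    · exact C.eq_of_orb hz1 (orb_add ho z)
    · have him := orb_im ho
      obtain rfl := ho.1
      have h3 := hxz.2
      simp at him h3
      have h00 : z.im = 0 := by linarith
      rw [hreal h00]
      refine C.eq_of_orb ?_ (orb_add ho z)
      constructor <;> simp [h00]; exact hp₂.le
  · have hz1 : (⟨x₂, ht j₂⟩ : ℂ) + z ∈ strip j₂ := by constructor <;> simp <;> linarith
    refine ⟨_, h₂ ▸ hd₂ z z3 hz1, fun p' hp' => ?_⟩
    obtain ⟨i, x, hx, hxz, hxp, rfl, -⟩ := h p' z z1 hp'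
    rcases ho i x hx hxp with ho | ho
    · have him := orb_im ho
      obtain rfl := ho.1
      have h3 := hxz.1
      simp at him h3
      have h00 : z.im = 0 := by linarith
      rw [← hreal h00]
      refine C.eq_of_orb ?_ (orb_add ho z)
      constructor <;> simp [h00]; exact hp₁.le
    · exact C.eq_of_orb hz1 (orb_add ho z)

lemma exists_small {a u : ℝ} (h0 : 0 < u) (h1 : u < a) :
    ∃ δ > 0, ∀ x : ℝ, |x| < δ → u + x ∈ Icc 0 a :=
  ⟨min u (a - u), lt_min h0 (by linarith), fun x hx => by
    obtain ⟨h2, h3⟩ := lt_min_iff.1 hx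
    constructor <;> linarith [abs_lt.1 h2, abs_lt.1 h3]⟩

lemma not_singular_mid (C : Cyl Y q r) {u : ℝ} (h0 : 0 < u) (h1 : u < 1) :
    ¬ Y.Singular (C.G 1 ⟨q + u, 0⟩) := by
  obtain ⟨δ, hδ, h⟩ := exists_small h0 h1
  refine C.not_singular_two_sided (j₂ := 1) (x₂ := 1 + √2 / 2 + u) rfl
    (C.resp.mid u ⟨h0.le, h1.le⟩).symm (fun j w hw hp => C.mid_orb h0 h1 hw hp.symm)
    ⟨δ, hδ, fun x hx => ?_⟩
  rw [add_assoc, add_assoc]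
  exact C.resp.mid _ (h x hx)

lemma not_singular_top (C : Cyl Y q r) {u : ℝ} (h0 : 0 < u) (h1 : u < 1 + √2) :
    ¬ Y.Singular (C.G 1 ⟨q + 1 + u, 0⟩) := by
  obtain ⟨δ, hδ, h⟩ := exists_small h0 h1
  refine C.not_singular_two_sided (j₂ := 0) (x₂ := r + u) rfl
    (C.resp.top u ⟨h0.le, h1.le⟩).symm (fun j w hw hp => C.top_orb h0 h1 hw hp.symm)
    ⟨δ, hδ, fun x hx => ?_⟩
  rw [add_assoc (q + 1), add_assoc r]
  exact C.resp.top _ (h x hx)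

lemma not_singular_bot (C : Cyl Y q r) {u : ℝ} (h0 : 0 < u) (h1 : u < 1 + √2) :
    ¬ Y.Singular (C.G 0 ⟨u, 0⟩) := by
  obtain ⟨δ, hδ, h⟩ := exists_small h0 h1
  refine C.not_singular_two_sided (j₂ := 1) (x₂ := 2 + √2 / 2 + u) rfl
    (C.resp.bot u ⟨h0.le, h1.le⟩) (fun j w hw hp => C.bot_orb h0 h1 hw hp.symm)
    ⟨δ, hδ, fun x hx => ?_⟩
  rw [add_assoc (2 + √2 / 2)]
  exact (C.resp.bot _ (h x hx)).symm

lemma singular_p0 (C : Cyl Y q r) : Y.Singular C.p0 := by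
  rintro ⟨ε, hε, h⟩
  obtain ⟨ε₁, hε₁, h₁⟩ := C.disp 1 _ (mk_zero_mem 1 q)
  obtain ⟨ε₂, hε₂, h₂⟩ := C.disp 0 _ (mk_zero_mem 0 0)
  set δ : ℝ := min (min ε ε₁) (min ε₂ 1) / 2
  have hδ : 0 < δ := by positivity
  have hlt : δ < min (min ε ε₁) (min ε₂ 1) := half_lt_self (by positivity)
  simp only [lt_min_iff] at hlt
  have hn : ‖(δ : ℂ)‖ = δ := by simp [abs_of_pos hδ]
  have e1 := h₁ δ (hn.trans_lt hlt.1.2) (strip_add_real (mk_zero_mem 1 q) δ)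
  have e2 := h₂ δ (hn.trans_lt hlt.2.1) (strip_add_real (mk_zero_mem 0 0) δ)
  rw [C.p0_Q] at e1
  have e := (h δ (hn.trans_lt hlt.1.1)).unique e1 e2
  have hq : (⟨q, 0⟩ : ℂ) + δ = ⟨q + δ, 0⟩ := by apply Complex.ext <;> simp
  rw [hq] at e
  rcases C.mid_orb hδ hlt.2.2 (strip_add_real (mk_zero_mem 0 0) δ) e with ⟨h, -⟩ | ⟨h, -⟩ <;>
    simp at h

lemma singular_iff (C : Cyl Y q r) (p : Y.Pt) : Y.Singular p ↔ p = C.p0 := by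
  constructor
  · intro hp
    obtain ⟨j, w, hw, rfl⟩ := C.surj p
    rcases strip_cases q r hw with ⟨h0, h1⟩ | ⟨u, hu, ho⟩ | ⟨u, hu, ho⟩ | ⟨u, hu, ho⟩ | h'
    · exact absurd hp (C.not_singular_interior h0 h1)
    · refine absurd ?_ (C.not_singular_mid hu.1 hu.2)
      rcases ho with ho | ho
      · rwa [← C.eq_of_orb (mk_zero_mem _ _) ho]
      · rw [C.eq_of_orb (mk_ht_mem 1 _) ho] at hp
        rwa [C.resp.mid u ⟨hu.1.le, hu.2.le⟩]
    · refine absurd ?_ (C.not_singular_top hu.1 hu.2)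
      rcases ho with ho | ho
      · rwa [← C.eq_of_orb (mk_zero_mem _ _) ho]
      · rw [C.eq_of_orb (mk_ht_mem 0 _) ho] at hp
        rwa [C.resp.top u ⟨hu.1.le, hu.2.le⟩]
    · refine absurd ?_ (C.not_singular_bot hu.1 hu.2)
      rcases ho with ho | ho
      · rwa [← C.eq_of_orb (mk_zero_mem _ _) ho]
      · rw [C.eq_of_orb (mk_ht_mem 1 _) ho] at hp
        rwa [← C.resp.bot u ⟨hu.1.le, hu.2.le⟩]
    · exact C.eq_p0 h'
  · rintro rfl
    exact C.singular_p0

lemma existsUnique_singular (C : Cyl Y q r) : ∃! p, Y.Singular p :=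
  ⟨C.p0, C.singular_p0, fun p hp => (C.singular_iff p).1 hp⟩

/-! ### Short saddle connections -/

lemma straight (C : Cyl Y q r) (j : Fin 2) (w v : ℂ) :
    Y.Straight v {t : ℝ | w + t * v ∈ strip j} fun t => C.G j (w + t * v) := by
  intro t ht
  obtain ⟨ε, hε, h⟩ := C.disp j _ ht
  filter_upwards [eventually_small v _ t hε, self_mem_nhdsWithin] with s hs hs'
  have e : w + s * v = w + t * v + ((s - t : ℝ) : ℂ) * v := by push_cast; ring
  rw [e]
  exact h _ hs (e ▸ hs')

/-- A saddle connection follows a straight line of a strip as long as this line does not meet a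
singular point. -/
lemma follow (C : Cyl Y q r) {v : ℂ} {c : ℝ → Y.Pt} (hc : Y.IsSaddleConnection v c) {j : Fin 2}
    {w : ℂ} {b s : ℝ} (hb : b ≤ 1) (hs : s ∈ Ioo 0 b) (hcs : C.G j (w + s * v) = c s)
    (hst : ∀ t ∈ Icc 0 b, w + t * v ∈ strip j)
    (hns : ∀ t ∈ Ioo 0 b, ¬ Y.Singular (C.G j (w + t * v))) :
    ∀ t ∈ Icc 0 b, c t = C.G j (w + t * v) := by
  have h1 : Y.Straight v (Icc 0 b) c := hc.straight.mono (Icc_subset_Icc_right hb)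
  have h2 : Y.Straight v (Icc 0 b) fun t => C.G j (w + t * v) := (C.straight j w v).mono hst
  have h3 := (h2.mono Ioo_subset_Icc_self).eqOn (h1.mono Ioo_subset_Icc_self) isPreconnected_Ioo
    hns hs hcs
  have h4 := h3.of_subset_closure h2.continuousOn h1.continuousOn Ioo_subset_Icc_self
    (by rw [closure_Ioo (hs.1.trans hs.2).ne])
  exact fun t ht => (h4 ht).symm

/-- How a saddle connection begins. -/
lemma exists_start (C : Cyl Y q r) {v : ℂ} {c : ℝ → Y.Pt} (hc : Y.IsSaddleConnection v c) {δ : ℝ}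
    (hδ : 0 < δ) : ∃ s ∈ Ioo 0 δ, ∃ j w, Vert q r j w ∧ w ∈ strip j ∧ w + s * v ∈ strip j ∧
      C.G j (w + s * v) = c s := by
  obtain ⟨ε, hε, h⟩ := C.exists_strip C.p0 (fun _ _ _ => True)
    (fun _ _ _ _ => ⟨1, one_pos, fun _ _ => trivial⟩)
  have h1 := hc.straight 0 (by simp)
  have h2 : ∀ᶠ s in 𝓝[>] (0 : ℝ), s ∈ Ioo 0 (min δ 1) := Ioo_mem_nhdsGT (by positivity)
  have h3 : 𝓝[>] (0 : ℝ) ≤ 𝓝[Icc 0 1] 0 := by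
    rw [← nhdsWithin_Ioc_eq_nhdsGT one_pos]
    exact nhdsWithin_mono _ Ioc_subset_Icc_self
  obtain ⟨s, ⟨hd, hn⟩, hs⟩ := (((h1.and (eventually_small v _ 0 hε)).filter_mono h3).and h2).exists
  rw [(C.singular_iff _).1 hc.2.1] at hd
  rw [sub_zero] at hd hn
  obtain ⟨j, w, hw, hwz, hp, hp', -⟩ := h _ _ hn hd
  exact ⟨s, ⟨hs.1, hs.2.trans_le (min_le_left _ _)⟩, j, w, C.vert_of_eq hw hp, hw, hwz, hp'⟩

lemma vert_im {j : Fin 2} {w : ℂ} (h : Vert q r j w) : w.im = 0 ∨ w.im = ht j := by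
  rcases h with (h | h | h) | h | h | h <;>
  · have := orb_im h
    obtain ⟨rfl, -⟩ := h
    simp at this
    simp [this]

/-- The representatives of the vertex at the bottom of the strips. -/
lemma vert_bot {j : Fin 2} {w : ℂ} (h : Vert q r j w) (h0 : w.im = 0) :
    Orb 0 ⟨0, 0⟩ j w ∨ Orb 1 ⟨q, 0⟩ j w ∨ Orb 1 ⟨q + 1, 0⟩ j w := by
  have hs := sqrt_two_bounds
  rcases h with h | h | h | h
  · exact h
  all_goals
    have := orb_im h
    simp [h0] at this
  all_goals linarith

lemma vert_top {j : Fin 2} {w : ℂ} (h : Vert q r j w) (h0 : w.im = ht j) :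
    Orb 0 ⟨r, 1⟩ j w ∨ Orb 1 ⟨1 + √2 / 2, √2 / 2⟩ j w ∨ Orb 1 ⟨2 + √2 / 2, √2 / 2⟩ j w := by
  rcases h with (h | h | h) | h
  · have h1 := ht_pos j
    have := orb_im h
    simp [h0] at this
    linarith
  · have h1 := ht_pos j
    have := orb_im h
    simp [h0] at this
    linarith
  · have h1 := ht_pos j
    have := orb_im h
    simp [h0] at this
    linarith
  · exact h

/-- How a saddle connection that points up begins. -/
lemma exists_start_up (C : Cyl Y q r) {v : ℂ} {c : ℝ → Y.Pt} (hc : Y.IsSaddleConnection v c)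
    (h0 : 0 < v.im) {δ : ℝ} (hδ : 0 < δ) : ∃ s ∈ Ioo 0 δ, ∃ j w,
      (j = 0 ∧ w = ⟨0, 0⟩ ∨ j = 1 ∧ (w = ⟨q, 0⟩ ∨ w = ⟨q + 1, 0⟩)) ∧ C.G j (w + s * v) = c s := by
  obtain ⟨s, hs, j, w, hw, hws, hwz, hcs⟩ := C.exists_start hc hδ
  refine ⟨s, hs, ?_⟩
  have him : w.im = 0 := by
    refine (vert_im hw).resolve_right fun h => ?_
    have := hwz.2
    simp [h] at this
    nlinarith [hs.1]
  rcases vert_bot hw him with h | h | h <;> obtain rfl := h.1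
  · exact ⟨0, _, Or.inl ⟨rfl, rfl⟩, by
      rw [← hcs]
      refine (C.eq_of_orb ?_ (orb_add h _)).symm
      have := hwz; simp [strip, him] at this ⊢; exact this⟩
  · exact ⟨1, _, Or.inr ⟨rfl, Or.inl rfl⟩, by
      rw [← hcs]
      refine (C.eq_of_orb ?_ (orb_add h _)).symm
      have := hwz; simp [strip, him] at this ⊢; exact this⟩
  · exact ⟨1, _, Or.inr ⟨rfl, Or.inr rfl⟩, by
      rw [← hcs]
      refine (C.eq_of_orb ?_ (orb_add h _)).symm
      have := hwz; simp [strip, him] at this ⊢; exact this⟩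

lemma line_mem {j : Fin 2} {x t : ℝ} {v : ℂ} (h0 : 0 ≤ t * v.im) (h1 : t * v.im ≤ ht j) :
    (⟨x, 0⟩ + t * v : ℂ) ∈ strip j := by
  simpa [strip] using ⟨h0, h1⟩

lemma line_not_singular (C : Cyl Y q r) {j : Fin 2} {x t : ℝ} {v : ℂ} (h0 : 0 < t * v.im)
    (h1 : t * v.im < ht j) : ¬ Y.Singular (C.G j (⟨x, 0⟩ + t * v)) :=
  C.not_singular_interior (by simpa using h0) (by simpa using h1)

/-- The nonsingular points of the upper side of strip `1` are identified with points of lower sides. -/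
lemma exists_bottom (C : Cyl Y q r) {w : ℂ} (hw : w.im = √2 / 2) (hns : ¬ Y.Singular (C.G 1 w)) :
    ∃ j x, C.G 1 w = C.G j ⟨x, 0⟩ := by
  have hs := sqrt_two_bounds
  have hst : w ∈ strip 1 := ⟨by rw [hw]; positivity, hw.le⟩
  rcases strip_cases q r hst with ⟨h0, h1⟩ | ⟨u, hu, ho | ho⟩ | ⟨u, hu, ho | ho⟩ |
    ⟨u, hu, ho | ho⟩ | h'
  · rw [hw] at h1; exact absurd h1 (lt_irrefl _)
  · exact ⟨1, _, C.eq_of_orb (mk_zero_mem _ _) ho⟩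
  · exact ⟨1, _, (C.eq_of_orb (mk_ht_mem 1 _) ho).trans (C.resp.mid u ⟨hu.1.le, hu.2.le⟩).symm⟩
  · exact ⟨1, _, C.eq_of_orb (mk_zero_mem _ _) ho⟩
  · exact absurd ho.1 (by simp)
  · exact absurd ho.1 (by simp)
  · exact ⟨0, _, (C.eq_of_orb (mk_ht_mem 1 _) ho).trans (C.resp.bot u ⟨hu.1.le, hu.2.le⟩)⟩
  · exact absurd (C.eq_p0 h' ▸ C.singular_p0) hns

/-- A saddle connection of height less than `1` that points up crosses cylinder `1`. -/
lemma saddle_up (C : Cyl Y q r) {v : ℂ} {c : ℝ → Y.Pt} (hc : Y.IsSaddleConnection v c)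
    (h0 : 0 < v.im) (h1 : v.im < 1) : v.im = √2 / 2 ∧ ∃ x, (x = q ∨ x = q + 1) ∧
      (Orb 1 ⟨1 + √2 / 2, √2 / 2⟩ 1 (⟨x, 0⟩ + v) ∨ Orb 1 ⟨2 + √2 / 2, √2 / 2⟩ 1 (⟨x, 0⟩ + v)) ∧
      ∀ t ∈ Icc (0 : ℝ) 1, c t = C.G 1 (⟨x, 0⟩ + t * v) := by
  have hs2 := sqrt_two_bounds
  obtain ⟨s, hs, j, w, hw, hcs⟩ := C.exists_start_up hc h0 (δ := √2 / 2) (by positivity)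
  obtain ⟨x, rfl, hx⟩ : ∃ x, w = ⟨x, 0⟩ ∧ (j = 1 → x = q ∨ x = q + 1) := by
    rcases hw with ⟨rfl, rfl⟩ | ⟨rfl, rfl | rfl⟩ <;> exact ⟨_, rfl, by simp⟩
  have hpos : ∀ t : ℝ, 0 < t → 0 < t * v.im := fun t ht => mul_pos ht h0
  rcases lt_or_ge v.im (ht j) with hlt | hge
  · -- the path ends inside the strip
    exfalso
    have h := C.follow hc le_rfl ⟨hs.1, by linarith [hs.2]⟩ hcs
      (fun t ht => line_mem (mul_nonneg ht.1 h0.le) (by nlinarith [ht.2]))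
      (fun t ht => C.line_not_singular (hpos t ht.1) (by nlinarith [ht.2])) 1 (by simp)
    have := hc.2.2.1
    rw [h] at this
    exact C.line_not_singular (hpos 1 one_pos) (by simpa using hlt) this
  obtain rfl : j = 1 := by
    obtain rfl | rfl := fin_two j
    · simp at hge; linarith
    · rfl
  rw [ht_one] at hge
  rcases hge.eq_or_lt with heq | hlt
  · -- the path ends at the upper side
    have h := C.follow hc le_rfl ⟨hs.1, by linarith [hs.2]⟩ hcs
      (fun t ht => line_mem (mul_nonneg ht.1 h0.le) (by rw [ht_one]; nlinarith [ht.2]))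
      (fun t ht => C.line_not_singular (hpos t ht.1) (by rw [ht_one]; nlinarith [ht.2]))
    refine ⟨heq.symm, x, hx rfl, ?_, h⟩
    have h1 := hc.2.2.1
    rw [h 1 (by simp), C.singular_iff] at h1
    have hst : (⟨x, 0⟩ + ((1 : ℝ) : ℂ) * v) ∈ strip 1 := by
      refine line_mem ?_ ?_ <;> simp [h0.le, heq]
    have h2 := vert_top (C.vert_of_eq hst h1) (by simp [heq])
    rw [Complex.ofReal_one, one_mul] at h2
    exact h2.resolve_left fun h => by simpa using h.1
  · -- the path enters the next strip, and ends inside it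
    exfalso
    set b := √2 / 2 / v.im with hb
    have hb1 : b < 1 := (div_lt_one h0).2 hlt
    have hbv : b * v.im = √2 / 2 := div_mul_cancel₀ _ h0.ne'
    have hb0 : 0 < b := by positivity
    have h := C.follow hc hb1.le ⟨hs.1, hs.2.trans (by nlinarith)⟩ hcs
      (fun t ht => line_mem (mul_nonneg ht.1 h0.le) (by rw [ht_one]; nlinarith [ht.2]))
      (fun t ht => C.line_not_singular (hpos t ht.1) (by rw [ht_one]; nlinarith [ht.2]))
    have hnb := hc.2.2.2.1 b ⟨hb0, hb1⟩
    rw [h b ⟨hb0.le, le_rfl⟩] at hnb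
    obtain ⟨i, y, hy⟩ := C.exists_bottom (by simp [hbv]) hnb
    have hup : ∀ t ∈ Icc b 1, (⟨y, 0⟩ + ((t - b : ℝ) : ℂ) * v : ℂ) ∈ strip i := fun t ht => by
      refine line_mem (mul_nonneg (by linarith [ht.1]) h0.le) ?_
      obtain rfl | rfl := fin_two i <;> simp <;> nlinarith [ht.1, ht.2]
    have hns : ∀ t ∈ Icc b 1, ¬ Y.Singular (C.G i (⟨y, 0⟩ + ((t - b : ℝ) : ℂ) * v)) := by
      intro t ht
      rcases ht.1.eq_or_lt with rfl | hbt
      · simpa [← hy] using hnb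
      · refine C.line_not_singular (hpos _ (by linarith)) ?_
        obtain rfl | rfl := fin_two i <;> simp <;> nlinarith [ht.1, ht.2]
    have hst : Y.Straight v (Icc b 1) fun t => C.G i (⟨y, 0⟩ + ((t - b : ℝ) : ℂ) * v) := by
      have := (C.straight i (⟨y, 0⟩ - b * v) v).mono (S := _) (T := Icc b 1) (fun t ht => by
        have := hup t ht
        push_cast at this
        rw [mem_ofPred]
        convert this using 1; ring)
      convert this using 3
      push_cast; ring
    have := hst.eqOn (hc.straight.mono (Icc_subset_Icc_left hb0.le)) isPreconnected_Icc hns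
      (left_mem_Icc.2 hb1.le) (by simp [← hy, h b ⟨hb0.le, le_rfl⟩]) (right_mem_Icc.2 hb1.le)
    refine hns 1 (right_mem_Icc.2 hb1.le) ?_
    simp only at this
    rw [this]
    exact hc.2.2.1

/-- The points of the strips on the right of the vertex. -/
lemma vert_right (C : Cyl Y q r) {j : Fin 2} {w : ℂ} (hw : Vert q r j w) :
    (∀ u ∈ Icc (0 : ℝ) 1, C.G j (w + u) = C.G 1 ⟨q + u, 0⟩) ∨
    (∀ u ∈ Icc (0 : ℝ) 1, C.G j (w + u) = C.G 1 ⟨q + 1 + u, 0⟩) ∨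
    (∀ u ∈ Icc (0 : ℝ) 1, C.G j (w + u) = C.G 0 ⟨u, 0⟩) := by
  have hs := sqrt_two_bounds
  have key : ∀ {i : Fin 2} {x y : ℝ} (u : ℝ), (⟨x, y⟩ : ℂ) ∈ strip i → Orb i ⟨x, y⟩ j w →
      C.G j (w + u) = C.G i ⟨x + u, y⟩ := by
    intro i x y u hx ho
    have h1 := C.eq_of_orb (strip_add_real hx u) (orb_add ho (u : ℂ))
    rw [h1]; congr 1; apply Complex.ext <;> simp
  rcases hw with (h | h | h) | h | h | h
  · exact Or.inr (Or.inr fun u hu => by simpa using key u (mk_zero_mem _ _) h)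
  · exact Or.inl fun u hu => key u (mk_zero_mem _ _) h
  · exact Or.inr (Or.inl fun u hu => key u (mk_zero_mem _ _) h)
  · exact Or.inr (Or.inl fun u hu => by
      rw [C.resp.top u ⟨hu.1, by linarith [hu.2]⟩]; exact key u (mk_ht_mem 0 _) h)
  · exact Or.inl fun u hu => by rw [C.resp.mid u hu]; exact key u (mk_ht_mem 1 _) h
  · exact Or.inr (Or.inr fun u hu => by
      rw [← C.resp.bot u ⟨hu.1, by linarith [hu.2]⟩]; exact key u (mk_ht_mem 1 _) h)

/-- The only horizontal saddle connection of length at most `1` is the closed one of length `1`. -/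
lemma saddle_right (C : Cyl Y q r) {ρ : ℝ} {c : ℝ → Y.Pt} (hc : Y.IsSaddleConnection ρ c)
    (h0 : 0 < ρ) (h1 : ρ ≤ 1) : ρ = 1 ∧ ∀ t ∈ Icc (0 : ℝ) 1, c t = C.G 1 ⟨q + t, 0⟩ := by
  have hs2 := sqrt_two_bounds
  obtain ⟨s, hs, j, w, hw, -, -, hcs⟩ := C.exists_start hc one_pos
  have hu : s * ρ ∈ Icc (0 : ℝ) 1 := ⟨by nlinarith [hs.1], by nlinarith [hs.1, hs.2]⟩
  have e : ∀ (x t : ℝ), (⟨x, 0⟩ + (t : ℂ) * (ρ : ℂ) : ℂ) = ⟨x + t * ρ, 0⟩ := fun x t => by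
    apply Complex.ext <;> simp
  have hcs : C.G j (w + (s * ρ : ℝ)) = c s := by push_cast; exact hcs
  have hu1 : ∀ t ∈ Ioc (0 : ℝ) 1, 0 < t * ρ ∧ t * ρ ≤ 1 := fun t ht =>
    ⟨mul_pos ht.1 h0, by nlinarith [ht.1, ht.2]⟩
  rcases C.vert_right hw with h | h | h
  · rw [h _ hu, ← e] at hcs
    have := C.follow hc le_rfl hs hcs (fun t _ => by rw [e]; exact mk_zero_mem _ _)
      (fun t ht => by
        rw [e]
        exact C.not_singular_mid (hu1 t ⟨ht.1, ht.2.le⟩).1 (by nlinarith [ht.1, ht.2]))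
    have hρ : ρ = 1 := by
      refine h1.eq_or_lt.resolve_right fun hlt => ?_
      have h3 := hc.2.2.1
      rw [this 1 (by simp), e, one_mul] at h3
      exact C.not_singular_mid h0 hlt h3
    subst hρ
    exact ⟨rfl, fun t ht => by rw [this t ht, e, mul_one]⟩
  · exfalso
    rw [h _ hu, ← e] at hcs
    have hns : ∀ t ∈ Ioc (0 : ℝ) 1, ¬ Y.Singular (C.G 1 (⟨q + 1, 0⟩ + (t : ℂ) * (ρ : ℂ))) := by
      intro t ht
      rw [e]
      exact C.not_singular_top (hu1 t ht).1 (by linarith [(hu1 t ht).2])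
    have := C.follow hc le_rfl hs hcs (fun t _ => by rw [e]; exact mk_zero_mem _ _)
      (fun t ht => hns t ⟨ht.1, ht.2.le⟩)
    have h3 := hc.2.2.1
    rw [this 1 (by simp)] at h3
    exact hns 1 (by simp) h3
  · exfalso
    have e0 := e 0
    simp only [zero_add] at e0
    rw [h _ hu, ← e0] at hcs
    have hns : ∀ t ∈ Ioc (0 : ℝ) 1, ¬ Y.Singular (C.G 0 (⟨0, 0⟩ + (t : ℂ) * (ρ : ℂ))) := by
      intro t ht
      rw [e0]
      exact C.not_singular_bot (hu1 t ht).1 (by linarith [(hu1 t ht).2])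
    have := C.follow hc le_rfl hs hcs (fun t _ => by rw [e0]; exact mk_zero_mem _ _)
      (fun t ht => hns t ⟨ht.1, ht.2.le⟩)
    have h3 := hc.2.2.1
    rw [this 1 (by simp)] at h3
    exact hns 1 (by simp) h3

/-- Straight segments that cross cylinder `1` from vertex to vertex are saddle connections. -/
lemma exists_saddle (C : Cyl Y q r) {x : ℝ} {v : ℂ} (hx : x = q ∨ x = q + 1) (hv : v.im = √2 / 2)
    (ho : Orb 1 ⟨1 + √2 / 2, √2 / 2⟩ 1 (⟨x, 0⟩ + v) ∨ Orb 1 ⟨2 + √2 / 2, √2 / 2⟩ 1 (⟨x, 0⟩ + v)) :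
    Y.IsSaddleConnection v fun t => C.G 1 (⟨x, 0⟩ + t * v) := by
  have hp : 0 < v.im := by rw [hv]; positivity
  refine ⟨fun h => by simp [h] at hp, ?_, ?_, fun t ht => ?_, ?_⟩
  · rw [C.singular_iff]
    rcases hx with rfl | rfl
    · simpa using C.p0_Q
    · simpa using C.p0_P
  · rw [C.singular_iff]
    simp only [Complex.ofReal_one, one_mul]
    exact C.eq_p0 (Or.inr (Or.inr ho))
  · exact C.line_not_singular (mul_pos ht.1 hp) (by rw [ht_one]; nlinarith [ht.1, ht.2])
  · exact (C.straight 1 _ v).mono fun t ht => line_mem (mul_nonneg ht.1 hp.le)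
      (by rw [ht_one]; nlinarith [ht.1, ht.2])

/-- The saddle connections of length less than `1`. -/
lemma saddle_short (C : Cyl Y q r) {v : ℂ} {c : ℝ → Y.Pt} (hc : Y.IsSaddleConnection v c)
    (h1 : ‖v‖ < 1) : ∃ v' x, ‖v'‖ = ‖v‖ ∧ v'.im = √2 / 2 ∧ (x = q ∨ x = q + 1) ∧
      (Orb 1 ⟨1 + √2 / 2, √2 / 2⟩ 1 (⟨x, 0⟩ + v') ∨ Orb 1 ⟨2 + √2 / 2, √2 / 2⟩ 1 (⟨x, 0⟩ + v')) ∧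
      c '' Icc 0 1 = (fun t : ℝ => C.G 1 (⟨x, 0⟩ + t * v')) '' Icc 0 1 := by
  have hi := abs_lt.1 ((Complex.abs_im_le_norm v).trans_lt h1)
  have hr := abs_lt.1 ((Complex.abs_re_le_norm v).trans_lt h1)
  rcases lt_trichotomy v.im 0 with h | h | h
  · obtain ⟨h2, x, hx, ho, hcx⟩ := C.saddle_up hc.reverse (by simpa using h)
      (by simp; linarith)
    exact ⟨-v, x, norm_neg v, h2, hx, ho, by rw [← reverse_image c]; exact image_congr hcx⟩
  · exfalso
    have hv : v = (v.re : ℂ) := by apply Complex.ext <;> simp [h]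
    rcases lt_trichotomy v.re 0 with h2 | h2 | h2
    · have h3 := hc.reverse
      rw [hv, ← Complex.ofReal_neg] at h3
      have := (C.saddle_right h3 (by linarith) (by linarith)).1
      linarith
    · rw [h2] at hv
      exact hc.1 (by simpa using hv)
    · rw [hv] at hc
      have := (C.saddle_right hc h2 hr.2.le).1
      linarith
  · obtain ⟨h2, x, hx, ho, hcx⟩ := C.saddle_up hc h hi.2
    exact ⟨v, x, rfl, h2, hx, ho, image_congr hcx⟩

end Cyl

/-! ### Strips assembled from pieces of polygons -/

namespace Gluing

/-- The point of the surface given by the position `x` in the `i`-th polygon (an arbitrary point if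
`x` is not in this polygon). -/
def pt (X : Gluing) [Nonempty X.Pt] (i : Fin X.1.n) (x : ℂ) : X.Pt :=
  Classical.epsilon fun p => ∃ h : x ∈ X.poly i, X.mk i ⟨x, h⟩ = p

lemma pt_eq (X : Gluing) [Nonempty X.Pt] {i : Fin X.1.n} {x : ℂ} (h : x ∈ X.poly i) :
    X.pt i x = X.mk i ⟨x, h⟩ :=
  (Classical.epsilon_spec (p := fun p => ∃ h : x ∈ X.poly i, X.mk i ⟨x, h⟩ = p)
    ⟨_, h, rfl⟩).2.symm

lemma convex_poly (X : Gluing) (i : Fin X.1.n) : Convex ℝ (X.poly i) := convex_convexHull ℝ _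

lemma segment_subset_poly (X : Gluing) (s : X.1.Side) :
    segment ℝ (X.vtx s) (X.vtx (X.1.next s)) ⊆ X.poly s.1 :=
  (X.convex_poly s.1).segment_subset (X.vtx_mem s) (X.vtx_mem (X.1.next s))

lemma glue_vtx (X : Gluing) (s : X.1.Side) :
    X.vtx (X.1.next (X.1.glue s)) - X.vtx (X.1.glue s) = -(X.vtx (X.1.next s) - X.vtx s) :=
  X.2.2.glue s

lemma glue_mem (X : Gluing) {s : X.1.Side} {x : ℂ}
    (hx : x ∈ segment ℝ (X.vtx s) (X.vtx (X.1.next s))) :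
    x - X.vtx s + X.vtx (X.1.next (X.1.glue s)) ∈
      segment ℝ (X.vtx (X.1.glue s)) (X.vtx (X.1.next (X.1.glue s))) := by
  have h := X.glue_vtx s
  rw [segment_symm]
  rw [segment_eq_image'] at hx ⊢
  obtain ⟨t, ht, rfl⟩ := hx
  refine ⟨t, ht, ?_⟩
  simp only [Complex.real_smul]
  linear_combination (-(t : ℂ)) * h

lemma pt_glue (X : Gluing) [Nonempty X.Pt] (s : X.1.Side) {x : ℂ}
    (hx : x ∈ segment ℝ (X.vtx s) (X.vtx (X.1.next s))) :
    X.pt s.1 x = X.pt (X.1.glue s).1 (x - X.vtx s + X.vtx (X.1.next (X.1.glue s))) := by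
  rw [X.pt_eq (X.segment_subset_poly s hx), X.pt_eq (X.segment_subset_poly _ (X.glue_mem hx))]
  exact Quot.sound ⟨s.2, (X.1.glue s).2, rfl, hx, add_sub_cancel_right _ _⟩

end Gluing

/-- A strip of height `h`, cut by the lines from `⟨lo k, 0⟩` to `⟨hi k, h⟩` into `m` trapezoids
and their translates by multiples of the circumference `L`. The `k`-th trapezoid is placed in the
polygon `idx k` by the translation `-τ k`. -/
structure Slab (Y : Gluing) [Nonempty Y.Pt] (h L : ℝ) where
  m : ℕ
  lo : ℕ → ℝ
  hi : ℕ → ℝ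
  idx : ℕ → Fin Y.1.n
  τ : ℕ → ℂ
  m_pos : 0 < m
  lo_le : ∀ k < m, lo k ≤ lo (k + 1)
  hi_le : ∀ k < m, hi k ≤ hi (k + 1)
  lo_wrap : lo m = lo 0 + L
  hi_wrap : hi m = hi 0 + L
  corner : ∀ k < m, (⟨lo k, 0⟩ - τ k ∈ Y.poly (idx k) ∧ ⟨lo (k + 1), 0⟩ - τ k ∈ Y.poly (idx k)) ∧
    ⟨hi k, h⟩ - τ k ∈ Y.poly (idx k) ∧ ⟨hi (k + 1), h⟩ - τ k ∈ Y.poly (idx k)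
  seam : ∀ k, k + 1 < m → ∀ w ∈ segment ℝ (⟨lo (k + 1), 0⟩ : ℂ) ⟨hi (k + 1), h⟩,
    Y.pt (idx k) (w - τ k) = Y.pt (idx (k + 1)) (w - τ (k + 1))
  wrap : ∀ w ∈ segment ℝ (⟨lo 0, 0⟩ : ℂ) ⟨hi 0, h⟩,
    Y.pt (idx (m - 1)) (w + L - τ (m - 1)) = Y.pt (idx 0) (w - τ 0)

namespace Slab

variable {Y : Gluing} [Nonempty Y.Pt] {h L : ℝ}

/-- The point of the `k`-th line at height `y`. -/
def line (S : Slab Y h L) (k : ℕ) (y : ℝ) : ℝ := S.lo k + (S.hi k - S.lo k) * (y / h)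

/-- The `k`-th trapezoid. -/
def trap (S : Slab Y h L) (k : ℕ) : Set ℂ :=
  {w | (0 ≤ w.im ∧ w.im ≤ h) ∧ S.line k w.im ≤ w.re ∧ w.re ≤ S.line (k + 1) w.im}

lemma ratio_mem (hh : 0 < h) {y : ℝ} (h0 : 0 ≤ y) (h1 : y ≤ h) : 0 ≤ y / h ∧ y / h ≤ 1 :=
  ⟨div_nonneg h0 hh.le, (div_le_one hh).2 h1⟩

lemma line_le (S : Slab Y h L) (hh : 0 < h) {k : ℕ} (hk : k < S.m) {y : ℝ} (h0 : 0 ≤ y)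
    (h1 : y ≤ h) : S.line k y ≤ S.line (k + 1) y := by
  obtain ⟨h2, h3⟩ := ratio_mem hh h0 h1
  unfold line
  nlinarith [S.lo_le k hk, S.hi_le k hk]

lemma line_mono (S : Slab Y h L) (hh : 0 < h) {k l : ℕ} (hkl : k ≤ l) (hl : l ≤ S.m) {y : ℝ}
    (h0 : 0 ≤ y) (h1 : y ≤ h) : S.line k y ≤ S.line l y := by
  induction l, hkl using Nat.le_induction with
  | base => exact le_rfl
  | succ l _ ih => exact (ih (by omega)).trans (S.line_le hh (by omega) h0 h1)

lemma line_wrap (S : Slab Y h L) (y : ℝ) : S.line S.m y = S.line 0 y + L := by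
  unfold line; rw [S.lo_wrap, S.hi_wrap]; ring

lemma isClosed_trap (S : Slab Y h L) (k : ℕ) : IsClosed (S.trap k) := by
  have hl : ∀ k, Continuous fun w : ℂ => S.line k w.im := fun k => by unfold line; fun_prop
  exact ((isClosed_le continuous_const Complex.continuous_im).inter
    (isClosed_le Complex.continuous_im continuous_const)).inter
    ((isClosed_le (hl k) Complex.continuous_re).inter
      (isClosed_le Complex.continuous_re (hl (k + 1))))

lemma mem_line (S : Slab Y h L) (hh : 0 < h) {k : ℕ} {w : ℂ} (h0 : 0 ≤ w.im) (h1 : w.im ≤ h)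
    (hw : w.re = S.line k w.im) : w ∈ segment ℝ (⟨S.lo k, 0⟩ : ℂ) ⟨S.hi k, h⟩ := by
  obtain ⟨h2, h3⟩ := ratio_mem hh h0 h1
  rw [segment_eq_image']
  refine ⟨w.im / h, ⟨h2, h3⟩, ?_⟩
  apply Complex.ext
  · simp [hw, line]; ring
  · simp; field_simp

lemma trap_mem (S : Slab Y h L) (hh : 0 < h) {k : ℕ} (hk : k < S.m) {w : ℂ} (hw : w ∈ S.trap k) :
    w - S.τ k ∈ Y.poly (S.idx k) := by
  obtain ⟨⟨h0, h1⟩, h2, h3⟩ := hw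
  obtain ⟨⟨c1, c2⟩, c3, c4⟩ := S.corner k hk
  have hK : Convex ℝ {w : ℂ | w - S.τ k ∈ Y.poly (S.idx k)} := by
    have := (Y.convex_poly (S.idx k)).translate_preimage_left (-S.τ k)
    simpa [preimage, sub_eq_add_neg] using this
  have a1 : (⟨S.line k w.im, w.im⟩ : ℂ) ∈ {w : ℂ | w - S.τ k ∈ Y.poly (S.idx k)} :=
    hK.segment_subset c1 c3 (S.mem_line hh h0 h1 rfl)
  have a2 : (⟨S.line (k + 1) w.im, w.im⟩ : ℂ) ∈ {w : ℂ | w - S.τ k ∈ Y.poly (S.idx k)} :=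
    hK.segment_subset c2 c4 (S.mem_line hh h0 h1 rfl)
  refine hK.segment_subset a1 a2 ?_
  have := segment_eq_Icc (𝕜 := ℝ) (h2.trans h3) ▸ (mem_Icc.2 ⟨h2, h3⟩)
  obtain ⟨a, b, ha, hb, hab, hx⟩ := this
  refine ⟨a, b, ha, hb, hab, ?_⟩
  apply Complex.ext
  · simpa using hx
  · simp; rw [← add_mul, hab, one_mul]

/-- The chart of the `k`-th trapezoid. -/
def φ (S : Slab Y h L) (k : ℕ) (w : ℂ) : Y.Pt := Y.pt (S.idx k) (w - S.τ k)

lemma φ_eq (S : Slab Y h L) (hh : 0 < h) {k l : ℕ} (hkl : k ≤ l) (hl : l < S.m) {w : ℂ}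
    (hk : w ∈ S.trap k) (hw : w ∈ S.trap l) : S.φ k w = S.φ l w := by
  induction l, hkl using Nat.le_induction with
  | base => rfl
  | succ l hkl ih =>
    obtain ⟨⟨h0, h1⟩, h2, h3⟩ := hw
    have h4 : w.re = S.line (l + 1) w.im :=
      le_antisymm (hk.2.2.trans (S.line_mono hh (by omega) (by omega) h0 h1)) h2
    have h5 : w ∈ S.trap l := ⟨⟨h0, h1⟩, h4 ▸ S.line_le hh (by omega) h0 h1, h4.le⟩
    exact (ih (by omega) h5).trans (S.seam l hl w (S.mem_line hh h0 h1 h4))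

lemma exists_trap (S : Slab Y h L) {w : ℂ} (h0 : 0 ≤ w.im) (h1 : w.im ≤ h)
    (h2 : S.line 0 w.im ≤ w.re) (h3 : w.re ≤ S.line S.m w.im) : ∃ k < S.m, w ∈ S.trap k := by
  have key : ∀ n ≤ S.m, w.re ≤ S.line n w.im → 0 < n → ∃ k < n, w ∈ S.trap k := by
    intro n
    induction n with
    | zero => intro _ _ h; omega
    | succ n ih =>
      intro hn h4 _
      rcases le_or_gt (S.line n w.im) w.re with h5 | h5
      · exact ⟨n, by omega, ⟨h0, h1⟩, h5, h4⟩
      · obtain ⟨k, hk, hw⟩ := ih (by omega) h5.le (by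
          rcases Nat.eq_zero_or_pos n with rfl | h
          · linarith
          · exact h)
        exact ⟨k, by omega, hw⟩
  exact key _ le_rfl h3 S.m_pos

/-- The chart of the strip. -/
def G (S : Slab Y h L) (w : ℂ) : Y.Pt :=
  Classical.epsilon fun p => ∃ k < S.m, ∃ n : ℤ, w - n * L ∈ S.trap k ∧ S.φ k (w - n * L) = p

lemma sub_mul_re (w : ℂ) (n : ℤ) (L : ℝ) : (w - n * L).re = w.re - n * L := by simp

lemma sub_mul_im (w : ℂ) (n : ℤ) (L : ℝ) : (w - n * L).im = w.im := by simp

lemma G_unique (S : Slab Y h L) (hh : 0 < h) (hL : 0 < L) {w : ℂ} {k k' : ℕ} {n n' : ℤ}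
    (hk : k < S.m) (hk' : k' < S.m) (hw : w - n * L ∈ S.trap k) (hw' : w - n' * L ∈ S.trap k') :
    S.φ k (w - n * L) = S.φ k' (w - n' * L) := by
  wlog hn : n ≤ n' generalizing k k' n n'
  · exact (this hk' hk hw' hw (by omega)).symm
  rcases hn.eq_or_lt with rfl | hn
  · rcases le_total k k' with h1 | h1
    · exact S.φ_eq hh h1 hk' hw hw'
    · exact (S.φ_eq hh h1 hk hw' hw).symm
  have hn : n + 1 ≤ n' := hn
  obtain ⟨⟨h0, h1⟩, h2, h3⟩ := hw
  obtain ⟨-, h2', h3'⟩ := hw'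
  have e1 := h3.trans (S.line_mono hh (by omega : k + 1 ≤ S.m) le_rfl h0 h1)
  have e2 := (S.line_mono hh (Nat.zero_le k') hk'.le (by simpa using h0) (by simpa using h1)).trans h2'
  rw [S.line_wrap] at e1
  rw [sub_mul_re, sub_mul_im] at e1 e2
  have hc : (n : ℝ) + 1 ≤ n' := by exact_mod_cast hn
  have hn1 : (n' : ℝ) = n + 1 := le_antisymm (by nlinarith) hc
  have e3 : w.re - n * L = S.line 0 w.im + L := by nlinarith
  have hn' : n' = n + 1 := by exact_mod_cast hn1
  obtain ⟨m, hm⟩ : ∃ m, S.m = m + 1 := ⟨S.m - 1, by have := S.m_pos; omega⟩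
  rw [sub_mul_im] at h0 h1
  have t1 : w - n * L ∈ S.trap m := by
    refine ⟨?_, ?_, ?_⟩ <;> rw [sub_mul_im]
    · exact ⟨h0, h1⟩
    · rw [sub_mul_re, e3, ← S.line_wrap]; exact S.line_mono hh (by omega) le_rfl h0 h1
    · rw [sub_mul_re, e3, ← S.line_wrap, hm]
  have t2 : w - n' * L ∈ S.trap 0 := by
    refine ⟨?_, ?_, ?_⟩ <;> rw [sub_mul_im]
    · exact ⟨h0, h1⟩
    · rw [sub_mul_re]; nlinarith
    · refine le_trans ?_ (S.line_le hh S.m_pos h0 h1); rw [sub_mul_re]; nlinarith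
  have e4 := S.wrap (w - n' * L) (S.mem_line hh (by simpa using h0) (by simpa using h1) (by
    rw [sub_mul_re, sub_mul_im]; nlinarith))
  have e5 : w - n' * L + L = w - n * L := by rw [hn']; push_cast; ring
  rw [e5, hm, Nat.add_sub_cancel] at e4
  calc S.φ k (w - n * L) = S.φ m (w - n * L) :=
        S.φ_eq hh (by omega) (by omega) ⟨⟨by simpa using h0, by simpa using h1⟩, h2, h3⟩ t1
    _ = S.φ 0 (w - n' * L) := e4
    _ = S.φ k' (w - n' * L) :=
        S.φ_eq hh (by omega) hk' t2 ⟨⟨by simpa using h0, by simpa using h1⟩, h2', h3'⟩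

lemma G_eq (S : Slab Y h L) (hh : 0 < h) (hL : 0 < L) {w : ℂ} {k : ℕ} (hk : k < S.m) (n : ℤ)
    (hw : w - n * L ∈ S.trap k) : S.G w = S.φ k (w - n * L) := by
  obtain ⟨k', hk', n', hw', he⟩ := Classical.epsilon_spec
    (p := fun p => ∃ k < S.m, ∃ n : ℤ, w - n * L ∈ S.trap k ∧ S.φ k (w - n * L) = p)
    ⟨_, k, hk, n, hw, rfl⟩
  exact he.symm.trans (S.G_unique hh hL hk' hk hw' hw)

lemma G_eq_zero (S : Slab Y h L) (hh : 0 < h) (hL : 0 < L) {w : ℂ} {k : ℕ} (hk : k < S.m)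
    (hw : w ∈ S.trap k) : S.G w = Y.pt (S.idx k) (w - S.τ k) := by
  have := S.G_eq hh hL hk 0 (w := w) (by simpa using hw)
  simpa [φ] using this

lemma exists_rep (S : Slab Y h L) (hL : 0 < L) {w : ℂ} (h0 : 0 ≤ w.im) (h1 : w.im ≤ h) :
    ∃ k < S.m, w - ⌊(w.re - S.line 0 w.im) / L⌋ * L ∈ S.trap k := by
  set n := ⌊(w.re - S.line 0 w.im) / L⌋ with hn
  have f1 := Int.floor_le ((w.re - S.line 0 w.im) / L)
  have f2 := Int.lt_floor_add_one ((w.re - S.line 0 w.im) / L)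
  rw [← hn, le_div_iff₀ hL] at f1
  rw [← hn, div_lt_iff₀ hL] at f2
  refine S.exists_trap (by simpa using h0) (by simpa using h1) ?_ ?_ <;>
    rw [sub_mul_re, sub_mul_im]
  · linarith
  · rw [S.line_wrap]; linarith

lemma G_per (S : Slab Y h L) (hh : 0 < h) (hL : 0 < L) {w : ℂ} (h0 : 0 ≤ w.im) (h1 : w.im ≤ h) :
    S.G (w + L) = S.G w := by
  obtain ⟨k, hk, hw⟩ := S.exists_rep hL h0 h1
  set n := ⌊(w.re - S.line 0 w.im) / L⌋
  have e : w + L - ((n + 1 : ℤ) : ℂ) * L = w - n * L := by push_cast; ring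
  rw [S.G_eq hh hL hk n hw, S.G_eq hh hL hk (n + 1) (e ▸ hw), e]

lemma G_disp (S : Slab Y h L) (hh : 0 < h) (hL : 0 < L) (w : ℂ) :
    ∃ ε > 0, ∀ z, ‖z‖ < ε → 0 ≤ (w + z).im → (w + z).im ≤ h → Y.Disp (S.G w) (S.G (w + z)) z := by
  set f : ℂ → ℝ := fun z => ((w + z).re - S.line 0 (w + z).im) / L with hf
  have hfc : Continuous f := by
    rw [hf]; unfold line; fun_prop
  -- only three translates of the trapezoids come near the given point
  set N := ⌊f 0⌋ with hN
  have hfin : ∀ᶠ z in 𝓝 (0 : ℂ), ⌊f z⌋ ∈ Finset.Icc (N - 1) (N + 1) := by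
    have h2 := hfc.continuousAt.eventually (Ioo_mem_nhds (a := (N : ℝ) - 1) (b := N + 2)
      (by linarith [Int.floor_le (f 0)]) (by linarith [Int.lt_floor_add_one (f 0)]))
    filter_upwards [h2] with z hz
    rw [Finset.mem_Icc]
    constructor
    · exact Int.le_floor.2 (by push_cast; exact hz.1.le)
    · have := Int.floor_lt.2 (show f z < ((N + 2 : ℤ) : ℝ) by push_cast; exact hz.2)
      omega
  have hpc : ∀ᶠ z in 𝓝 (0 : ℂ), ∀ n ∈ Finset.Icc (N - 1) (N + 1), ∀ k ∈ Finset.range S.m,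
      w - n * L ∉ S.trap k → w + z - n * L ∉ S.trap k := by
    rw [Filter.eventually_all_finset]
    intro n _
    rw [Filter.eventually_all_finset]
    intro k _
    by_cases hk : w - n * L ∈ S.trap k
    · filter_upwards with z h using absurd hk h
    · have hc : ContinuousAt (fun z : ℂ => w + z - n * L) 0 := by fun_prop
      filter_upwards [hc.eventually ((S.isClosed_trap k).isOpen_compl.mem_nhds
        (by simpa using hk))] with z hz _
      exact hz
  obtain ⟨ε, hε, H⟩ := Metric.eventually_nhds_iff.1 (hfin.and hpc)
  refine ⟨ε, hε, fun z hz h2 h3 => ?_⟩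
  obtain ⟨a1, a2⟩ := H (y := z) (by simpa using hz)
  obtain ⟨k, hk, hwz⟩ := S.exists_rep hL h2 h3
  set n := ⌊((w + z).re - S.line 0 (w + z).im) / L⌋
  have hw : w - n * L ∈ S.trap k := by
    by_contra hn
    exact a2 n a1 k (Finset.mem_range.2 hk) hn hwz
  rw [S.G_eq hh hL hk n hw, S.G_eq hh hL hk n hwz]
  refine ⟨S.idx k, ⟨_, S.trap_mem hh hk hw⟩, ⟨_, S.trap_mem hh hk hwz⟩, (Y.pt_eq _).symm,
    (Y.pt_eq _).symm, ?_⟩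
  simp

end Slab

/-- The two strips of a surface, assembled from pieces of polygons. -/
def Cyl.ofSlabs {Y : Gluing} [Nonempty Y.Pt] {q r : ℝ} (S : ∀ j, Slab Y (ht j) (circ j))
    (mid : ∀ u ∈ Icc (0 : ℝ) 1, (S 1).G ⟨q + u, 0⟩ = (S 1).G ⟨1 + √2 / 2 + u, √2 / 2⟩)
    (top : ∀ u ∈ Icc (0 : ℝ) (1 + √2), (S 1).G ⟨q + 1 + u, 0⟩ = (S 0).G ⟨r + u, 1⟩)
    (bot : ∀ u ∈ Icc (0 : ℝ) (1 + √2), (S 1).G ⟨2 + √2 / 2 + u, √2 / 2⟩ = (S 0).G ⟨u, 0⟩)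
    (cover : ∀ i, ∀ x ∈ Y.poly i, ∃ j, ∃ k < (S j).m, (S j).idx k = i ∧
      x + (S j).τ k ∈ (S j).trap k)
    (univ : ∀ {T : Type} (g : Fin 2 → ℂ → T), Respects q r g → ∃ F : Fin Y.1.n → ℂ → T,
      (∀ j, ∀ k < (S j).m, ∀ w ∈ (S j).trap k, F ((S j).idx k) (w - (S j).τ k) = g j w) ∧
      ∀ s, ∀ x ∈ segment ℝ (Y.vtx s) (Y.vtx (Y.1.next s)),
        F s.1 x = F (Y.1.glue s).1 (x - Y.vtx s + Y.vtx (Y.1.next (Y.1.glue s)))) :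
    Cyl Y q r where
  G j := (S j).G
  resp := ⟨fun j _ hw => (S j).G_per (ht_pos j) (circ_pos_all j) hw.1 hw.2, mid, top, bot⟩
  κ := Σ j, Fin (S j).m
  fin := inferInstance
  idx a := (S a.1).idx a.2
  D a := {x | x + (S a.1).τ a.2 ∈ (S a.1).trap a.2}
  τ a := (S a.1).τ a.2
  str a := a.1
  closed a := ((S a.1).isClosed_trap a.2).preimage (by fun_prop)
  cover i x := by
    obtain ⟨j, k, hk, h1, h2⟩ := cover i x x.2
    exact ⟨⟨j, k, hk⟩, h1, h2⟩
  piece a x hx := by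
    refine ⟨hx.1, ?_⟩
    rw [(S a.1).G_eq_zero (ht_pos _) (circ_pos_all _) a.2.2 hx, add_sub_cancel_right,
      Y.pt_eq x.2]
  disp j w hw := by
    obtain ⟨ε, hε, h⟩ := (S j).G_disp (ht_pos j) (circ_pos_all j) w
    exact ⟨ε, hε, fun z hz hwz => h z hz hwz.1 hwz.2⟩
  univ g hg := by
    obtain ⟨F, h1, h2⟩ := univ g hg
    refine ⟨Quot.lift (fun a => F a.1 a.2) ?_, fun j w hw => ?_⟩
    · rintro ⟨i, x⟩ ⟨i', y⟩ ⟨k, l, hkl, hx, hy⟩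
      have := h2 ⟨i, k⟩ x hx
      simp only at hkl hy ⊢
      rw [hkl] at this
      rw [this, ← hy]
      simp
    · obtain ⟨k, hk, hn⟩ := (S j).exists_rep (circ_pos_all j) hw.1 hw.2
      set n := ⌊(w.re - (S j).line 0 w.im) / circ j⌋
      rw [(S j).G_eq (ht_pos j) (circ_pos_all j) hk n hn, Slab.φ,
        Y.pt_eq ((S j).trap_mem (ht_pos j) hk hn)]
      change F _ _ = _
      rw [h1 j k hk _ hn]
      have := hg.per_int j hw (-n)
      rw [← this]
      congr 1; push_cast; ring

/-! ### Surfaces with one polygon for each cylinder -/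

lemma mem_hseg {x x₀ x₁ y : ℝ} (h : x₀ ≤ x ∧ x ≤ x₁ ∨ x₁ ≤ x ∧ x ≤ x₀) :
    (⟨x, y⟩ : ℂ) ∈ segment ℝ (⟨x₀, y⟩ : ℂ) ⟨x₁, y⟩ := by
  wlog hh : x₀ ≤ x ∧ x ≤ x₁ generalizing x₀ x₁
  · rw [segment_symm]
    exact this h.symm (h.resolve_left hh)
  obtain ⟨a, b, ha, hb, hab, hx⟩ := segment_eq_Icc (𝕜 := ℝ) (hh.1.trans hh.2) ▸ mem_Icc.2 hh
  refine ⟨a, b, ha, hb, hab, ?_⟩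
  apply Complex.ext
  · simpa using hx
  · simp; rw [← add_mul, hab, one_mul]

lemma pt_glue_eq {X : Gluing} [Nonempty X.Pt] (s : X.1.Side) {s' : X.1.Side} (hs : X.1.glue s = s')
    {x y : ℂ} (hx : x ∈ segment ℝ (X.vtx s) (X.vtx (X.1.next s)))
    (hy : y = x - X.vtx s + X.vtx (X.1.next s')) : X.pt s.1 x = X.pt s'.1 y := by
  subst hs hy
  exact X.pt_glue s hx

/-- A compatibility with the side pairings has to be checked on one side of each pair only. -/
lemma compat_of_half {X : Gluing} {T : Type} {F : Fin X.1.n → ℂ → T} (l : List X.1.Side)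
    (hl : ∀ s, s ∈ l ∨ X.1.glue s ∈ l)
    (h : ∀ s ∈ l, ∀ x ∈ segment ℝ (X.vtx s) (X.vtx (X.1.next s)),
      F s.1 x = F (X.1.glue s).1 (x - X.vtx s + X.vtx (X.1.next (X.1.glue s)))) :
    ∀ s, ∀ x ∈ segment ℝ (X.vtx s) (X.vtx (X.1.next s)),
      F s.1 x = F (X.1.glue s).1 (x - X.vtx s + X.vtx (X.1.next (X.1.glue s))) := by
  intro s x hx
  rcases hl s with hs | hs
  · exact h s hs x hx
  · have := h _ hs _ (X.glue_mem hx)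
    rw [this, X.1.glue_glue]
    congr 1
    linear_combination -X.glue_vtx s

namespace Slab

variable {Y : Gluing} [Nonempty Y.Pt] {h L : ℝ}

/-- A strip that is cut into translates of a single trapezoid. -/
def one (i : Fin Y.1.n) (a b : ℝ) (τ : ℂ) (hL : 0 ≤ L)
    (corner : (⟨a, 0⟩ - τ ∈ Y.poly i ∧ ⟨a + L, 0⟩ - τ ∈ Y.poly i) ∧
      ⟨b, h⟩ - τ ∈ Y.poly i ∧ ⟨b + L, h⟩ - τ ∈ Y.poly i)
    (wrap : ∀ w ∈ segment ℝ (⟨a, 0⟩ : ℂ) ⟨b, h⟩, Y.pt i (w + L - τ) = Y.pt i (w - τ)) :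
    Slab Y h L where
  m := 1
  lo k := a + k * L
  hi k := b + k * L
  idx _ := i
  τ _ := τ
  m_pos := one_pos
  lo_le k _ := by push_cast; linarith
  hi_le k _ := by push_cast; linarith
  lo_wrap := by simp
  hi_wrap := by simp
  corner k hk := by
    obtain rfl : k = 0 := by omega
    simpa using corner
  seam k hk := by omega
  wrap w hw := wrap w (by simpa using hw)

variable {i : Fin Y.1.n} {a b : ℝ} {τ : ℂ} {hL : 0 ≤ L} {corner : (⟨a, 0⟩ - τ ∈ Y.poly i ∧
  ⟨a + L, 0⟩ - τ ∈ Y.poly i) ∧ ⟨b, h⟩ - τ ∈ Y.poly i ∧ ⟨b + L, h⟩ - τ ∈ Y.poly i}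
  {wrap : ∀ w ∈ segment ℝ (⟨a, 0⟩ : ℂ) ⟨b, h⟩, Y.pt i (w + L - τ) = Y.pt i (w - τ)}

lemma mem_one_trap {w : ℂ} : w ∈ (one i a b τ hL corner wrap).trap 0 ↔ (0 ≤ w.im ∧ w.im ≤ h) ∧
    a + (b - a) * (w.im / h) ≤ w.re ∧ w.re ≤ a + (b - a) * (w.im / h) + L := by
  have : a + L + (b - a) * (w.im / h) = a + (b - a) * (w.im / h) + L := by ring
  simp [trap, line, one, this]

lemma one_bot (hh : 0 < h) (hL' : 0 < L) {x : ℝ} (n : ℤ) (hx : x ∈ Icc a (a + L)) :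
    (one i a b τ hL corner wrap).G ⟨x + n * L, 0⟩ = Y.pt i (⟨x, 0⟩ - τ) := by
  have e : (⟨x + n * L, 0⟩ : ℂ) - n * L = ⟨x, 0⟩ := by apply Complex.ext <;> simp
  have := (one i a b τ hL corner wrap).G_eq hh hL' (w := ⟨x + n * L, 0⟩) (k := 0) one_pos n
    (by rw [e, mem_one_trap]; simpa [hh.le] using hx)
  rw [this, e]; rfl

lemma one_top (hh : 0 < h) (hL' : 0 < L) {x : ℝ} (n : ℤ) (hx : x ∈ Icc b (b + L)) :
    (one i a b τ hL corner wrap).G ⟨x + n * L, h⟩ = Y.pt i (⟨x, h⟩ - τ) := by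
  have e : (⟨x + n * L, h⟩ : ℂ) - n * L = ⟨x, h⟩ := by apply Complex.ext <;> simp
  have := (one i a b τ hL corner wrap).G_eq hh hL' (w := ⟨x + n * L, h⟩) (k := 0) one_pos n
    (by rw [e, mem_one_trap]; simpa [hh.le, hh.ne'] using hx)
  rw [this, e]; rfl

end Slab

/-- The trapezoid of a strip with lower left corner `a` and upper left corner `b`. -/
def trapezoid (h L a b : ℝ) : Set ℂ :=
  {w | (0 ≤ w.im ∧ w.im ≤ h) ∧ a + (b - a) * (w.im / h) ≤ w.re ∧
    w.re ≤ a + (b - a) * (w.im / h) + L}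

lemma convex_trapezoid (h L a b : ℝ) : Convex ℝ (trapezoid h L a b) := by
  have key : ∀ f : ℂ →ₗ[ℝ] ℝ, ∀ c : ℝ, Convex ℝ {w | f w ≤ c} := fun f c =>
    convex_halfSpace_le f.isLinear c
  have e : trapezoid h L a b = ({w | (-Complex.imLm) w ≤ 0} ∩ {w | Complex.imLm w ≤ h}) ∩
      ({w | (((b - a) / h) • Complex.imLm - Complex.reLm) w ≤ -a} ∩
        {w | (Complex.reLm - ((b - a) / h) • Complex.imLm) w ≤ a + L}) := by
    ext w
    have : (b - a) / h * w.im = (b - a) * (w.im / h) := by ring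
    simp only [trapezoid, mem_inter_iff, Set.mem_ofPred_eq, LinearMap.sub_apply, LinearMap.neg_apply,
      LinearMap.smul_apply, Complex.imLm_coe, Complex.reLm_coe, smul_eq_mul, this]
    constructor
    · rintro ⟨⟨h1, h2⟩, h3, h4⟩; exact ⟨⟨by linarith, h2⟩, by linarith, by linarith⟩
    · rintro ⟨⟨h1, h2⟩, h3, h4⟩; exact ⟨⟨by linarith, h2⟩, by linarith, by linarith⟩
  rw [e]
  exact ((key _ _).inter (key _ _)).inter ((key _ _).inter (key _ _))

/-- Two polygons, translates of trapezoids that cover the two cylinders. -/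
def Cyl.ofTwo {Y : Gluing} [Nonempty Y.Pt] {q r : ℝ} (i₀ i₁ : Fin Y.1.n) (hi : i₁ ≠ i₀)
    (hi' : ∀ i, i = i₀ ∨ i = i₁) (a₀ b₀ a₁ b₁ : ℝ) (τ₀ τ₁ : ℂ)
    (corner₀ : (⟨a₀, 0⟩ - τ₀ ∈ Y.poly i₀ ∧ ⟨a₀ + (1 + √2), 0⟩ - τ₀ ∈ Y.poly i₀) ∧
      ⟨b₀, 1⟩ - τ₀ ∈ Y.poly i₀ ∧ ⟨b₀ + (1 + √2), 1⟩ - τ₀ ∈ Y.poly i₀)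
    (corner₁ : (⟨a₁, 0⟩ - τ₁ ∈ Y.poly i₁ ∧ ⟨a₁ + (2 + √2), 0⟩ - τ₁ ∈ Y.poly i₁) ∧
      ⟨b₁, √2 / 2⟩ - τ₁ ∈ Y.poly i₁ ∧ ⟨b₁ + (2 + √2), √2 / 2⟩ - τ₁ ∈ Y.poly i₁)
    (wrap₀ : ∀ w ∈ segment ℝ (⟨a₀, 0⟩ : ℂ) ⟨b₀, 1⟩,
      Y.pt i₀ (w - τ₀) = Y.pt i₀ (w - τ₀ + (1 + √2 : ℝ)))
    (wrap₁ : ∀ w ∈ segment ℝ (⟨a₁, 0⟩ : ℂ) ⟨b₁, √2 / 2⟩,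
      Y.pt i₁ (w - τ₁) = Y.pt i₁ (w - τ₁ + (2 + √2 : ℝ)))
    (verts₀ : ∀ k, Y.vtx ⟨i₀, k⟩ + τ₀ ∈ trapezoid 1 (1 + √2) a₀ b₀)
    (verts₁ : ∀ k, Y.vtx ⟨i₁, k⟩ + τ₁ ∈ trapezoid (√2 / 2) (2 + √2) a₁ b₁)
    (rel : ∀ B₀ U₀ B₁ U₁ : ℝ → Y.Pt,
      (∀ x y (n : ℤ) P, x ∈ Icc a₀ (a₀ + (1 + √2)) → y = x + n * (1 + √2) → P + τ₀ = ⟨x, 0⟩ →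
        B₀ y = Y.pt i₀ P) →
      (∀ x y (n : ℤ) P, x ∈ Icc b₀ (b₀ + (1 + √2)) → y = x + n * (1 + √2) → P + τ₀ = ⟨x, 1⟩ →
        U₀ y = Y.pt i₀ P) →
      (∀ x y (n : ℤ) P, x ∈ Icc a₁ (a₁ + (2 + √2)) → y = x + n * (2 + √2) → P + τ₁ = ⟨x, 0⟩ →
        B₁ y = Y.pt i₁ P) →
      (∀ x y (n : ℤ) P, x ∈ Icc b₁ (b₁ + (2 + √2)) → y = x + n * (2 + √2) → P + τ₁ = ⟨x, √2 / 2⟩ →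
        U₁ y = Y.pt i₁ P) →
      (∀ u ∈ Icc (0 : ℝ) 1, B₁ (q + u) = U₁ (1 + √2 / 2 + u)) ∧
      (∀ u ∈ Icc (0 : ℝ) (1 + √2), B₁ (q + 1 + u) = U₀ (r + u)) ∧
      (∀ u ∈ Icc (0 : ℝ) (1 + √2), U₁ (2 + √2 / 2 + u) = B₀ u))
    (univ : ∀ {T : Type} (g : Fin 2 → ℂ → T), Respects q r g → ∀ F : Fin Y.1.n → ℂ → T,
      (∀ x, F i₀ x = g 0 (x + τ₀)) → (∀ x, F i₁ x = g 1 (x + τ₁)) →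
      ∀ s, ∀ x ∈ segment ℝ (Y.vtx s) (Y.vtx (Y.1.next s)),
        F s.1 x = F (Y.1.glue s).1 (x - Y.vtx s + Y.vtx (Y.1.next (Y.1.glue s)))) :
    {C : Cyl Y q r // (∀ w ∈ trapezoid 1 (1 + √2) a₀ b₀, C.G 0 w = Y.pt i₀ (w - τ₀)) ∧
      ∀ w ∈ trapezoid (√2 / 2) (2 + √2) a₁ b₁, C.G 1 w = Y.pt i₁ (w - τ₁)} := by
  let S₀ : Slab Y (ht 0) (circ 0) := Slab.one i₀ a₀ b₀ τ₀ (circ_pos_all 0).le corner₀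
    fun w hw => by rw [add_sub_right_comm]; exact (wrap₀ w hw).symm
  let S₁ : Slab Y (ht 1) (circ 1) := Slab.one i₁ a₁ b₁ τ₁ (circ_pos_all 1).le corner₁
    fun w hw => by rw [add_sub_right_comm]; exact (wrap₁ w hw).symm
  have t₀ : ∀ w ∈ trapezoid 1 (1 + √2) a₀ b₀, w ∈ S₀.trap 0 := fun w hw => Slab.mem_one_trap.2 hw
  have t₁ : ∀ w ∈ trapezoid (√2 / 2) (2 + √2) a₁ b₁, w ∈ S₁.trap 0 :=
    fun w hw => Slab.mem_one_trap.2 hw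
  let S : ∀ j, Slab Y (ht j) (circ j) := Fin.cons S₀ (Fin.cons S₁ finZeroElim)
  have hrel := rel (fun x => S₀.G ⟨x, 0⟩) (fun x => S₀.G ⟨x, ht 0⟩) (fun x => S₁.G ⟨x, 0⟩)
    (fun x => S₁.G ⟨x, ht 1⟩)
    (fun x y n P hx hy hP => by
      rw [hy, eq_sub_of_add_eq hP]; exact Slab.one_bot (ht_pos 0) (circ_pos_all 0) n hx)
    (fun x y n P hx hy hP => by
      rw [hy, eq_sub_of_add_eq hP]; exact Slab.one_top (ht_pos 0) (circ_pos_all 0) n hx)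
    (fun x y n P hx hy hP => by
      rw [hy, eq_sub_of_add_eq hP]; exact Slab.one_bot (ht_pos 1) (circ_pos_all 1) n hx)
    (fun x y n P hx hy hP => by
      rw [hy, eq_sub_of_add_eq hP]; exact Slab.one_top (ht_pos 1) (circ_pos_all 1) n hx)
  have hcov : ∀ {i : Fin Y.1.n} {τ : ℂ} {h L a b : ℝ} (_ : ∀ k, Y.vtx ⟨i, k⟩ + τ ∈ trapezoid h L a b)
      (x : ℂ), x ∈ Y.poly i → x + τ ∈ trapezoid h L a b := by
    intro i τ h L a b hv x hx
    have hK : Convex ℝ {x : ℂ | x + τ ∈ trapezoid h L a b} := by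
      have := (convex_trapezoid h L a b).translate_preimage_left τ
      simpa [preimage] using this
    exact convexHull_min (s := range fun l => Y.vtx ⟨i, l⟩) (by rintro _ ⟨l, rfl⟩; exact hv l) hK hx
  refine ⟨Cyl.ofSlabs S hrel.1 hrel.2.1 hrel.2.2 (fun i x hx => ?_) (fun g hg => ?_),
    fun w hw => S₀.G_eq_zero (ht_pos 0) (circ_pos_all 0) one_pos (t₀ w hw),
    fun w hw => S₁.G_eq_zero (ht_pos 1) (circ_pos_all 1) one_pos (t₁ w hw)⟩
  · rcases hi' i with rfl | rfl
    · exact ⟨0, 0, one_pos, rfl, t₀ _ (hcov verts₀ x hx)⟩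
    · exact ⟨1, 0, one_pos, rfl, t₁ _ (hcov verts₁ x hx)⟩
  · classical
    let F : Fin Y.1.n → ℂ → _ := fun i x => if i = i₀ then g 0 (x + τ₀) else g 1 (x + τ₁)
    have h0 : ∀ x, F i₀ x = g 0 (x + τ₀) := fun x => if_pos rfl
    have h1 : ∀ x, F i₁ x = g 1 (x + τ₁) := fun x => if_neg hi
    refine ⟨F, fun j k _ w _ => ?_, univ g hg F h0 h1⟩
    obtain rfl | rfl := fin_two j
    · exact (h0 _).trans (by change g 0 (w - τ₀ + τ₀) = _; rw [sub_add_cancel])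
    · exact (h1 _).trans (by change g 1 (w - τ₁ + τ₁) = _; rw [sub_add_cancel])

instance (q r : ℝ) : Nonempty (fig q r).1.Pt := (fig_connected q r).toNonempty

lemma fig_mem_par {q r : ℝ} (k : Fin 4) {x : ℂ} (h : x = figVtx q r (parSide k)) :
    x ∈ (fig q r).1.poly (0 : Fin 2) := h ▸ (fig q r).1.vtx_mem (parSide k)

lemma fig_mem_hex {q r : ℝ} (k : Fin 6) {x : ℂ} (h : x = figVtx q r (hexSide k)) :
    x ∈ (fig q r).1.poly (1 : Fin 2) := h ▸ (fig q r).1.vtx_mem (hexSide k)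

lemma hseg_elim {x₀ x₁ y : ℝ} {x : ℂ} (hx : x ∈ segment ℝ (⟨x₀, y⟩ : ℂ) ⟨x₁, y⟩) (h : x₀ ≤ x₁) :
    ∃ u ∈ Icc (0 : ℝ) (x₁ - x₀), x = ⟨x₀ + u, y⟩ := by
  rw [segment_eq_image'] at hx
  obtain ⟨t, ht, rfl⟩ := hx
  refine ⟨t * (x₁ - x₀), ⟨mul_nonneg ht.1 (by linarith), by nlinarith [ht.2]⟩, ?_⟩
  apply Complex.ext <;> simp

lemma seg_mem_strip {j : Fin 2} {a b x : ℂ} (hx : x ∈ segment ℝ a b) (ha : a ∈ strip j)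
    (hb : b ∈ strip j) : x ∈ strip j := by
  obtain ⟨s, t, hs, ht, hst, rfl⟩ := hx
  have h1 : s * TranslationSurface.ht j + t * TranslationSurface.ht j = TranslationSurface.ht j := by rw [← add_mul, hst, one_mul]
  obtain ⟨a0, a1⟩ := ha
  obtain ⟨b0, b1⟩ := hb
  constructor <;> simp <;> nlinarith [mul_nonneg hs a0, mul_nonneg ht b0]

/-- A pair of sides that differ by the translation `d`, as an identification of points. -/
lemma pt_glue_add {X : Gluing} [Nonempty X.Pt] {s s' : X.1.Side} (hs : X.1.glue s = s')
    {d x a b : ℂ} (ha : X.vtx s = a) (hb : X.vtx (X.1.next s) = b)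
    (hd : X.vtx (X.1.next s') = a + d) (hx : x ∈ segment ℝ a b) :
    X.pt s.1 x = X.pt s'.1 (x + d) := by
  subst ha hb
  exact pt_glue_eq s hs hx (by rw [hd]; ring)

lemma pt_glue_hor {X : Gluing} [Nonempty X.Pt] {s s' : X.1.Side} (hs : X.1.glue s = s')
    {α β l y y' : ℝ} (ha : X.vtx s = ⟨α, y⟩) (hb : X.vtx (X.1.next s) = ⟨α + l, y⟩)
    (hd : X.vtx (X.1.next s') = ⟨β, y'⟩) {u : ℝ} (hu : u ∈ Icc 0 l) :
    X.pt s.1 ⟨α + u, y⟩ = X.pt s'.1 ⟨β + u, y'⟩ := by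
  rw [pt_glue_add hs ha hb (d := ⟨β, y'⟩ - ⟨α, y⟩) (by rw [hd]; ring)
    (mem_hseg (Or.inl ⟨by linarith [hu.1], by linarith [hu.2]⟩))]
  congr 1
  apply Complex.ext <;> simp; ring

lemma compat_add {X : Gluing} {T : Type} {F : Fin X.1.n → ℂ → T} {s s' : X.1.Side}
    (hs : X.1.glue s = s') {d a b : ℂ} (ha : X.vtx s = a) (hb : X.vtx (X.1.next s) = b)
    (hd : X.vtx (X.1.next s') = a + d) (h : ∀ x ∈ segment ℝ a b, F s.1 x = F s'.1 (x + d)) :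
    ∀ x ∈ segment ℝ (X.vtx s) (X.vtx (X.1.next s)),
      F s.1 x = F (X.1.glue s).1 (x - X.vtx s + X.vtx (X.1.next (X.1.glue s))) := by
  subst hs ha hb
  intro x hx
  rw [h x hx, hd]
  congr 1
  ring

lemma compat_hor {X : Gluing} {T : Type} {F : Fin X.1.n → ℂ → T} {s s' : X.1.Side}
    (hs : X.1.glue s = s') {α β l y y' : ℝ} (hl : 0 ≤ l) (ha : X.vtx s = ⟨α, y⟩)
    (hb : X.vtx (X.1.next s) = ⟨α + l, y⟩) (hd : X.vtx (X.1.next s') = ⟨β, y'⟩)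
    (h : ∀ u ∈ Icc 0 l, F s.1 ⟨α + u, y⟩ = F s'.1 ⟨β + u, y'⟩) :
    ∀ x ∈ segment ℝ (X.vtx s) (X.vtx (X.1.next s)),
      F s.1 x = F (X.1.glue s).1 (x - X.vtx s + X.vtx (X.1.next (X.1.glue s))) := by
  refine compat_add hs ha hb (d := ⟨β, y'⟩ - ⟨α, y⟩) (by rw [hd]; ring) fun x hx => ?_
  obtain ⟨u, hu, rfl⟩ := hseg_elim hx (by linarith)
  rw [h u (by simpa using hu)]
  congr 1
  apply Complex.ext <;> simp; ring

section

variable (q r : ℝ)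

lemma fig_vtx_par (k : Fin 4) : (fig q r).1.vtx (parSide k) =
    (![⟨-(√2 / 2), √2 / 2⟩, ⟨-(√2 / 2) + (1 + √2), √2 / 2⟩, ⟨-(√2 / 2) + r + (1 + √2), √2 / 2 + 1⟩,
      ⟨-(√2 / 2) + r, √2 / 2 + 1⟩] : Fin 4 → ℂ) k := by
  change figVtx q r (parSide k) = _
  rw [figVtx_par]
  fin_cases k <;> apply Complex.ext <;> simp [ptE]; ring

lemma fig_vtx_hex (k : Fin 6) : (fig q r).1.vtx (hexSide k) =
    (![⟨q, 0⟩, ⟨q + 1, 0⟩, ⟨q + (2 + √2), 0⟩, ⟨1 + √2 / 2 + (2 + √2), √2 / 2⟩,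
      ⟨2 + √2 / 2, √2 / 2⟩, ⟨1 + √2 / 2, √2 / 2⟩] : Fin 6 → ℂ) k := by
  change figVtx q r (hexSide k) = _
  rw [figVtx_hex]
  fin_cases k <;> apply Complex.ext <;> simp [ptB, ptC]

lemma fig_vtx_next_par (k : Fin 4) : (fig q r).1.vtx ((fig q r).1.1.next (parSide k)) =
    (![⟨-(√2 / 2), √2 / 2⟩, ⟨-(√2 / 2) + (1 + √2), √2 / 2⟩, ⟨-(√2 / 2) + r + (1 + √2), √2 / 2 + 1⟩,
      ⟨-(√2 / 2) + r, √2 / 2 + 1⟩] : Fin 4 → ℂ) (k + 1) :=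
  (congrArg _ (parSide_next k)).trans (fig_vtx_par q r (k + 1))

lemma fig_vtx_next_hex (k : Fin 6) : (fig q r).1.vtx ((fig q r).1.1.next (hexSide k)) =
    (![⟨q, 0⟩, ⟨q + 1, 0⟩, ⟨q + (2 + √2), 0⟩, ⟨1 + √2 / 2 + (2 + √2), √2 / 2⟩,
      ⟨2 + √2 / 2, √2 / 2⟩, ⟨1 + √2 / 2, √2 / 2⟩] : Fin 6 → ℂ) (k + 1) :=
  (congrArg _ (hexSide_next k)).trans (fig_vtx_hex q r (k + 1))

end

lemma add_ofReal {x y a : ℝ} : (⟨x, y⟩ : ℂ) + (a : ℂ) = ⟨x + a, y⟩ := by apply Complex.ext <;> simp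

/-- The two cylinders of `fig q r`, with the positions of the polygons. -/
def figCylAux (q r : ℝ) : {C : Cyl (fig q r).1 q r // (∀ w ∈ trapezoid 1 (1 + √2) 0 r,
    C.G 0 w = (fig q r).1.pt (0 : Fin 2) (w - -ptE)) ∧ ∀ w ∈ trapezoid (√2 / 2) (2 + √2) q
      (1 + √2 / 2), C.G 1 w = (fig q r).1.pt (1 : Fin 2) (w - 0)} := by
  have hs := sqrt_two_bounds
  have hc := circ_pos'
  have hV := fig_vtx_hex q r
  have hV' := fig_vtx_par q r
  have hN := fig_vtx_next_hex q r
  have hN' := fig_vtx_next_par q r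
  have e0 : (⟨-(√2 / 2) + r + (1 + √2), √2 / 2 + 1⟩ : ℂ) =
      ⟨-(√2 / 2) + r, √2 / 2 + 1⟩ + (1 + √2 : ℝ) := add_ofReal.symm
  have e1 : (⟨1 + √2 / 2 + (2 + √2), √2 / 2⟩ : ℂ) = ⟨1 + √2 / 2, √2 / 2⟩ + (2 + √2 : ℝ) :=
    add_ofReal.symm
  have e2 : (⟨q + 1 + (1 + √2), 0⟩ : ℂ) = ⟨q + (2 + √2), 0⟩ := by congr 1; ring
  refine Cyl.ofTwo (Y := (fig q r).1) (0 : Fin 2) (1 : Fin 2) (by decide : (1 : Fin 2) ≠ 0) fin_two 0 r q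
    (1 + √2 / 2) (-ptE) 0 ?_ ?_ ?_ ?_ ?_ ?_ ?_ ?_
  · refine ⟨⟨fig_mem_par 0 ?_, fig_mem_par 1 ?_⟩, fig_mem_par 3 ?_, fig_mem_par 2 ?_⟩ <;>
    · rw [figVtx_par]; apply Complex.ext <;> simp [ptE] <;> ring
  · refine ⟨⟨fig_mem_hex 0 ?_, fig_mem_hex 2 ?_⟩, fig_mem_hex 5 ?_, fig_mem_hex 3 ?_⟩ <;>
    · rw [figVtx_hex]; apply Complex.ext <;> simp [ptB]
  · intro w hw
    refine pt_glue_add (X := (fig q r).1) (s := parSide 3) (s' := parSide 1) rfl (hV' 3) (hN' 3)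
      ((hN' 1).trans e0) ?_
    have := (mem_segment_translate ℝ ptE).2 hw
    rw [segment_symm, sub_neg_eq_add, add_comm w]
    have f1 : ptE + ⟨0, 0⟩ = ⟨-(√2 / 2), √2 / 2⟩ := by apply Complex.ext <;> simp [ptE]
    have f2 : ptE + ⟨r, 1⟩ = ⟨-(√2 / 2) + r, √2 / 2 + 1⟩ := by apply Complex.ext <;> simp [ptE]
    rw [f1, f2] at this
    exact this
  · intro w hw
    refine pt_glue_add (X := (fig q r).1) (s := hexSide 5) (s' := hexSide 2) rfl (hV 5) (hN 5)
      ((hN 2).trans e1) ?_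
    rw [segment_symm, sub_zero]
    exact hw
  · intro (k : Fin 4)
    change (fig q r).1.vtx (parSide k) + -ptE ∈ _
    rw [hV']
    fin_cases k <;> simp [trapezoid, ptE] <;> first | linarith | (constructor <;> linarith)
  · intro (k : Fin 6)
    change (fig q r).1.vtx (hexSide k) + 0 ∈ _
    rw [hV, add_zero]
    fin_cases k <;> simp [trapezoid] <;> refine ⟨?_, ?_⟩ <;> first | positivity | linarith
  · intro B₀ U₀ B₁ U₁ hB₀ hU₀ hB₁ hU₁
    refine ⟨fun u hu => ?_, fun u hu => ?_, fun u hu => ?_⟩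
    · refine (hB₁ (q + u) _ 0 ⟨q + u, 0⟩ ⟨by linarith [hu.1], by linarith [hu.2]⟩ (by simp)
        (add_zero _)).trans (Eq.trans ?_ (hU₁ (1 + √2 / 2 + u) _ 0 ⟨1 + √2 / 2 + u, √2 / 2⟩
        ⟨by linarith [hu.1], by linarith [hu.2]⟩ (by simp) (add_zero _)).symm)
      exact pt_glue_hor (X := (fig q r).1) (s := hexSide 0) (s' := hexSide 4) rfl (hV 0) (hN 0)
        (hN 4) hu
    · refine (hB₁ (q + 1 + u) _ 0 ⟨q + 1 + u, 0⟩ ⟨by linarith [hu.1], by linarith [hu.2]⟩ (by simp)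
        (add_zero _)).trans (Eq.trans ?_ (hU₀ (r + u) _ 0 ⟨-(√2 / 2) + r + u, √2 / 2 + 1⟩
        ⟨by linarith [hu.1], by linarith [hu.2]⟩ (by simp) ?_).symm)
      · exact pt_glue_hor (X := (fig q r).1) (s := hexSide 1) (s' := parSide 2) rfl (hV 1)
          ((hN 1).trans e2.symm) (hN' 2) hu
      · apply Complex.ext <;> simp [ptE]; ring
    · refine (hU₁ (2 + √2 / 2 + u) _ 0 ⟨2 + √2 / 2 + u, √2 / 2⟩ ⟨by linarith [hu.1],
        by linarith [hu.2]⟩ (by simp) (add_zero _)).trans (Eq.trans ?_ (hB₀ u _ 0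
        ⟨-(√2 / 2) + u, √2 / 2⟩ ⟨by linarith [hu.1], by linarith [hu.2]⟩ (by simp) ?_).symm)
      · exact (pt_glue_hor (X := (fig q r).1) (s := parSide 0) (s' := hexSide 3) rfl (hV' 0)
          (hN' 0) (hN 3) hu).symm
      · apply Complex.ext <;> simp [ptE]
  · intro T g hg F h0 h1
    refine compat_of_half (X := (fig q r).1)
      [hexSide 0, hexSide 1, hexSide 5, parSide 0, parSide 3]
      (by change ∀ s : figPattern.Side, s ∈ [hexSide 0, hexSide 1, hexSide 5, parSide 0, parSide 3] ∨
            figPattern.glue s ∈ [hexSide 0, hexSide 1, hexSide 5, parSide 0, parSide 3]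
          decide) ?_
    refine List.forall_mem_cons.2 ⟨?_, List.forall_mem_cons.2 ⟨?_, List.forall_mem_cons.2 ⟨?_,
      List.forall_mem_cons.2 ⟨?_, List.forall_mem_cons.2 ⟨?_, fun _ h => absurd h List.not_mem_nil⟩⟩⟩⟩⟩
    · refine compat_hor (s' := hexSide 4) rfl zero_le_one (hV 0) (hN 0) (hN 4) fun u hu => ?_
      refine (h1 _).trans (Eq.trans ?_ (h1 _).symm)
      simpa using hg.mid u hu
    · refine compat_hor (s' := parSide 2) rfl hc.le (hV 1) ((hN 1).trans e2.symm) (hN' 2)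
        fun u hu => ?_
      refine (h1 _).trans (Eq.trans ?_ (h0 _).symm)
      convert hg.top u hu using 2 <;> apply Complex.ext <;> simp [ptE]; ring
    · refine compat_add (s' := hexSide 2) rfl (hV 5) (hN 5) ((hN 2).trans e1) fun x hx => ?_
      refine (h1 _).trans (Eq.trans ?_ (h1 _).symm)
      rw [add_zero, add_zero]
      exact (hg.per 1 x (seg_mem_strip hx (mk_ht_mem 1 _) (mk_zero_mem 1 _))).symm
    · refine compat_hor (s' := hexSide 3) rfl hc.le (hV' 0) (hN' 0) (hN 3) fun u hu => ?_
      refine (h0 _).trans (Eq.trans ?_ (h1 _).symm)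
      rw [eq_comm]
      convert hg.bot u hu using 2 <;> apply Complex.ext <;> simp [ptE]
    · refine compat_add (s' := parSide 1) rfl (hV' 3) (hN' 3) ((hN' 1).trans e0) fun x hx => ?_
      refine (h0 _).trans (Eq.trans ?_ (h0 _).symm)
      have hm := (mem_segment_translate ℝ (-ptE)).2 hx
      have := hg.per 0 (x + -ptE) (by
        rw [add_comm]
        refine seg_mem_strip hm ?_ ?_ <;> simp [strip, ptE])
      rw [← this, circ_zero, add_right_comm]

/-- The two cylinders of `fig q r`. -/
def figCyl (q r : ℝ) : Cyl (fig q r).1 q r := (figCylAux q r).1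

lemma figCyl_hex {q r : ℝ} {w : ℂ} (hw : w ∈ trapezoid (√2 / 2) (2 + √2) q (1 + √2 / 2)) :
    (figCyl q r).G 1 w = (fig q r).1.pt (1 : Fin 2) w := by
  rw [figCyl, (figCylAux q r).2.2 w hw, sub_zero]

/-! ### The two cylinders cut for the surgeries -/

/-- The side pairing of the two cylinders of `fig q r`, as polygons that have both twins of the
unit saddle connection among their sides. -/
def cutGlue (s : Σ i : Fin 2, Fin ((![6, 8] : Fin 2 → ℕ) i)) :
    Σ i : Fin 2, Fin ((![6, 8] : Fin 2 → ℕ) i) :=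
  match s with
  | ⟨0, k⟩ => (![⟨1, (5 : Fin 8)⟩, ⟨1, (4 : Fin 8)⟩, ⟨0, (5 : Fin 6)⟩, ⟨1, (2 : Fin 8)⟩,
      ⟨1, (1 : Fin 8)⟩, ⟨0, (2 : Fin 6)⟩] : Fin 6 → Σ i : Fin 2, Fin ((![6, 8] : Fin 2 → ℕ) i)) k
  | ⟨1, k⟩ => (![⟨1, (6 : Fin 8)⟩, ⟨0, (4 : Fin 6)⟩, ⟨0, (3 : Fin 6)⟩, ⟨1, (7 : Fin 8)⟩,
      ⟨0, (1 : Fin 6)⟩, ⟨0, (0 : Fin 6)⟩, ⟨1, (0 : Fin 8)⟩, ⟨1, (3 : Fin 8)⟩] :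
      Fin 8 → Σ i : Fin 2, Fin ((![6, 8] : Fin 2 → ℕ) i)) k

lemma cutGlue_cutGlue : ∀ s, cutGlue (cutGlue s) = s := by decide

/-- The pattern of two polygons with `6` and `8` sides, with a given pairing of the sides. -/
def cutPattern (glue : Equiv.Perm (Σ i : Fin 2, Fin ((![6, 8] : Fin 2 → ℕ) i)))
    (hg : ∀ s, glue (glue s) = s) : Pattern where
  n := 2
  sides := ![6, 8]
  glue := glue
  glue_glue := hg

/-- The sides of the two polygons. -/
abbrev CutSide : Type := Σ i : Fin 2, Fin ((![6, 8] : Fin 2 → ℕ) i)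

/-- The `k`-th side of the hexagon of cylinder `0`. -/
def cutPar (k : Fin 6) : CutSide := ⟨(0 : Fin 2), k⟩

/-- The `k`-th side of the octagon of cylinder `1`. -/
def cutHex (k : Fin 8) : CutSide := ⟨(1 : Fin 2), k⟩

/-- The pairing as a permutation. -/
def cutPerm : Equiv.Perm CutSide := ⟨cutGlue, cutGlue, cutGlue_cutGlue, cutGlue_cutGlue⟩

lemma cutPerm_cutPerm : ∀ s, cutPerm (cutPerm s) = s := cutGlue_cutGlue

/-- The vertices of the two polygons. The first one is the parallelogram of `fig q r`, translated to the
origin, with additional vertices at distance `1` to the right of its left vertices; the second one is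
the hexagon of `fig q r` with additional vertices at distance `1` to the right of `P` and `C`. -/
def cutVtx (q r : ℝ) (s : CutSide) : ℂ :=
  match s with
  | ⟨(0 : Fin 2), k⟩ => (![⟨0, 0⟩, ⟨1, 0⟩, ⟨1 + √2, 0⟩, ⟨r + (1 + √2), 1⟩, ⟨r + 1, 1⟩, ⟨r, 1⟩] :
      Fin 6 → ℂ) k
  | ⟨(1 : Fin 2), k⟩ => (![⟨q, 0⟩, ⟨q + 1, 0⟩, ⟨q + 1 + 1, 0⟩, ⟨q + (2 + √2), 0⟩,
      ⟨1 + √2 / 2 + (2 + √2), √2 / 2⟩, ⟨2 + √2 / 2 + 1, √2 / 2⟩, ⟨2 + √2 / 2, √2 / 2⟩,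
      ⟨1 + √2 / 2, √2 / 2⟩] : Fin 8 → ℂ) k

section

variable {glue : Equiv.Perm CutSide} {hg : ∀ s, glue (glue s) = s}

lemma cutPar_next (k : Fin 6) : (cutPattern glue hg).next (cutPar k) = cutPar (k + 1) :=
  congrArg cutPar (finRotate_apply (n := 6) k)

lemma cutHex_next (k : Fin 8) : (cutPattern glue hg).next (cutHex k) = cutHex (k + 1) :=
  congrArg cutHex (finRotate_apply (n := 8) k)

variable (q r : ℝ)

lemma cutVtx_par (k : Fin 6) : cutVtx q r (cutPar k) =
    (![⟨0, 0⟩, ⟨1, 0⟩, ⟨1 + √2, 0⟩, ⟨r + (1 + √2), 1⟩, ⟨r + 1, 1⟩, ⟨r, 1⟩] : Fin 6 → ℂ) k := rfl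

lemma cutVtx_hex (k : Fin 8) : cutVtx q r (cutHex k) =
    (![⟨q, 0⟩, ⟨q + 1, 0⟩, ⟨q + 1 + 1, 0⟩, ⟨q + (2 + √2), 0⟩,
      ⟨1 + √2 / 2 + (2 + √2), √2 / 2⟩, ⟨2 + √2 / 2 + 1, √2 / 2⟩, ⟨2 + √2 / 2, √2 / 2⟩,
      ⟨1 + √2 / 2, √2 / 2⟩] : Fin 8 → ℂ) k := rfl

lemma cut_admissible : Admissible (cutPattern cutPerm cutPerm_cutPerm) (cutVtx q r) := by
  have h0 : 0 < √2 := by positivity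
  have h2 : √2 * √2 = 2 := sqrt_two_sq
  have h1 := sqrt_two_bounds
  constructor
  · intro i
    obtain rfl | rfl := fin_two i
    · intro (k : Fin 6) (l : Fin 6) h
      change cutVtx q r (cutPar k) = cutVtx q r (cutPar l) at h
      rw [cutVtx_par, cutVtx_par] at h
      have hr := congrArg Complex.re h
      have hi := congrArg Complex.im h
      clear h
      fin_cases k <;> fin_cases l <;>
        first | rfl | (exfalso; simp at hr hi; try linarith)
    · intro (k : Fin 8) (l : Fin 8) h
      change cutVtx q r (cutHex k) = cutVtx q r (cutHex l) at h
      rw [cutVtx_hex, cutVtx_hex] at h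
      have hr := congrArg Complex.re h
      have hi := congrArg Complex.im h
      clear h
      fin_cases k <;> fin_cases l <;>
        first | rfl | (exfalso; simp at hr hi; try linarith)
  · intro i
    obtain rfl | rfl := fin_two i
    · intro (k : Fin 6) (l : Fin 6)
      change 0 ≤ cross (cutVtx q r ((cutPattern cutPerm cutPerm_cutPerm).next (cutPar k)) -
        cutVtx q r (cutPar k)) (cutVtx q r (cutPar l) - cutVtx q r (cutPar k))
      rw [cutPar_next, cutVtx_par, cutVtx_par, cutVtx_par]
      fin_cases k <;> fin_cases l <;> simp [cross] <;> nlinarith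
    · intro (k : Fin 8) (l : Fin 8)
      change 0 ≤ cross (cutVtx q r ((cutPattern cutPerm cutPerm_cutPerm).next (cutHex k)) -
        cutVtx q r (cutHex k)) (cutVtx q r (cutHex l) - cutVtx q r (cutHex k))
      rw [cutHex_next, cutVtx_hex, cutVtx_hex, cutVtx_hex]
      fin_cases k <;> fin_cases l <;> simp [cross] <;> nlinarith
  · intro i
    obtain rfl | rfl := fin_two i
    · intro (k : Fin 6)
      refine ⟨(![5, 5, 0, 0, 0, 2] : Fin 6 → Fin 6) k, ?_⟩
      change 0 < cross (cutVtx q r ((cutPattern cutPerm cutPerm_cutPerm).next (cutPar k)) -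
        cutVtx q r (cutPar k)) (cutVtx q r (cutPar _) - cutVtx q r (cutPar k))
      rw [cutPar_next, cutVtx_par, cutVtx_par, cutVtx_par]
      fin_cases k <;> simp [cross] <;> nlinarith
    · intro (k : Fin 8)
      refine ⟨(![7, 7, 7, 0, 0, 0, 0, 3] : Fin 8 → Fin 8) k, ?_⟩
      change 0 < cross (cutVtx q r ((cutPattern cutPerm cutPerm_cutPerm).next (cutHex k)) -
        cutVtx q r (cutHex k)) (cutVtx q r (cutHex _) - cutVtx q r (cutHex k))
      rw [cutHex_next, cutVtx_hex, cutVtx_hex, cutVtx_hex]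
      fin_cases k <;> simp [cross] <;> nlinarith
  · rintro ⟨i, k⟩
    obtain rfl | rfl := fin_two i
    · change Fin 6 at k
      change cutVtx q r ((cutPattern cutPerm cutPerm_cutPerm).next (cutGlue (cutPar k))) -
        cutVtx q r (cutGlue (cutPar k)) =
          -(cutVtx q r ((cutPattern cutPerm cutPerm_cutPerm).next (cutPar k)) - cutVtx q r (cutPar k))
      have : cutGlue (cutPar k) = (![cutHex 5, cutHex 4, cutPar 5, cutHex 2, cutHex 1, cutPar 2] :
        Fin 6 → CutSide) k := rfl
      rw [this, cutPar_next]
      fin_cases k <;> apply Complex.ext <;>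
        simp [cutPar_next, cutHex_next, cutVtx_par, cutVtx_hex] <;> ring
    · change Fin 8 at k
      change cutVtx q r ((cutPattern cutPerm cutPerm_cutPerm).next (cutGlue (cutHex k))) -
        cutVtx q r (cutGlue (cutHex k)) =
          -(cutVtx q r ((cutPattern cutPerm cutPerm_cutPerm).next (cutHex k)) - cutVtx q r (cutHex k))
      have : cutGlue (cutHex k) = (![cutHex 6, cutPar 4, cutPar 3, cutHex 7, cutPar 1, cutPar 0,
        cutHex 0, cutHex 3] : Fin 8 → CutSide) k := rfl
      rw [this, cutHex_next]
      fin_cases k <;> apply Complex.ext <;>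
        simp [cutPar_next, cutHex_next, cutVtx_par, cutVtx_hex] <;> ring

end

/-- The two polygons with a given pairing of their sides. -/
def cutGluing (q r : ℝ) (glue : Equiv.Perm CutSide) (hg : ∀ s, glue (glue s) = s)
    (hV : Admissible (cutPattern glue hg) (cutVtx q r)) : Gluing := ⟨cutPattern glue hg, cutVtx q r, hV⟩

section

variable {q r : ℝ} {glue : Equiv.Perm CutSide} {hg : ∀ s, glue (glue s) = s}
  {hV : Admissible (cutPattern glue hg) (cutVtx q r)}

instance : Nonempty (cutGluing q r glue hg hV).Pt := ⟨start _ (cutPar 0)⟩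

lemma cut_vtx_par (k : Fin 6) : (cutGluing q r glue hg hV).vtx (cutPar k) =
    (![⟨0, 0⟩, ⟨1, 0⟩, ⟨1 + √2, 0⟩, ⟨r + (1 + √2), 1⟩, ⟨r + 1, 1⟩, ⟨r, 1⟩] : Fin 6 → ℂ) k := rfl

lemma cut_vtx_hex (k : Fin 8) : (cutGluing q r glue hg hV).vtx (cutHex k) =
    (![⟨q, 0⟩, ⟨q + 1, 0⟩, ⟨q + 1 + 1, 0⟩, ⟨q + (2 + √2), 0⟩,
      ⟨1 + √2 / 2 + (2 + √2), √2 / 2⟩, ⟨2 + √2 / 2 + 1, √2 / 2⟩, ⟨2 + √2 / 2, √2 / 2⟩,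
      ⟨1 + √2 / 2, √2 / 2⟩] : Fin 8 → ℂ) k := rfl

lemma cut_vtx_next_par (k : Fin 6) :
    (cutGluing q r glue hg hV).vtx ((cutGluing q r glue hg hV).1.next (cutPar k)) =
    (![⟨0, 0⟩, ⟨1, 0⟩, ⟨1 + √2, 0⟩, ⟨r + (1 + √2), 1⟩, ⟨r + 1, 1⟩, ⟨r, 1⟩] : Fin 6 → ℂ) (k + 1) :=
  congrArg _ (cutPar_next k)

lemma cut_vtx_next_hex (k : Fin 8) :
    (cutGluing q r glue hg hV).vtx ((cutGluing q r glue hg hV).1.next (cutHex k)) =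
    (![⟨q, 0⟩, ⟨q + 1, 0⟩, ⟨q + 1 + 1, 0⟩, ⟨q + (2 + √2), 0⟩,
      ⟨1 + √2 / 2 + (2 + √2), √2 / 2⟩, ⟨2 + √2 / 2 + 1, √2 / 2⟩, ⟨2 + √2 / 2, √2 / 2⟩,
      ⟨1 + √2 / 2, √2 / 2⟩] : Fin 8 → ℂ) (k + 1) :=
  congrArg _ (cutHex_next k)

lemma cut_mem_par (k : Fin 6) {x : ℂ} (h : x = cutVtx q r (cutPar k)) :
    x ∈ (cutGluing q r glue hg hV).poly (0 : Fin 2) :=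
  h ▸ (cutGluing q r glue hg hV).vtx_mem (cutPar k)

lemma cut_mem_hex (k : Fin 8) {x : ℂ} (h : x = cutVtx q r (cutHex k)) :
    x ∈ (cutGluing q r glue hg hV).poly (1 : Fin 2) :=
  h ▸ (cutGluing q r glue hg hV).vtx_mem (cutHex k)

/-- The two cylinders of the surface obtained from the two polygons by a pairing of their sides that
makes cylinders of the polygons. The strips are translated by `σ`. -/
def cutCyl {q' r' : ℝ} (σ : ℝ) (h₀ : glue (cutPar 5) = cutPar 2) (h₁ : glue (cutHex 7) = cutHex 3)
    (rel : ∀ B₀ U₀ B₁ U₁ : ℝ → (cutGluing q r glue hg hV).Pt,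
      (∀ x y (n : ℤ), x ∈ Icc 0 (1 + √2) → y = x + σ + n * (1 + √2) →
        B₀ y = (cutGluing q r glue hg hV).pt (0 : Fin 2) ⟨x, 0⟩) →
      (∀ x y (n : ℤ), x ∈ Icc r (r + (1 + √2)) → y = x + σ + n * (1 + √2) →
        U₀ y = (cutGluing q r glue hg hV).pt (0 : Fin 2) ⟨x, 1⟩) →
      (∀ x y (n : ℤ), x ∈ Icc q (q + (2 + √2)) → y = x + σ + n * (2 + √2) →
        B₁ y = (cutGluing q r glue hg hV).pt (1 : Fin 2) ⟨x, 0⟩) →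
      (∀ x y (n : ℤ), x ∈ Icc (1 + √2 / 2) (1 + √2 / 2 + (2 + √2)) → y = x + σ + n * (2 + √2) →
        U₁ y = (cutGluing q r glue hg hV).pt (1 : Fin 2) ⟨x, √2 / 2⟩) →
      (∀ u ∈ Icc (0 : ℝ) 1, B₁ (q' + u) = U₁ (1 + √2 / 2 + u)) ∧
      (∀ u ∈ Icc (0 : ℝ) (1 + √2), B₁ (q' + 1 + u) = U₀ (r' + u)) ∧
      (∀ u ∈ Icc (0 : ℝ) (1 + √2), U₁ (2 + √2 / 2 + u) = B₀ u))
    (l : List CutSide)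
    (hl : ∀ s, s ∈ cutPar 5 :: cutHex 7 :: l ∨ glue s ∈ cutPar 5 :: cutHex 7 :: l)
    (univ : ∀ {T : Type} (g : Fin 2 → ℂ → T), Respects q' r' g → ∀ F : Fin 2 → ℂ → T,
      (∀ x y, F 0 ⟨x, y⟩ = g 0 ⟨x + σ, y⟩) → (∀ x y, F 1 ⟨x, y⟩ = g 1 ⟨x + σ, y⟩) →
      ∀ s ∈ l, ∀ x ∈ segment ℝ ((cutGluing q r glue hg hV).vtx s)
          ((cutGluing q r glue hg hV).vtx ((cutGluing q r glue hg hV).1.next s)),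
        F s.1 x = F (glue s).1 (x - (cutGluing q r glue hg hV).vtx s +
          (cutGluing q r glue hg hV).vtx ((cutGluing q r glue hg hV).1.next (glue s)))) :
    {C : Cyl (cutGluing q r glue hg hV) q' r' // (∀ w ∈ trapezoid 1 (1 + √2) (0 + σ) (r + σ),
      C.G 0 w = (cutGluing q r glue hg hV).pt (0 : Fin 2) (w - σ)) ∧
      ∀ w ∈ trapezoid (√2 / 2) (2 + √2) (q + σ) (1 + √2 / 2 + σ),
        C.G 1 w = (cutGluing q r glue hg hV).pt (1 : Fin 2) (w - σ)} := by
  have hs := sqrt_two_bounds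
  have hc := circ_pos'
  have V := cut_vtx_hex (q := q) (r := r) (glue := glue) (hg := hg) (hV := hV)
  have V' := cut_vtx_par (q := q) (r := r) (glue := glue) (hg := hg) (hV := hV)
  have N := cut_vtx_next_hex (q := q) (r := r) (glue := glue) (hg := hg) (hV := hV)
  have N' := cut_vtx_next_par (q := q) (r := r) (glue := glue) (hg := hg) (hV := hV)
  have e0 : (⟨r + (1 + √2), 1⟩ : ℂ) = ⟨r, 1⟩ + (1 + √2 : ℝ) := add_ofReal.symm
  have e1 : (⟨1 + √2 / 2 + (2 + √2), √2 / 2⟩ : ℂ) = ⟨1 + √2 / 2, √2 / 2⟩ + (2 + √2 : ℝ) :=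
    add_ofReal.symm
  have es : ∀ {x y : ℝ}, (⟨x, y⟩ : ℂ) + σ = ⟨x + σ, y⟩ := add_ofReal
  have es' : ∀ {x y : ℝ}, (⟨x + σ, y⟩ : ℂ) - σ = ⟨x, y⟩ := by
    intro x y; apply Complex.ext <;> simp
  refine Cyl.ofTwo (Y := cutGluing q r glue hg hV) (0 : Fin 2) (1 : Fin 2)
    (by decide : (1 : Fin 2) ≠ 0) fin_two (0 + σ) (r + σ) (q + σ) (1 + √2 / 2 + σ) σ σ
    ?_ ?_ ?_ ?_ ?_ ?_ ?_ ?_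
  · rw [add_right_comm, add_right_comm r, es', es', es', es']
    exact ⟨⟨cut_mem_par 0 rfl, cut_mem_par 2 (by rw [cutVtx_par, zero_add]; rfl)⟩,
      cut_mem_par 5 rfl, cut_mem_par 3 rfl⟩
  · rw [add_right_comm q, add_right_comm (1 + √2 / 2), es', es', es', es']
    exact ⟨⟨cut_mem_hex 0 rfl, cut_mem_hex 3 rfl⟩, cut_mem_hex 7 rfl, cut_mem_hex 4 rfl⟩
  · intro w hw
    refine pt_glue_add (X := cutGluing q r glue hg hV) (s := cutPar 5) (s' := cutPar 2) h₀ (V' 5)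
      (N' 5) ((N' 2).trans e0) ?_
    have := (mem_segment_translate ℝ (-σ : ℂ)).2 hw
    rw [← sub_eq_neg_add, ← sub_eq_neg_add, ← sub_eq_neg_add, es', es', segment_symm] at this
    exact this
  · intro w hw
    refine pt_glue_add (X := cutGluing q r glue hg hV) (s := cutHex 7) (s' := cutHex 3) h₁ (V 7)
      (N 7) ((N 3).trans e1) ?_
    have := (mem_segment_translate ℝ (-σ : ℂ)).2 hw
    rw [← sub_eq_neg_add, ← sub_eq_neg_add, ← sub_eq_neg_add, es', es', segment_symm] at this
    exact this
  · intro (k : Fin 6)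
    change (cutGluing q r glue hg hV).vtx (cutPar k) + σ ∈ _
    rw [V']
    fin_cases k <;> simp [trapezoid] <;> first | linarith | (constructor <;> linarith)
  · intro (k : Fin 8)
    change (cutGluing q r glue hg hV).vtx (cutHex k) + σ ∈ _
    rw [V]
    fin_cases k <;> simp [trapezoid] <;> refine ⟨?_, ?_⟩ <;>
      first | positivity | linarith | (constructor <;> linarith)
  · intro B₀ U₀ B₁ U₁ hB₀ hU₀ hB₁ hU₁
    exact rel B₀ U₀ B₁ U₁
      (fun x y n hx hy => hB₀ (x + σ) y n _ ⟨by linarith [hx.1], by linarith [hx.2]⟩ hy es)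
      (fun x y n hx hy => hU₀ (x + σ) y n _ ⟨by linarith [hx.1], by linarith [hx.2]⟩ hy es)
      (fun x y n hx hy => hB₁ (x + σ) y n _ ⟨by linarith [hx.1], by linarith [hx.2]⟩ hy es)
      (fun x y n hx hy => hU₁ (x + σ) y n _ ⟨by linarith [hx.1], by linarith [hx.2]⟩ hy es)
  · intro T g hg F h0 h1
    refine compat_of_half (X := cutGluing q r glue _ hV) (cutPar 5 :: cutHex 7 :: l) hl ?_
    refine List.forall_mem_cons.2 ⟨?_, List.forall_mem_cons.2 ⟨?_, univ g hg F
      (fun x y => (h0 _).trans (by rw [es])) (fun x y => (h1 _).trans (by rw [es]))⟩⟩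
    · refine compat_add (s' := cutPar 2) h₀ (V' 5) (N' 5) ((N' 2).trans e0) fun x hx => ?_
      refine (h0 _).trans (Eq.trans ?_ (h0 _).symm)
      have hm := seg_mem_strip (j := 0) hx (mk_ht_mem 0 _) (mk_zero_mem 0 _)
      rw [← hg.per 0 _ (strip_add_real hm σ), circ_zero, add_right_comm]
    · refine compat_add (s' := cutHex 3) h₁ (V 7) (N 7) ((N 3).trans e1) fun x hx => ?_
      refine (h1 _).trans (Eq.trans ?_ (h1 _).symm)
      have hm := seg_mem_strip (j := 1) hx (mk_ht_mem 1 _) (mk_zero_mem 1 _)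
      rw [← hg.per 1 _ (strip_add_real hm σ), circ_one, add_right_comm]

end

lemma Respects.mid_mod {T : Type} {q r : ℝ} {g : Fin 2 → ℂ → T} (h : Respects q r g) (u : ℝ)
    (k k' : ℤ) {x x' : ℝ} (h0 : 0 ≤ u) (h1 : u ≤ 1) (hx : x = q + u + k * (2 + √2))
    (hx' : x' = 1 + √2 / 2 + u + k' * (2 + √2)) : g 1 ⟨x, 0⟩ = g 1 ⟨x', √2 / 2⟩ := by
  rw [hx, hx', ← circ_one, h.per_mk 1 (mk_zero_mem 1 _), h.mid u ⟨h0, h1⟩, ← ht_one,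
    h.per_mk 1 (mk_ht_mem 1 _)]

lemma Respects.top_mod {T : Type} {q r : ℝ} {g : Fin 2 → ℂ → T} (h : Respects q r g) (u : ℝ)
    (k k' : ℤ) {x x' : ℝ} (h0 : 0 ≤ u) (h1 : u ≤ 1 + √2) (hx : x = q + 1 + u + k * (2 + √2))
    (hx' : x' = r + u + k' * (1 + √2)) : g 1 ⟨x, 0⟩ = g 0 ⟨x', 1⟩ := by
  rw [hx, hx', ← circ_one, h.per_mk 1 (mk_zero_mem 1 _), h.top u ⟨h0, h1⟩, ← circ_zero]
  nth_rw 2 [← ht_zero]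
  rw [h.per_mk 0 (mk_ht_mem 0 _), ht_zero]

lemma Respects.bot_mod {T : Type} {q r : ℝ} {g : Fin 2 → ℂ → T} (h : Respects q r g) (u : ℝ)
    (k k' : ℤ) {x x' : ℝ} (h0 : 0 ≤ u) (h1 : u ≤ 1 + √2) (hx : x = 2 + √2 / 2 + u + k * (2 + √2))
    (hx' : x' = u + k' * (1 + √2)) : g 1 ⟨x, √2 / 2⟩ = g 0 ⟨x', 0⟩ := by
  rw [hx, hx', ← circ_zero, ← circ_one, h.per_mk 0 (mk_zero_mem 0 _), ← h.bot u ⟨h0, h1⟩, ← ht_one,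
    h.per_mk 1 (mk_ht_mem 1 _)]

/-- The surface `fig q r`, cut for the surgeries. -/
def cutFig (q r : ℝ) : Gluing := cutGluing q r cutPerm cutPerm_cutPerm (cut_admissible q r)

section

variable {q r : ℝ} {glue : Equiv.Perm CutSide} {hg : ∀ s, glue (glue s) = s}
  {hV : Admissible (cutPattern glue hg) (cutVtx q r)}

lemma cut_hor (s s' : CutSide) (hs : glue s = s') {α α' β y y' : ℝ}
    (ha : (cutGluing q r glue hg hV).vtx s = ⟨α, y⟩)
    (hb : (cutGluing q r glue hg hV).vtx ((cutGluing q r glue hg hV).1.next s) = ⟨α', y⟩)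
    (hd : (cutGluing q r glue hg hV).vtx ((cutGluing q r glue hg hV).1.next s') = ⟨β, y'⟩)
    {x x' : ℝ} (h : α ≤ x) (h' : x ≤ α') (e : x' = β + (x - α)) :
    (cutGluing q r glue hg hV).pt s.1 ⟨x, y⟩ = (cutGluing q r glue hg hV).pt s'.1 ⟨x', y'⟩ := by
  have := pt_glue_hor (X := cutGluing q r glue hg hV) hs ha (l := α' - α)
    (by rw [hb, add_sub_cancel]) hd (u := x - α) ⟨by linarith, by linarith⟩
  rw [add_sub_cancel] at this
  rw [e]
  exact this

lemma cut_compat {T : Type} {F : Fin 2 → ℂ → T} (s s' : CutSide) (hs : glue s = s')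
    {α α' β y y' : ℝ} (hα : α ≤ α') (ha : (cutGluing q r glue hg hV).vtx s = ⟨α, y⟩)
    (hb : (cutGluing q r glue hg hV).vtx ((cutGluing q r glue hg hV).1.next s) = ⟨α', y⟩)
    (hd : (cutGluing q r glue hg hV).vtx ((cutGluing q r glue hg hV).1.next s') = ⟨β, y'⟩)
    (h : ∀ u, 0 ≤ u → u ≤ α' - α → F s.1 ⟨α + u, y⟩ = F s'.1 ⟨β + u, y'⟩) :
    ∀ x ∈ segment ℝ ((cutGluing q r glue hg hV).vtx s)
        ((cutGluing q r glue hg hV).vtx ((cutGluing q r glue hg hV).1.next s)),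
      F s.1 x = F (glue s).1 (x - (cutGluing q r glue hg hV).vtx s +
        (cutGluing q r glue hg hV).vtx ((cutGluing q r glue hg hV).1.next (glue s))) :=
  compat_hor (X := cutGluing q r glue hg hV) hs (sub_nonneg.2 hα) ha (by rw [hb, add_sub_cancel]) hd
    fun u hu => h u hu.1 hu.2

end

/-- The two cylinders of `cutFig q r`, with the positions of the polygons. -/
def cutFigCylAux (q r : ℝ) :
    {C : Cyl (cutGluing q r cutPerm cutPerm_cutPerm (cut_admissible q r)) q r //
      (∀ w ∈ trapezoid 1 (1 + √2) (0 + 0) (r + 0), C.G 0 w =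
        (cutGluing q r cutPerm cutPerm_cutPerm (cut_admissible q r)).pt (0 : Fin 2) (w - (0 : ℝ))) ∧
      ∀ w ∈ trapezoid (√2 / 2) (2 + √2) (q + 0) (1 + √2 / 2 + 0), C.G 1 w =
        (cutGluing q r cutPerm cutPerm_cutPerm (cut_admissible q r)).pt (1 : Fin 2) (w - (0 : ℝ))} := by
  have hs := sqrt_two_bounds
  have V := cut_vtx_hex (q := q) (r := r) (glue := cutPerm) (hV := cut_admissible q r)
  have V' := cut_vtx_par (q := q) (r := r) (glue := cutPerm) (hV := cut_admissible q r)
  have N := cut_vtx_next_hex (q := q) (r := r) (glue := cutPerm) (hV := cut_admissible q r)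
  have N' := cut_vtx_next_par (q := q) (r := r) (glue := cutPerm) (hV := cut_admissible q r)
  refine cutCyl 0 rfl rfl ?_ [cutHex 0, cutHex 1, cutHex 2, cutPar 0, cutPar 1] (by decide) ?_
  · intro B₀ U₀ B₁ U₁ hB₀ hU₀ hB₁ hU₁
    refine ⟨fun u ⟨h0, h1⟩ => ?_, fun u ⟨h0, h1⟩ => ?_, fun u ⟨h0, h1⟩ => ?_⟩
    · rw [hB₁ (q + u) _ 0 ⟨by linarith, by linarith⟩ (by simp),
        hU₁ (1 + √2 / 2 + u) _ 0 ⟨by linarith, by linarith⟩ (by simp)]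
      exact cut_hor (cutHex 0) (cutHex 6) rfl (V 0) (N 0) (N 6) (by linarith)
        (by linarith) (by ring)
    · rw [hB₁ (q + 1 + u) _ 0 ⟨by linarith, by linarith⟩ (by simp),
        hU₀ (r + u) _ 0 ⟨by linarith, by linarith⟩ (by simp)]
      rcases le_total u 1 with h | h
      · exact cut_hor (cutHex 1) (cutPar 4) rfl (V 1) (N 1) (N' 4) (by linarith)
          (by linarith) (by ring)
      · exact cut_hor (cutHex 2) (cutPar 3) rfl (V 2) (N 2) (N' 3) (by linarith)
          (by linarith) (by ring)
    · rw [hU₁ (2 + √2 / 2 + u) _ 0 ⟨by linarith, by linarith⟩ (by simp),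
        hB₀ u _ 0 ⟨by linarith, by linarith⟩ (by simp)]
      rcases le_total u 1 with h | h
      · exact (cut_hor (cutPar 0) (cutHex 5) rfl (V' 0) (N' 0) (N 5) (by linarith)
          (by linarith) (by ring)).symm
      · exact (cut_hor (cutPar 1) (cutHex 4) rfl (V' 1) (N' 1) (N 4) (by linarith)
          (by linarith) (by ring)).symm
  · intro T g hG F h0 h1
    refine List.forall_mem_cons.2 ⟨?_, List.forall_mem_cons.2 ⟨?_, List.forall_mem_cons.2 ⟨?_,
      List.forall_mem_cons.2 ⟨?_, List.forall_mem_cons.2 ⟨?_, fun _ h => absurd h List.not_mem_nil⟩⟩⟩⟩⟩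
    · refine cut_compat (cutHex 0) (cutHex 6) rfl (by linarith) (V 0) (N 0) (N 6)
        fun u h h' => ?_
      refine (h1 _ _).trans (Eq.trans ?_ (h1 _ _).symm)
      exact hG.mid_mod u 0 0 (by linarith) (by linarith)
        (by push_cast; ring) (by push_cast; ring)
    · refine cut_compat (cutHex 1) (cutPar 4) rfl (by linarith) (V 1) (N 1) (N' 4)
        fun u h h' => ?_
      refine (h1 _ _).trans (Eq.trans ?_ (h0 _ _).symm)
      exact hG.top_mod u 0 0 (by linarith) (by linarith)
        (by push_cast; ring) (by push_cast; ring)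
    · refine cut_compat (cutHex 2) (cutPar 3) rfl (by linarith) (V 2) (N 2) (N' 3)
        fun u h h' => ?_
      refine (h1 _ _).trans (Eq.trans ?_ (h0 _ _).symm)
      exact hG.top_mod (1 + u) 0 0 (by linarith) (by linarith)
        (by push_cast; ring) (by push_cast; ring)
    · refine cut_compat (cutPar 0) (cutHex 5) rfl (by linarith) (V' 0) (N' 0) (N 5)
        fun u h h' => ?_
      refine (h0 _ _).trans (Eq.trans ?_ (h1 _ _).symm)
      exact (hG.bot_mod u 0 0 (by linarith) (by linarith)
        (by push_cast; ring) (by push_cast; ring)).symm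
    · refine cut_compat (cutPar 1) (cutHex 4) rfl (by linarith) (V' 1) (N' 1) (N 4)
        fun u h h' => ?_
      refine (h0 _ _).trans (Eq.trans ?_ (h1 _ _).symm)
      exact (hG.bot_mod (1 + u) 0 0 (by linarith) (by linarith)
        (by push_cast; ring) (by push_cast; ring)).symm

/-- The two cylinders of `cutFig q r`. -/
def cutFigCyl (q r : ℝ) : Cyl (cutFig q r) q r := (cutFigCylAux q r).1

lemma cutFig_vec_hex₀ (q r : ℝ) : (cutFig q r).vec (cutHex 0) = 1 :=
  (congrArg₂ _ (cut_vtx_next_hex 0) (cut_vtx_hex 0)).trans (by apply Complex.ext <;> simp)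

lemma cutFig_vec_hex₁ (q r : ℝ) : (cutFig q r).vec (cutHex 1) = 1 :=
  (congrArg₂ _ (cut_vtx_next_hex 1) (cut_vtx_hex 1)).trans (by apply Complex.ext <;> simp)

lemma cutFig_vec_par₀ (q r : ℝ) : (cutFig q r).vec (cutPar 0) = 1 :=
  (congrArg₂ _ (cut_vtx_next_par 0) (cut_vtx_par 0)).trans (by apply Complex.ext <;> simp)

section

variable {q r : ℝ} {glue : Equiv.Perm CutSide} {hg : ∀ s, glue (glue s) = s}
  {hV : Admissible (cutPattern glue hg) (cutVtx q r)}

/-- Regluing the cut surface as in the left surgery gives two cylinders with parameters `q + 1` and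
`r + 1`: the upper side `BC` is now glued to the left twin, the side that follows the unit saddle
connection on the lower boundary of strip `1`. -/
def leftCylAux
    (g0 : glue (cutHex 0) = cutPar 4)
    (g1 : glue (cutHex 1) = cutHex 6)
    (g2 : glue (cutHex 2) = cutPar 3)
    (g3 : glue (cutPar 0) = cutHex 5)
    (g4 : glue (cutPar 1) = cutHex 4)
    (h₀ : glue (cutPar 5) = cutPar 2) (h₁ : glue (cutHex 7) = cutHex 3)
    (hl : ∀ s, s ∈ [cutPar 5, cutHex 7, cutHex 0, cutHex 1, cutHex 2, cutPar 0, cutPar 1] ∨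
      glue s ∈ [cutPar 5, cutHex 7, cutHex 0, cutHex 1, cutHex 2, cutPar 0, cutPar 1]) :
    Cyl (cutGluing q r glue hg hV) (q + 1) (r + 1) := by
  have hs := sqrt_two_bounds
  have V := cut_vtx_hex (q := q) (r := r) (glue := glue) (hV := hV)
  have V' := cut_vtx_par (q := q) (r := r) (glue := glue) (hV := hV)
  have N := cut_vtx_next_hex (q := q) (r := r) (glue := glue) (hV := hV)
  have N' := cut_vtx_next_par (q := q) (r := r) (glue := glue) (hV := hV)
  refine (cutCyl 0 h₀ h₁ ?_
    [cutHex 0, cutHex 1, cutHex 2, cutPar 0, cutPar 1] hl ?_).1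
  · intro B₀ U₀ B₁ U₁ hB₀ hU₀ hB₁ hU₁
    refine ⟨fun u ⟨h0, h1⟩ => ?_, fun u ⟨h0, h1⟩ => ?_, fun u ⟨h0, h1⟩ => ?_⟩
    · rw [hB₁ (q + 1 + u) _ 0 ⟨by linarith, by linarith⟩ (by simp),
        hU₁ (1 + √2 / 2 + u) _ 0 ⟨by linarith, by linarith⟩ (by simp)]
      exact cut_hor (cutHex 1) (cutHex 6) g1 (V 1) (N 1) (N 6) (by linarith)
        (by linarith) (by ring)
    · rcases le_total u √2 with h | h
      · rw [hB₁ (q + 1 + 1 + u) _ 0 ⟨by linarith, by linarith⟩ (by simp),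
          hU₀ (r + 1 + u) _ 0 ⟨by linarith, by linarith⟩ (by simp)]
        exact cut_hor (cutHex 2) (cutPar 3) g2 (V 2) (N 2) (N' 3) (by linarith)
          (by linarith) (by ring)
      · -- this part of the circle lies beyond the right end of the polygons
        rw [hB₁ (q + (u - √2)) _ 1 ⟨by linarith, by linarith⟩ (by push_cast; ring),
          hU₀ (r + (u - √2)) _ 1 ⟨by linarith, by linarith⟩ (by push_cast; ring)]
        exact cut_hor (cutHex 0) (cutPar 4) g0 (V 0) (N 0) (N' 4) (by linarith)
          (by linarith) (by ring)
    · rw [hU₁ (2 + √2 / 2 + u) _ 0 ⟨by linarith, by linarith⟩ (by simp),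
        hB₀ u _ 0 ⟨by linarith, by linarith⟩ (by simp)]
      rcases le_total u 1 with h | h
      · exact (cut_hor (cutPar 0) (cutHex 5) g3 (V' 0) (N' 0) (N 5) (by linarith)
          (by linarith) (by ring)).symm
      · exact (cut_hor (cutPar 1) (cutHex 4) g4 (V' 1) (N' 1) (N 4) (by linarith)
          (by linarith) (by ring)).symm
  · intro T g hG F h0 h1
    refine List.forall_mem_cons.2 ⟨?_, List.forall_mem_cons.2 ⟨?_, List.forall_mem_cons.2 ⟨?_,
      List.forall_mem_cons.2 ⟨?_, List.forall_mem_cons.2 ⟨?_, fun _ h => absurd h List.not_mem_nil⟩⟩⟩⟩⟩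
    · refine cut_compat (cutHex 0) (cutPar 4) g0 (by linarith) (V 0) (N 0) (N' 4)
        fun u h h' => ?_
      refine (h1 _ _).trans (Eq.trans ?_ (h0 _ _).symm)
      exact hG.top_mod (u + √2) (-1) (-1) (by linarith) (by linarith)
        (by push_cast; ring) (by push_cast; ring)
    · refine cut_compat (cutHex 1) (cutHex 6) g1 (by linarith) (V 1) (N 1) (N 6)
        fun u h h' => ?_
      refine (h1 _ _).trans (Eq.trans ?_ (h1 _ _).symm)
      exact hG.mid_mod u 0 0 (by linarith) (by linarith)
        (by push_cast; ring) (by push_cast; ring)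
    · refine cut_compat (cutHex 2) (cutPar 3) g2 (by linarith) (V 2) (N 2) (N' 3)
        fun u h h' => ?_
      refine (h1 _ _).trans (Eq.trans ?_ (h0 _ _).symm)
      exact hG.top_mod u 0 0 (by linarith) (by linarith)
        (by push_cast; ring) (by push_cast; ring)
    · refine cut_compat (cutPar 0) (cutHex 5) g3 (by linarith) (V' 0) (N' 0) (N 5)
        fun u h h' => ?_
      refine (h0 _ _).trans (Eq.trans ?_ (h1 _ _).symm)
      exact (hG.bot_mod u 0 0 (by linarith) (by linarith)
        (by push_cast; ring) (by push_cast; ring)).symm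
    · refine cut_compat (cutPar 1) (cutHex 4) g4 (by linarith) (V' 1) (N' 1) (N 4)
        fun u h h' => ?_
      refine (h0 _ _).trans (Eq.trans ?_ (h1 _ _).symm)
      exact (hG.bot_mod (1 + u) 0 0 (by linarith) (by linarith)
        (by push_cast; ring) (by push_cast; ring)).symm

end

/-- The left surgery moves `P` and `P'` by `1` to the right. -/
def leftCyl (q r : ℝ) : Cyl ((cutFig q r).reglue (cutHex 0) (cutHex 1)
    ((cutFig_vec_hex₀ q r).trans (cutFig_vec_hex₁ q r).symm)) (q + 1) (r + 1) :=
  leftCylAux (q := q) (r := r) (glue := Equiv.swap (cutHex 0) (cutHex 1) * cutPerm *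
    Equiv.swap (cutHex 0) (cutHex 1)) (hg := Pattern.glue_glue (Gluing.reglue (cutFig q r) (cutHex 0)
    (cutHex 1) ((cutFig_vec_hex₀ q r).trans (cutFig_vec_hex₁ q r).symm)).1)
    (hV := ((cutFig q r).reglue (cutHex 0) (cutHex 1) ((cutFig_vec_hex₀ q r).trans
    (cutFig_vec_hex₁ q r).symm)).2.2)
    (by decide) (by decide) (by decide) (by decide) (by decide) (by decide) (by decide)
    (by decide)

section

variable {q r : ℝ} {glue : Equiv.Perm CutSide} {hg : ∀ s, glue (glue s) = s}
  {hV : Admissible (cutPattern glue hg) (cutVtx q r)}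

/-- Regluing the cut surface as in the right surgery gives two cylinders with parameters `q - 1` and
`r - 1`: the unit saddle connection and the right twin, which lies on the lower boundary of strip `0`,
exchange their partners. -/
def rightCylAux
    (g0 : glue (cutHex 0) = cutHex 5)
    (g1 : glue (cutHex 1) = cutPar 4)
    (g2 : glue (cutHex 2) = cutPar 3)
    (g3 : glue (cutPar 0) = cutHex 6)
    (g4 : glue (cutPar 1) = cutHex 4)
    (h₀ : glue (cutPar 5) = cutPar 2) (h₁ : glue (cutHex 7) = cutHex 3)
    (hl : ∀ s, s ∈ [cutPar 5, cutHex 7, cutHex 0, cutHex 1, cutHex 2, cutPar 0, cutPar 1] ∨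
      glue s ∈ [cutPar 5, cutHex 7, cutHex 0, cutHex 1, cutHex 2, cutPar 0, cutPar 1]) :
    Cyl (cutGluing q r glue hg hV) (q - 1) (r - 1) := by
  have hs := sqrt_two_bounds
  have V := cut_vtx_hex (q := q) (r := r) (glue := glue) (hV := hV)
  have V' := cut_vtx_par (q := q) (r := r) (glue := glue) (hV := hV)
  have N := cut_vtx_next_hex (q := q) (r := r) (glue := glue) (hV := hV)
  have N' := cut_vtx_next_par (q := q) (r := r) (glue := glue) (hV := hV)
  refine (cutCyl (-1) h₀ h₁ ?_
    [cutHex 0, cutHex 1, cutHex 2, cutPar 0, cutPar 1] hl ?_).1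
  · intro B₀ U₀ B₁ U₁ hB₀ hU₀ hB₁ hU₁
    refine ⟨fun u ⟨h0, h1⟩ => ?_, fun u ⟨h0, h1⟩ => ?_, fun u ⟨h0, h1⟩ => ?_⟩
    · rw [hB₁ (q + u) _ 0 ⟨by linarith, by linarith⟩ (by push_cast; ring),
        hU₁ (2 + √2 / 2 + u) _ 0 ⟨by linarith, by linarith⟩ (by push_cast; ring)]
      exact cut_hor (cutHex 0) (cutHex 5) g0 (V 0) (N 0) (N 5) (by linarith)
        (by linarith) (by ring)
    · rw [hB₁ (q + 1 + u) _ 0 ⟨by linarith, by linarith⟩ (by push_cast; ring),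
        hU₀ (r + u) _ 0 ⟨by linarith, by linarith⟩ (by push_cast; ring)]
      rcases le_total u 1 with h | h
      · exact cut_hor (cutHex 1) (cutPar 4) g1 (V 1) (N 1) (N' 4) (by linarith)
          (by linarith) (by ring)
      · exact cut_hor (cutHex 2) (cutPar 3) g2 (V 2) (N 2) (N' 3) (by linarith)
          (by linarith) (by ring)
    · rcases le_total u √2 with h | h
      · rw [hU₁ (2 + √2 / 2 + 1 + u) _ 0 ⟨by linarith, by linarith⟩ (by push_cast; ring),
          hB₀ (1 + u) _ 0 ⟨by linarith, by linarith⟩ (by push_cast; ring)]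
        exact (cut_hor (cutPar 1) (cutHex 4) g4 (V' 1) (N' 1) (N 4) (by linarith)
          (by linarith) (by ring)).symm
      · -- this part of the circle lies beyond the right end of the polygons
        rw [hU₁ (1 + √2 / 2 + (u - √2)) _ 1 ⟨by linarith, by linarith⟩ (by push_cast; ring),
          hB₀ (u - √2) _ 1 ⟨by linarith, by linarith⟩ (by push_cast; ring)]
        exact (cut_hor (cutPar 0) (cutHex 6) g3 (V' 0) (N' 0) (N 6) (by linarith)
          (by linarith) (by ring)).symm
  · intro T g hG F h0 h1
    refine List.forall_mem_cons.2 ⟨?_, List.forall_mem_cons.2 ⟨?_, List.forall_mem_cons.2 ⟨?_,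
      List.forall_mem_cons.2 ⟨?_, List.forall_mem_cons.2 ⟨?_, fun _ h => absurd h List.not_mem_nil⟩⟩⟩⟩⟩
    · refine cut_compat (cutHex 0) (cutHex 5) g0 (by linarith) (V 0) (N 0) (N 5)
        fun u h h' => ?_
      refine (h1 _ _).trans (Eq.trans ?_ (h1 _ _).symm)
      exact hG.mid_mod u 0 0 (by linarith) (by linarith)
        (by push_cast; ring) (by push_cast; ring)
    · refine cut_compat (cutHex 1) (cutPar 4) g1 (by linarith) (V 1) (N 1) (N' 4)
        fun u h h' => ?_
      refine (h1 _ _).trans (Eq.trans ?_ (h0 _ _).symm)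
      exact hG.top_mod u 0 0 (by linarith) (by linarith)
        (by push_cast; ring) (by push_cast; ring)
    · refine cut_compat (cutHex 2) (cutPar 3) g2 (by linarith) (V 2) (N 2) (N' 3)
        fun u h h' => ?_
      refine (h1 _ _).trans (Eq.trans ?_ (h0 _ _).symm)
      exact hG.top_mod (1 + u) 0 0 (by linarith) (by linarith)
        (by push_cast; ring) (by push_cast; ring)
    · refine cut_compat (cutPar 0) (cutHex 6) g3 (by linarith) (V' 0) (N' 0) (N 6)
        fun u h h' => ?_
      refine (h0 _ _).trans (Eq.trans ?_ (h1 _ _).symm)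
      exact (hG.bot_mod (u + √2) (-1) (-1) (by linarith) (by linarith)
        (by push_cast; ring) (by push_cast; ring)).symm
    · refine cut_compat (cutPar 1) (cutHex 4) g4 (by linarith) (V' 1) (N' 1) (N 4)
        fun u h h' => ?_
      refine (h0 _ _).trans (Eq.trans ?_ (h1 _ _).symm)
      exact (hG.bot_mod u 0 0 (by linarith) (by linarith)
        (by push_cast; ring) (by push_cast; ring)).symm

end

/-- The right surgery moves `P` and `P'` by `1` to the left, if the two strips are translated by `-1`. -/
def rightCyl (q r : ℝ) : Cyl ((cutFig q r).reglue (cutHex 0) (cutPar 0)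
    ((cutFig_vec_hex₀ q r).trans (cutFig_vec_par₀ q r).symm)) (q - 1) (r - 1) :=
  rightCylAux (q := q) (r := r) (glue := Equiv.swap (cutHex 0) (cutPar 0) * cutPerm *
    Equiv.swap (cutHex 0) (cutPar 0)) (hg := Pattern.glue_glue (Gluing.reglue (cutFig q r) (cutHex 0)
    (cutPar 0) ((cutFig_vec_hex₀ q r).trans (cutFig_vec_par₀ q r).symm)).1)
    (hV := ((cutFig q r).reglue (cutHex 0) (cutPar 0) ((cutFig_vec_hex₀ q r).trans
    (cutFig_vec_par₀ q r).symm)).2.2)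
    (by decide) (by decide) (by decide) (by decide) (by decide) (by decide) (by decide)
    (by decide)

/-! ### The surgeries -/

lemma start_eq (X : Gluing) [Nonempty X.Pt] (s : X.1.Side) : X.start s = X.pt s.1 (X.vtx s) :=
  (X.pt_eq (X.vtx_mem s)).symm

/-- A chord is the image of an affine path. -/
lemma chord_eq (X : Gluing) [Nonempty X.Pt] (i : Fin X.1.n) {a b : ℂ} (ha : a ∈ X.poly i)
    (hb : b ∈ X.poly i) :
    X.chord i a b = (fun t : ℝ => X.pt i (a + t * (b - a))) '' Icc 0 1 := by
  ext p
  constructor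
  · rintro ⟨x, hx, rfl⟩
    rw [segment_eq_image'] at hx
    obtain ⟨t, ht, hx⟩ := hx
    refine ⟨t, ht, ?_⟩
    simp only [Complex.real_smul] at hx
    simp only [hx]
    exact X.pt_eq x.2
  · rintro ⟨t, ht, rfl⟩
    have h : a + t * (b - a) ∈ segment ℝ a b := by
      rw [segment_eq_image']; exact ⟨t, ht, by simp⟩
    exact ⟨⟨_, (X.convex_poly i).segment_subset ha hb h⟩, h, (X.pt_eq _).symm⟩

section

variable (q r : ℝ)

instance : Nonempty (cutFig q r).Pt := ⟨start _ (cutPar 0)⟩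

lemma cutFigCyl_bot (x : ℝ) (hx : x ∈ Icc 0 (1 + √2)) :
    (cutFigCyl q r).G 0 ⟨x, 0⟩ = (cutFig q r).pt (0 : Fin 2) ⟨x, 0⟩ := by
  have := (cutFigCylAux q r).2.1 ⟨x, 0⟩ (by simpa [trapezoid] using hx)
  exact this.trans (congrArg _ (by rw [Complex.ofReal_zero, sub_zero]))

lemma cutFigCyl_mid (x : ℝ) (hx : x ∈ Icc q (q + (2 + √2))) :
    (cutFigCyl q r).G 1 ⟨x, 0⟩ = (cutFig q r).pt (1 : Fin 2) ⟨x, 0⟩ := by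
  have := (cutFigCylAux q r).2.2 ⟨x, 0⟩ (by
    simp only [trapezoid, zero_div, mul_zero, Set.mem_ofPred_eq, le_refl, true_and, add_zero]
    exact ⟨by positivity, hx⟩)
  exact this.trans (congrArg _ (by rw [Complex.ofReal_zero, sub_zero]))

lemma cutFig_start (s : CutSide) {x : ℂ} (h : cutVtx q r s = x) :
    (cutFig q r).start s = (cutFig q r).pt s.1 x := by
  subst h
  exact start_eq (cutFig q r) s

lemma start_hex₀ : (cutFig q r).start (cutHex 0) = (cutFigCyl q r).p0 := by
  rw [← (cutFigCyl q r).p0_Q, cutFigCyl_mid q r q ⟨le_rfl, by linarith [circ_pos]⟩]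
  exact cutFig_start q r (cutHex 0) rfl

lemma start_hex₁ : (cutFig q r).start (cutHex 1) = (cutFigCyl q r).p0 := by
  rw [← (cutFigCyl q r).p0_P, cutFigCyl_mid q r (q + 1)
    ⟨by linarith, by linarith [circ_pos']⟩]
  exact cutFig_start q r (cutHex 1) rfl

lemma cutFig_next_hex (k : Fin 8) : (cutFig q r).1.next (cutHex k) = cutHex (k + 1) := cutHex_next k

lemma cutFig_next_par (k : Fin 6) : (cutFig q r).1.next (cutPar k) = cutPar (k + 1) := cutPar_next k

lemma isUnitSaddle : (cutFig q r).IsUnitSaddle (cutHex 0) := by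
  refine ⟨cutFig_vec_hex₀ q r, ?_, ?_, fun c hc => ?_⟩
  · rw [cutFig_next_hex]
    exact (start_hex₀ q r).trans (start_hex₁ q r).symm
  · rw [start_hex₀]
    exact (cutFigCyl q r).singular_p0
  · have h := ((cutFigCyl q r).saddle_right (ρ := 1) (by simpa using hc) one_pos le_rfl).2
    rw [chord_eq _ _ ((cutFig q r).vtx_mem (cutHex 0))
      ((cutFig q r).segment_subset_poly (cutHex 0) (right_mem_segment ℝ _ _))]
    refine image_congr fun t ht => ?_
    rw [h t ht, cutFigCyl_mid q r _ ⟨by linarith [ht.1], by linarith [ht.2, circ_pos']⟩]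
    have e : (cutFig q r).vtx ((cutFig q r).1.next (cutHex 0)) - (cutFig q r).vtx (cutHex 0) = 1 :=
      cutFig_vec_hex₀ q r
    simp only [e]
    refine congrArg ((cutFig q r).pt (1 : Fin 2)) ?_
    refine Eq.trans ?_ (congrArg (· + (t : ℂ) * 1) (cut_vtx_hex (hV := cut_admissible q r) 0)).symm
    apply Complex.ext <;> simp

variable {q r} {Z Y : Gluing}

lemma leftSurgery (C : Cyl Z q r) (C' : Cyl Y (q + 1) (r + 1)) : LeftSurgery Z Y := by
  have h := (cutFig_vec_hex₀ q r).trans (cutFig_vec_hex₁ q r).symm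
  refine ⟨cutFig q r, C.iso (cutFigCyl q r), cutHex 0, cutHex 1, h, isUnitSaddle q r,
    ⟨h.symm, 0, (cutFig_next_hex q r 0).symm, fun i hi => absurd hi (Nat.not_lt_zero i)⟩, ?_,
    (leftCyl q r).iso C'⟩
  rw [cutFig_next_hex]
  intro he
  refine (cutFigCyl q r).not_singular_top (u := 1) one_pos (by linarith [sqrt_two_bounds.1]) ?_
  rw [cutFigCyl_mid q r _ ⟨by linarith, by linarith [sqrt_two_bounds.1]⟩]
  have e : (cutFig q r).start (cutHex 2) = (cutFig q r).pt (1 : Fin 2) ⟨q + 1 + 1, 0⟩ :=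
    cutFig_start q r (cutHex 2) rfl
  rw [← e, Cyl.singular_iff]
  exact he.symm.trans (start_hex₁ q r)

lemma rightSurgery (C : Cyl Z q r) (C' : Cyl Y (q - 1) (r - 1)) : RightSurgery Z Y := by
  have h := (cutFig_vec_hex₀ q r).trans (cutFig_vec_par₀ q r).symm
  have e5 : (cutFig q r).1.next.symm (cutHex 6) = cutHex 5 :=
    (Equiv.symm_apply_eq _).2 (cutFig_next_hex q r 5).symm
  have hη : cutPar 0 = (cutFig q r).1.glue ((cutFig q r).1.next.symm
      ((cutFig q r).1.glue (cutHex 0))) := by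
    change cutPar 0 = (cutFig q r).1.glue ((cutFig q r).1.next.symm (cutHex 6))
    rw [e5]; rfl
  refine ⟨cutFig q r, C.iso (cutFigCyl q r), cutHex 0, cutPar 0, h, isUnitSaddle q r,
    ⟨h.symm, 0, hη, fun i hi => absurd hi (Nat.not_lt_zero i)⟩, ?_, (rightCyl q r).iso C'⟩
  rw [cutFig_next_par]
  intro he
  refine (cutFigCyl q r).not_singular_bot (u := 1) one_pos (by linarith [sqrt_two_bounds.1]) ?_
  rw [cutFigCyl_bot q r _ ⟨by linarith, by linarith [sqrt_two_bounds.1]⟩]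
  have e : (cutFig q r).start (cutPar 1) = (cutFig q r).pt (0 : Fin 2) ⟨1, 0⟩ :=
    cutFig_start q r (cutPar 1) rfl
  have e0 : (cutFig q r).start (cutPar 0) = (cutFig q r).pt (0 : Fin 2) ⟨0, 0⟩ :=
    cutFig_start q r (cutPar 0) rfl
  rw [← e, Cyl.singular_iff, Cyl.p0, cutFigCyl_bot q r _ ⟨le_rfl, circ_pos'.le⟩, ← e0]
  exact he.symm

end

/-- The parameters of the cylinders, replaced by equal ones. -/
def Cyl.cast {Y : Gluing} {q r q' r' : ℝ} (C : Cyl Y q r) (hq : q = q') (hr : r = r') : Cyl Y q' r' :=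
  hq ▸ hr ▸ C

lemma posP_pred (n : ℤ) : posP (n - 1) + toIcoDiv circ_pos 0 (n : ℝ) * (2 + √2) = n := by
  have := toIcoMod_add_toIcoDiv_zsmul circ_pos 0 (n : ℝ)
  rw [zsmul_eq_mul] at this
  rw [posP, Int.cast_sub, Int.cast_one, sub_add_cancel, this]

lemma posP'_eq (n : ℤ) : posP' n + toIcoDiv circ_pos' 0 (n : ℝ) * (1 + √2) = n := by
  have := toIcoMod_add_toIcoDiv_zsmul circ_pos' 0 (n : ℝ)
  rwa [zsmul_eq_mul] at this

/-- The two cylinders of `Oct n`, with parameters that are not reduced. -/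
def octCyl (n : ℤ) : Cyl (Oct n).1 n n :=
  ((figCyl (posP (n - 1)) (posP' n)).shift (toIcoDiv circ_pos 0 (n : ℝ))
    (toIcoDiv circ_pos' 0 (n : ℝ))).cast (posP_pred n) (posP'_eq n)

lemma leftSurgery_oct (n : ℤ) : LeftSurgery (Oct n).1 (Oct (n + 1)).1 :=
  leftSurgery (octCyl n) ((octCyl (n + 1)).cast (by push_cast; rfl) (by push_cast; rfl))

lemma rightSurgery_oct (n : ℤ) : RightSurgery (Oct n).1 (Oct (n - 1)).1 :=
  rightSurgery (octCyl n) ((octCyl (n - 1)).cast (by push_cast; rfl) (by push_cast; rfl))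

/-! ### Developed maps and isoperiodic homeomorphisms -/

/-- `D` is a continuous developing map along `Φ : S → Y`: short moves in `S` displace `Φ` by the
increment of `D`. -/
def LocDisp {E : Type*} [TopologicalSpace E] (Y : Gluing) (S : Set E) (Φ : E → Y.Pt) (D : E → ℂ) :
    Prop :=
  ∀ x ∈ S, ContinuousWithinAt D S x ∧ ∀ᶠ x' in 𝓝[S] x, Y.Disp (Φ x) (Φ x') (D x' - D x)

section

variable {E E' : Type*} [TopologicalSpace E] [TopologicalSpace E'] {Y Y' : Gluing} {S T : Set E}
  {Φ Φ' : E → Y.Pt} {D D' : E → ℂ}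

lemma LocDisp.congr (h : LocDisp Y S Φ D) (c : ℂ) (hΦ : ∀ x ∈ S, Φ' x = Φ x)
    (hD : ∀ x ∈ S, D' x = D x + c) : LocDisp Y S Φ' D' := by
  intro x hx
  refine ⟨((h x hx).1.add_const c).congr hD (hD x hx), ?_⟩
  filter_upwards [(h x hx).2, self_mem_nhdsWithin] with x' hd hx'
  rw [hΦ x hx, hΦ x' hx', hD x hx, hD x' hx']
  simpa using hd

lemma LocDisp.comp (h : LocDisp Y S Φ D) {u : E' → E} {S' : Set E'} (hu : ContinuousOn u S')
    (hm : MapsTo u S' S) : LocDisp Y S' (Φ ∘ u) (D ∘ u) := by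
  intro x hx
  have ht : Tendsto u (𝓝[S'] x) (𝓝[S] (u x)) := (hu x hx).tendsto_nhdsWithin hm
  exact ⟨(h _ (hm hx)).1.comp (hu x hx) hm, ht.eventually (h _ (hm hx)).2⟩

/-- A developing map can be checked on the pieces of a finite closed cover. -/
lemma LocDisp.of_pieces {ι : Type*} [Finite ι] (K : ι → Set E) (hK : ∀ i, IsClosed (K i))
    (hS : S ⊆ ⋃ i, K i) (h : ∀ i, LocDisp Y (S ∩ K i) Φ D) : LocDisp Y S Φ D := by
  intro x hx
  have hle : ∀ {P : E → Prop}, (∀ i, x ∈ K i → ∀ᶠ x' in 𝓝[S ∩ K i] x, P x') → ∀ᶠ x' in 𝓝[S] x, P x' := by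
    intro P hP
    have h1 : ∀ᶠ x' in 𝓝[S] x, ∀ i, x' ∈ K i → P x' := by
      rw [Filter.eventually_all]
      intro i
      by_cases hi : x ∈ K i
      · have := hP i hi
        rw [nhdsWithin_inter', eventually_inf_principal] at this
        exact this
      · filter_upwards [mem_nhdsWithin_of_mem_nhds ((hK i).isOpen_compl.mem_nhds hi)] with x' hx' hx''
          using absurd hx'' hx'
    filter_upwards [h1, self_mem_nhdsWithin] with x' h1 hx'
    obtain ⟨i, hi⟩ := mem_iUnion.1 (hS hx')
    exact h1 i hi
  refine ⟨?_, hle fun i hi => (h i x ⟨hx, hi⟩).2⟩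
  intro U hU
  exact hle fun i hi => (h i x ⟨hx, hi⟩).1 hU

/-- A developing map can be checked locally. -/
lemma LocDisp.of_nhds (h : ∀ x ∈ S, ∃ U ∈ 𝓝 x, LocDisp Y (S ∩ U) Φ D) : LocDisp Y S Φ D := by
  intro x hx
  obtain ⟨U, hU, h⟩ := h x hx
  have := h x ⟨hx, mem_of_mem_nhds hU⟩
  rw [ContinuousWithinAt, nhdsWithin_inter_of_mem' (mem_nhdsWithin_of_mem_nhds hU)] at this
  exact this

lemma Cyl.locDisp {q r : ℝ} (C : Cyl Y q r) (j : Fin 2) : LocDisp Y (strip j) (C.G j) id := by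
  intro w hw
  refine ⟨continuousWithinAt_id, ?_⟩
  obtain ⟨ε, hε, h⟩ := C.disp j w hw
  filter_upwards [self_mem_nhdsWithin, mem_nhdsWithin_of_mem_nhds (Metric.ball_mem_nhds w hε)]
    with w' hw' hd
  have := h (w' - w) (by simpa [dist_eq_norm] using hd) (by simpa using hw')
  simpa using this

lemma Cyl.exists_disp {q r : ℝ} (C : Cyl Y q r) {f : Y.Pt → Y'.Pt} {H : Y.Pt → ℂ}
    (h : ∀ j, LocDisp Y' (strip j) (fun w => f (C.G j w)) fun w => w + H (C.G j w)) (p : Y.Pt)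
    {η : ℝ} (hη : 0 < η) : ∃ ε > 0, ∀ p' z, ‖z‖ < ε → Y.Disp p p' z →
      Y'.Disp (f p) (f p') (z + (H p' - H p)) ∧ ‖z + (H p' - H p)‖ < η := by
  obtain ⟨ε, hε, hs⟩ := C.exists_strip p (fun j w z => w + z ∈ strip j →
    Y'.Disp (f (C.G j w)) (f (C.G j (w + z))) (z + (H (C.G j (w + z)) - H (C.G j w))) ∧
      ‖z + (H (C.G j (w + z)) - H (C.G j w))‖ < η) (by
    intro j w hw _
    obtain ⟨h1, h2⟩ := h j w hw
    have h1' : ∀ᶠ w' in 𝓝[strip j] w, ‖(w' + H (C.G j w')) - (w + H (C.G j w))‖ < η := by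
      have := h1 (Metric.ball_mem_nhds _ hη)
      filter_upwards [this] with w' hw'
      simpa [dist_eq_norm] using hw'
    obtain ⟨ε, hε, hb⟩ := Metric.mem_nhdsWithin_iff.1 (h1'.and h2)
    refine ⟨ε, hε, fun z hz hwz => ?_⟩
    obtain ⟨h3, h4⟩ := hb ⟨by simpa [dist_eq_norm] using hz, hwz⟩
    have e : w + z + H (C.G j (w + z)) - (w + H (C.G j w)) = z + (H (C.G j (w + z)) - H (C.G j w)) := by
      ring
    rw [e] at h3 h4
    exact ⟨h4, h3⟩)
  refine ⟨ε, hε, fun p' z hz hd => ?_⟩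
  obtain ⟨j, w, h1, h2, rfl, rfl, h5⟩ := hs p' z hz hd
  exact h5 h2

lemma Cyl.continuous_of_locDisp {q r : ℝ} (C : Cyl Y q r) {f : Y.Pt → Y'.Pt} {H : Y.Pt → ℂ}
    (h : ∀ j, LocDisp Y' (strip j) (fun w => f (C.G j w)) fun w => w + H (C.G j w)) :
    Continuous f := by
  refine continuous_iff_continuousAt.2 fun p U hU => ?_
  obtain ⟨η, hη, hU⟩ := Y'.mem_nhds_iff_disp.1 hU
  obtain ⟨ε, hε, hd⟩ := C.exists_disp h p hη
  refine mem_map.2 (Y.mem_nhds_iff_disp.2 ⟨ε, hε, fun p' z hz hz' => ?_⟩)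
  obtain ⟨h1, h2⟩ := hd p' z hz hz'
  exact hU _ _ h2 h1

lemma Cyl.continuous_shift {q r : ℝ} (C : Cyl Y q r) {f : Y.Pt → Y'.Pt} {H : Y.Pt → ℂ}
    (h : ∀ j, LocDisp Y' (strip j) (fun w => f (C.G j w)) fun w => w + H (C.G j w)) :
    Continuous H := by
  refine continuous_iff_continuousAt.2 fun p => Metric.tendsto_nhds.2 fun η hη => ?_
  obtain ⟨ε, hε, hd⟩ := C.exists_disp h p (half_pos hη)
  refine Y.mem_nhds_iff_disp.2 ⟨min ε (η / 2), by positivity, fun p' z hz hz' => ?_⟩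
  obtain ⟨hz1, hz2⟩ := lt_min_iff.1 hz
  obtain ⟨-, h2⟩ := hd p' z hz1 hz'
  change dist _ _ < η
  rw [dist_eq_norm]
  calc ‖H p' - H p‖ = ‖(z + (H p' - H p)) - z‖ := by congr 1; ring
    _ ≤ ‖z + (H p' - H p)‖ + ‖z‖ := norm_sub_le _ _
    _ < η := by linarith

/-- A homeomorphism that changes the developing map by a globally defined function preserves the
absolute periods. -/
theorem Cyl.isoperiodic_of_locDisp {q r : ℝ} (C : Cyl Y q r) (f : Y.Pt ≃ Y'.Pt) (H : Y.Pt → ℂ)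
    (h : ∀ j, LocDisp Y' (strip j) (fun w => f (C.G j w)) fun w => w + H (C.G j w)) :
    Isoperiodic Y Y' := by
  have hf : Continuous f := C.continuous_of_locDisp h
  have hH : Continuous H := C.continuous_shift h
  refine ⟨hf.homeoOfEquivCompactToT2, fun x γ z ⟨F, hF, hz, hd⟩ =>
    ⟨fun t => F t + H (γ t), hF.add (hH.comp γ.continuous), ?_, fun t => ?_⟩⟩
  · simp only [γ.target, γ.source, add_sub_add_right_eq_sub, hz]
  · obtain ⟨ε, hε, hs⟩ := C.exists_disp h (γ t) one_pos
    have : ∀ᶠ s in 𝓝 t, ‖F s - F t‖ < ε :=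
      ((hF.sub continuous_const).norm.continuousAt (x := t)).eventually_lt continuousAt_const
        (by simpa using hε)
    filter_upwards [hd t, this] with s h1 h2
    have := (hs _ _ h2 h1).1
    rw [add_sub_add_comm]
    exact this

end

/-! ### A Dehn twist about the unit saddle connection -/

/-- Distance to the interval `[0,1]`. -/
def segDist (t : ℝ) : ℝ := max 0 (max (-t) (t - 1))

lemma segDist_nonneg (t : ℝ) : 0 ≤ segDist t := le_max_left _ _

lemma neg_le_segDist (t : ℝ) : -t ≤ segDist t := (le_max_left _ _).trans (le_max_right _ _)

lemma sub_le_segDist (t : ℝ) : t - 1 ≤ segDist t := (le_max_right _ _).trans (le_max_right _ _)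

lemma segDist_le {t ρ : ℝ} (h : 0 ≤ ρ) (h1 : -ρ ≤ t) (h2 : t ≤ 1 + ρ) : segDist t ≤ ρ :=
  max_le h (max_le (by linarith) (by linarith))

lemma segDist_left {ρ : ℝ} (h : 0 ≤ ρ) : segDist (-ρ) = ρ := by
  simp [segDist, h]; linarith

lemma segDist_right {ρ : ℝ} (h : 0 ≤ ρ) : segDist (1 + ρ) = ρ := by
  simp [segDist, h]; linarith

lemma continuous_segDist : Continuous segDist := by unfold segDist; fun_prop

/-- The number of complete turns at the parameter `a` on the loop with index `ρ`, which has
period `1 + 4 * ρ`. -/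
def turn (a ρ : ℝ) : ℤ := ⌊(a + ρ) / (1 + 4 * ρ)⌋

/-- The parameter on the loop, reduced to the interval `[-ρ, 1 + 3 * ρ)`. -/
def rest (a ρ : ℝ) : ℝ := a - turn a ρ * (1 + 4 * ρ)

/-- The position, relative to `B`, at the parameter `b ∈ [-ρ, 1 + ρ]` of the loop. -/
def hexPos (b ρ : ℝ) : ℂ := ⟨b, segDist b - ρ⟩

/-- The position, relative to `E`, at the parameter `b ∈ [1 + ρ, 1 + 3 * ρ]` of the loop. -/
def parPos (b ρ : ℝ) : ℂ := ⟨1 + 2 * ρ - b, ρ - |1 + 2 * ρ - b|⟩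

/-- The developing map along the loops. -/
def loopDev (a ρ : ℝ) : ℂ :=
  turn a ρ + if rest a ρ ≤ 1 + ρ then hexPos (rest a ρ) ρ else parPos (rest a ρ) ρ + 1

section

variable {a ρ : ℝ}

lemma turn_eq {n : ℤ} (hρ : 0 ≤ ρ) (h : -ρ ≤ a - n * (1 + 4 * ρ)) (h' : a - n * (1 + 4 * ρ) < 1 + 3 * ρ) :
    turn a ρ = n := by
  have hP : 0 < 1 + 4 * ρ := by linarith
  rw [turn, Int.floor_eq_iff, le_div_iff₀ hP, div_lt_iff₀ hP]
  constructor <;> linarith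

lemma rest_mem (a : ℝ) (hρ : 0 ≤ ρ) : -ρ ≤ rest a ρ ∧ rest a ρ < 1 + 3 * ρ := by
  have hP : 0 < 1 + 4 * ρ := by linarith
  have h1 := Int.floor_le ((a + ρ) / (1 + 4 * ρ))
  have h2 := Int.lt_floor_add_one ((a + ρ) / (1 + 4 * ρ))
  rw [le_div_iff₀ hP] at h1
  rw [div_lt_iff₀ hP] at h2
  unfold rest turn
  constructor <;> linarith

lemma turn_add (hρ : 0 ≤ ρ) (n : ℤ) : turn (a + n * (1 + 4 * ρ)) ρ = turn a ρ + n := by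
  have hP : 1 + 4 * ρ ≠ 0 := by linarith
  have : (a + n * (1 + 4 * ρ) + ρ) / (1 + 4 * ρ) = (a + ρ) / (1 + 4 * ρ) + n := by
    field_simp; ring
  rw [turn, this, Int.floor_add_intCast, turn]

lemma rest_add (hρ : 0 ≤ ρ) (n : ℤ) : rest (a + n * (1 + 4 * ρ)) ρ = rest a ρ := by
  rw [rest, turn_add hρ, rest]; push_cast; ring

lemma loopDev_add (hρ : 0 ≤ ρ) (n : ℤ) : loopDev (a + n * (1 + 4 * ρ)) ρ = loopDev a ρ + n := by
  rw [loopDev, rest_add hρ, turn_add hρ, loopDev]; push_cast; ring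

lemma rest_eq {n : ℤ} (h : turn a ρ = n) : rest a ρ = a - n * (1 + 4 * ρ) := by rw [rest, h]

/-- The end of the part of the loop in strip `1`, when it is also the start of the next turn. -/
lemma eq_zero_of_end {n : ℤ} (hρ : 0 ≤ ρ) (h' : a - n * (1 + 4 * ρ) ≤ 1 + ρ)
    (h : ¬ a - n * (1 + 4 * ρ) < 1 + 3 * ρ) : ρ = 0 ∧ a = n + 1 := by
  have : ρ = 0 := by linarith
  subst this
  exact ⟨rfl, by linarith⟩

lemma loopDev_hex (hρ : 0 ≤ ρ) (n : ℤ) (h : -ρ ≤ a - n * (1 + 4 * ρ))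
    (h' : a - n * (1 + 4 * ρ) ≤ 1 + ρ) : loopDev a ρ = n + hexPos (a - n * (1 + 4 * ρ)) ρ := by
  by_cases h2 : a - n * (1 + 4 * ρ) < 1 + 3 * ρ
  · have := turn_eq hρ h h2
    rw [loopDev, rest_eq this, this, if_pos h']
  · obtain ⟨rfl, rfl⟩ := eq_zero_of_end hρ h' h2
    have : turn (n + 1) 0 = n + 1 := turn_eq le_rfl (by push_cast; linarith) (by push_cast; linarith)
    rw [loopDev, rest_eq this, this, if_pos (by push_cast; linarith)]
    apply Complex.ext <;> simp [hexPos, segDist]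

lemma loopDev_par (hρ : 0 ≤ ρ) (n : ℤ) (h : 1 + ρ ≤ a - n * (1 + 4 * ρ))
    (h' : a - n * (1 + 4 * ρ) ≤ 1 + 3 * ρ) :
    loopDev a ρ = n + (parPos (a - n * (1 + 4 * ρ)) ρ + 1) := by
  rcases h'.lt_or_eq with h2 | h2
  · have := turn_eq hρ (by linarith) h2
    rcases h.eq_or_lt with h3 | h3
    · rw [loopDev_hex hρ n (by linarith) h3.symm.le, ← h3]
      apply Complex.ext <;> simp [hexPos, parPos, segDist_right hρ]
      · ring
      · ring_nf; rw [abs_of_nonneg hρ, sub_self]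
    · rw [loopDev, rest_eq this, this, if_neg (not_le.2 h3)]
  · rw [loopDev_hex hρ (n + 1) (by push_cast; linarith) (by push_cast; linarith), h2]
    have e : a - ((n + 1 : ℤ) : ℝ) * (1 + 4 * ρ) = -ρ := by push_cast; linarith
    rw [e]
    apply Complex.ext <;> simp [hexPos, parPos, segDist_left hρ]
    · ring
    · ring_nf; rw [abs_neg, abs_of_nonneg hρ, sub_self]

end

namespace Cyl

variable {Y Y' : Gluing} {q r q' r' : ℝ}

/-- The loops around the unit saddle connection: the loop with index `ρ` consists of the points at
distance `ρ` (in the norm `|x| + |y|`) below it, and is completed by a detour around the vertex. -/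
def loop (C : Cyl Y q r) (a ρ : ℝ) : Y.Pt :=
  if rest a ρ ≤ 1 + ρ then C.G 1 (⟨1 + √2 / 2, √2 / 2⟩ + hexPos (rest a ρ) ρ)
  else C.G 0 (parPos (rest a ρ) ρ)

section

variable {a ρ : ℝ}

lemma loop_add (C : Cyl Y q r) (hρ : 0 ≤ ρ) (n : ℤ) :
    C.loop (a + n * (1 + 4 * ρ)) ρ = C.loop a ρ := by
  rw [loop, rest_add hρ, loop]

lemma loop_hex (C : Cyl Y q r) (hρ : 0 ≤ ρ) (n : ℤ) (h : -ρ ≤ a - n * (1 + 4 * ρ))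
    (h' : a - n * (1 + 4 * ρ) ≤ 1 + ρ) :
    C.loop a ρ = C.G 1 (⟨1 + √2 / 2, √2 / 2⟩ + hexPos (a - n * (1 + 4 * ρ)) ρ) := by
  by_cases h2 : a - n * (1 + 4 * ρ) < 1 + 3 * ρ
  · have := turn_eq hρ h h2
    rw [loop, rest_eq this, if_pos h']
  · obtain ⟨rfl, rfl⟩ := eq_zero_of_end hρ h' h2
    have : turn (n + 1) 0 = n + 1 := turn_eq le_rfl (by push_cast; linarith) (by push_cast; linarith)
    rw [loop, rest_eq this, if_pos (by push_cast; linarith)]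
    have e1 : (⟨1 + √2 / 2, √2 / 2⟩ + hexPos ((n : ℝ) + 1 - ((n + 1 : ℤ) : ℝ) * (1 + 4 * 0)) 0 : ℂ) =
        ⟨1 + √2 / 2, √2 / 2⟩ := by
      apply Complex.ext <;> simp [hexPos, segDist]
    have e2 : (⟨1 + √2 / 2, √2 / 2⟩ + hexPos ((n : ℝ) + 1 - (n : ℝ) * (1 + 4 * 0)) 0 : ℂ) =
        ⟨2 + √2 / 2, √2 / 2⟩ := by
      apply Complex.ext <;> simp [hexPos, segDist]; ring
    rw [e1, e2, C.p0_B, C.p0_C]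

lemma loop_par (C : Cyl Y q r) (hρ : 0 ≤ ρ) (hρ' : ρ ≤ 1) (n : ℤ) (h : 1 + ρ ≤ a - n * (1 + 4 * ρ))
    (h' : a - n * (1 + 4 * ρ) ≤ 1 + 3 * ρ) :
    C.loop a ρ = C.G 0 (parPos (a - n * (1 + 4 * ρ)) ρ) := by
  have hs := sqrt_two_bounds
  rcases h'.lt_or_eq with h2 | h2
  · have := turn_eq hρ (by linarith) h2
    rcases h.eq_or_lt with h3 | h3
    · rw [C.loop_hex hρ n (by linarith) h3.symm.le, ← h3]
      have e1 : (⟨1 + √2 / 2, √2 / 2⟩ + hexPos (1 + ρ) ρ : ℂ) = ⟨2 + √2 / 2 + ρ, √2 / 2⟩ := by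
        apply Complex.ext <;> simp [hexPos, segDist_right hρ]; ring
      have e2 : parPos (1 + ρ) ρ = ⟨ρ, 0⟩ := by
        have : 1 + 2 * ρ - (1 + ρ) = ρ := by ring
        rw [parPos, this, abs_of_nonneg hρ, sub_self]
      rw [e1, e2]
      exact C.resp.bot ρ ⟨hρ, by linarith⟩
    · rw [loop, rest_eq this, if_neg (not_le.2 h3)]
  · rw [C.loop_hex hρ (n + 1) (by push_cast; linarith) (by push_cast; linarith), h2]
    have e : a - ((n + 1 : ℤ) : ℝ) * (1 + 4 * ρ) = -ρ := by push_cast; linarith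
    have e1 : (⟨1 + √2 / 2, √2 / 2⟩ + hexPos (-ρ) ρ : ℂ) = ⟨1 + √2 / 2 - ρ, √2 / 2⟩ := by
      apply Complex.ext <;> simp [hexPos, segDist_left hρ]; ring
    have e2 : parPos (1 + 3 * ρ) ρ = ⟨-ρ, 0⟩ := by
      have : 1 + 2 * ρ - (1 + 3 * ρ) = -ρ := by ring
      rw [parPos, this, abs_neg, abs_of_nonneg hρ, sub_self]
    rw [e, e1, e2]
    exact C.resp.bot_mod (1 + √2 - ρ) (-1) (-1) (by linarith) (by linarith) (by push_cast; ring)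
      (by push_cast; ring)

lemma loop_cases (a : ℝ) (hρ : 0 ≤ ρ) : ∃ n : ℤ, -ρ ≤ a - n * (1 + 4 * ρ) ∧
    a - n * (1 + 4 * ρ) < 1 + 3 * ρ := ⟨turn a ρ, rest_mem a hρ⟩

/-- The set of parameters of the loops that are needed for one twist. -/
def loopSet : Set (ℝ × ℝ) := {x | (0 ≤ x.2 ∧ x.2 ≤ 1 / 4) ∧ -x.2 - 1 ≤ x.1 ∧ x.1 ≤ 2 + 3 * x.2}

/-- The loops form a continuous family, developed by `loopDev`. -/
lemma locDisp_loop (C : Cyl Y q r) :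
    LocDisp Y loopSet (fun x => C.loop x.1 x.2) fun x => loopDev x.1 x.2 := by
  have hs := sqrt_two_bounds
  let K : Finset.Icc (-1 : ℤ) 2 × Bool → Set (ℝ × ℝ) := fun i =>
    if i.2 then {x | -x.2 ≤ x.1 - (i.1 : ℤ) * (1 + 4 * x.2) ∧ x.1 - (i.1 : ℤ) * (1 + 4 * x.2) ≤ 1 + x.2}
    else {x | 1 + x.2 ≤ x.1 - (i.1 : ℤ) * (1 + 4 * x.2) ∧
      x.1 - (i.1 : ℤ) * (1 + 4 * x.2) ≤ 1 + 3 * x.2}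
  refine LocDisp.of_pieces K ?_ ?_ ?_
  · have hf : ∀ n : ℤ, Continuous fun x : ℝ × ℝ => x.1 - n * (1 + 4 * x.2) := fun n => by fun_prop
    rintro ⟨n, _ | _⟩
    · exact (isClosed_le (f := fun x : ℝ × ℝ => 1 + x.2) (by fun_prop) (hf n)).inter
        (isClosed_le (g := fun x : ℝ × ℝ => 1 + 3 * x.2) (hf n) (by fun_prop))
    · exact (isClosed_le (f := fun x : ℝ × ℝ => -x.2) (by fun_prop) (hf n)).inter
        (isClosed_le (g := fun x : ℝ × ℝ => 1 + x.2) (hf n) (by fun_prop))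
  · rintro ⟨a, ρ⟩ ⟨⟨h0, h1⟩, h2, h3⟩
    simp only at h0 h1 h2 h3
    obtain ⟨n, h4, h5⟩ := loop_cases a h0
    have hn1 : (n : ℝ) < 3 := by
      by_contra hn; push Not at hn; nlinarith
    have hn2 : (-2 : ℝ) < n := by
      by_contra hn; push Not at hn; nlinarith
    have hn1' : n < 3 := by exact_mod_cast hn1
    have hn2' : -2 < n := by exact_mod_cast hn2
    have hn : n ∈ Finset.Icc (-1 : ℤ) 2 := by rw [Finset.mem_Icc]; omega
    rcases le_total (a - n * (1 + 4 * ρ)) (1 + ρ) with h6 | h6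
    · exact mem_iUnion.2 ⟨⟨⟨n, hn⟩, true⟩, h4, h6⟩
    · exact mem_iUnion.2 ⟨⟨⟨n, hn⟩, false⟩, h6, h5.le⟩
  · rintro ⟨⟨n, hn⟩, _ | _⟩
    · refine ((C.locDisp 0).comp (u := fun x : ℝ × ℝ => parPos (x.1 - n * (1 + 4 * x.2)) x.2)
        ?_ ?_).congr (n + 1) ?_ ?_
      · refine Continuous.continuousOn ?_
        have : Continuous fun p : ℝ × ℝ => (⟨p.1, p.2⟩ : ℂ) := Complex.equivRealProdCLM.symm.continuous
        exact this.comp (f := fun x : ℝ × ℝ => (1 + 2 * x.2 - (x.1 - n * (1 + 4 * x.2)),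
          x.2 - |1 + 2 * x.2 - (x.1 - n * (1 + 4 * x.2))|)) (by fun_prop)
      · rintro ⟨a, ρ⟩ ⟨⟨⟨h0, h1⟩, h2, h3⟩, h4, h5⟩
        simp only at h0 h1 h2 h3 h4 h5
        have := abs_le.2 ⟨(by linarith : -ρ ≤ 1 + 2 * ρ - (a - n * (1 + 4 * ρ))), by linarith⟩
        have h6 := abs_nonneg (1 + 2 * ρ - (a - n * (1 + 4 * ρ)))
        refine ⟨?_, ?_⟩
        · simp only [parPos]; linarith
        · simp only [parPos, ht_zero]; linarith
      · rintro ⟨a, ρ⟩ ⟨⟨⟨h0, h1⟩, h2, h3⟩, h4, h5⟩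
        exact C.loop_par h0 (by linarith) n h4 h5
      · rintro ⟨a, ρ⟩ ⟨⟨⟨h0, h1⟩, h2, h3⟩, h4, h5⟩
        refine (loopDev_par h0 n h4 h5).trans ?_
        simp only [Function.comp, id]; ring
    · refine ((C.locDisp 1).comp (u := fun x : ℝ × ℝ => ⟨1 + √2 / 2, √2 / 2⟩ +
        hexPos (x.1 - n * (1 + 4 * x.2)) x.2) ?_ ?_).congr (n - ⟨1 + √2 / 2, √2 / 2⟩) ?_ ?_
      · refine Continuous.continuousOn ?_
        have : Continuous fun p : ℝ × ℝ => (⟨1 + √2 / 2, √2 / 2⟩ + ⟨p.1, p.2⟩ : ℂ) :=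
          continuous_const.add Complex.equivRealProdCLM.symm.continuous
        have hd := continuous_segDist
        exact this.comp (f := fun x : ℝ × ℝ => (x.1 - n * (1 + 4 * x.2),
          segDist (x.1 - n * (1 + 4 * x.2)) - x.2)) (by fun_prop)
      · rintro ⟨a, ρ⟩ ⟨⟨⟨h0, h1⟩, h2, h3⟩, h4, h5⟩
        simp only at h0 h1 h2 h3 h4 h5
        have h6 := segDist_le h0 h4 h5
        have h7 := segDist_nonneg (a - n * (1 + 4 * ρ))
        refine ⟨?_, ?_⟩
        · simp only [hexPos, Complex.add_im]; linarith
        · simp only [hexPos, Complex.add_im, ht_one]; linarith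
      · rintro ⟨a, ρ⟩ ⟨⟨⟨h0, h1⟩, h2, h3⟩, h4, h5⟩
        exact C.loop_hex h0 n h4 h5
      · rintro ⟨a, ρ⟩ ⟨⟨⟨h0, h1⟩, h2, h3⟩, h4, h5⟩
        refine (loopDev_hex h0 n h4 h5).trans ?_
        simp only [Function.comp, id]; ring

end

end Cyl

/-- The index of the loop through a point of strip `j` that is close to the vertex or to the unit
saddle connection above the origin of the strip. -/
def loopIdx (j : Fin 2) (w : ℂ) : ℝ :=
  ![|w.re| + w.im, √2 / 2 - w.im + segDist (w.re - (1 + √2 / 2))] j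

/-- The parameter of this point on the loop. -/
def loopPar (j : Fin 2) (w : ℂ) : ℝ :=
  ![1 + 2 * (|w.re| + w.im) - w.re, w.re - (1 + √2 / 2)] j

/-- The amount by which the strips are sheared away from the loops. -/
def shear (j : Fin 2) (w : ℂ) : ℝ :=
  ![max 0 ((w.im - 1 / 4) / (3 / 4)), max 0 (1 - w.im / (√2 / 2 - 1 / 4))] j

/-- The midpoint of the part of strip `j` that meets the loops. -/
def loopMid (j : Fin 2) : ℝ := ![0, 3 / 2 + √2 / 2] j

/-- The constant by which the developing map along the loops differs from the coordinate of the
strip. -/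
def loopConst (j : Fin 2) : ℂ := ![1, -⟨1 + √2 / 2, √2 / 2⟩] j

lemma loopIdx_zero (w : ℂ) : loopIdx 0 w = |w.re| + w.im := rfl
lemma loopIdx_one (w : ℂ) :
    loopIdx 1 w = √2 / 2 - w.im + segDist (w.re - (1 + √2 / 2)) := rfl
lemma loopPar_zero (w : ℂ) : loopPar 0 w = 1 + 2 * loopIdx 0 w - w.re := rfl
lemma loopPar_one (w : ℂ) : loopPar 1 w = w.re - (1 + √2 / 2) := rfl
lemma shear_zero (w : ℂ) : shear 0 w = max 0 ((w.im - 1 / 4) / (3 / 4)) := rfl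
lemma shear_one (w : ℂ) : shear 1 w = max 0 (1 - w.im / (√2 / 2 - 1 / 4)) := rfl
lemma loopMid_zero : loopMid 0 = 0 := rfl
lemma loopMid_one : loopMid 1 = 3 / 2 + √2 / 2 := rfl
lemma loopConst_zero : loopConst 0 = 1 := rfl
lemma loopConst_one : loopConst 1 = -⟨1 + √2 / 2, √2 / 2⟩ := rfl

lemma continuous_loopIdx (j : Fin 2) : Continuous (loopIdx j) := by
  have := continuous_segDist
  obtain rfl | rfl := fin_two j
  · change Continuous fun w : ℂ => |w.re| + w.im
    fun_prop
  · change Continuous fun w : ℂ => √2 / 2 - w.im + segDist (w.re - (1 + √2 / 2))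
    fun_prop

lemma continuous_loopPar (j : Fin 2) : Continuous (loopPar j) := by
  obtain rfl | rfl := fin_two j
  · change Continuous fun w : ℂ => 1 + 2 * (|w.re| + w.im) - w.re
    fun_prop
  · change Continuous fun w : ℂ => w.re - (1 + √2 / 2)
    fun_prop

lemma continuous_shear (j : Fin 2) : Continuous (shear j) := by
  obtain rfl | rfl := fin_two j
  · change Continuous fun w : ℂ => max 0 ((w.im - 1 / 4) / (3 / 4))
    fun_prop
  · change Continuous fun w : ℂ => max 0 (1 - w.im / (√2 / 2 - 1 / 4))
    fun_prop

lemma shear_congr {j : Fin 2} {w w' : ℂ} (h : w'.im = w.im) : shear j w' = shear j w := by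
  obtain rfl | rfl := fin_two j <;> simp only [shear_zero, shear_one, h]

lemma loopIdx_nonneg {j : Fin 2} {w : ℂ} (hw : w ∈ strip j) : 0 ≤ loopIdx j w := by
  obtain ⟨h0, h1⟩ := hw
  obtain rfl | rfl := fin_two j
  · rw [loopIdx_zero]; positivity
  · rw [loopIdx_one]; rw [ht_one] at h1; linarith [segDist_nonneg (w.re - (1 + √2 / 2))]

/-- Shearing takes place away from the loops. -/
lemma lt_loopIdx_of_shear {j : Fin 2} {w w' : ℂ} (h : shear j w ≠ 0) (hw : w'.im = w.im) :
    1 / 4 < loopIdx j w' := by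
  have hs := sqrt_two_bounds
  by_contra! hc
  refine h ?_
  obtain rfl | rfl := fin_two j
  · rw [loopIdx_zero] at hc
    rw [shear_zero, max_eq_left]
    have := abs_nonneg w'.re
    exact div_nonpos_of_nonpos_of_nonneg (by linarith) (by norm_num)
  · rw [loopIdx_one] at hc
    rw [shear_one, max_eq_left]
    have := segDist_nonneg (w'.re - (1 + √2 / 2))
    rw [sub_nonpos, le_div_iff₀ (by linarith)]
    linarith

lemma exists_near_loopMid (j : Fin 2) (x : ℝ) : ∃ k : ℤ, |x - k * circ j - loopMid j| < 2 := by
  have hc := circ_pos_all j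
  have hs := sqrt_two_bounds
  refine ⟨round ((x - loopMid j) / circ j), ?_⟩
  have h := abs_sub_round ((x - loopMid j) / circ j)
  have e : x - round ((x - loopMid j) / circ j) * circ j - loopMid j =
      ((x - loopMid j) / circ j - round ((x - loopMid j) / circ j)) * circ j := by
    field_simp; ring
  rw [e, abs_mul, abs_of_pos hc]
  have : circ j < 4 := by obtain rfl | rfl := fin_two j <;> simp <;> linarith
  nlinarith

/-- A point of the strip is close to at most one translate of the loops. -/
lemma lt_loopIdx_of_ne {j : Fin 2} {w : ℂ} (hw : w ∈ strip j) (h : |w.re - loopMid j| < 2) {n : ℤ}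
    (hn : n ≠ 0) : 1 / 4 < loopIdx j (w - n * circ j) := by
  have hs := sqrt_two_bounds
  obtain ⟨h0, h1⟩ := hw
  obtain ⟨h2, h3⟩ := abs_lt.1 h
  have e1 : (w - n * circ j).re = w.re - n * circ j := by simp
  have e2 : (w - n * circ j).im = w.im := by simp
  have hn' : (n : ℝ) ≤ -1 ∨ 1 ≤ (n : ℝ) := by
    rcases lt_or_gt_of_ne hn with h | h
    · left; exact_mod_cast (by omega : n ≤ -1)
    · right; exact_mod_cast (by omega : 1 ≤ n)
  obtain rfl | rfl := fin_two j
  · rw [loopIdx_zero, e1, e2]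
    rw [loopMid_zero] at h2 h3
    rw [circ_zero]
    rcases hn' with h | h
    · have := le_abs_self (w.re - n * (1 + √2)); nlinarith
    · have := neg_abs_le (w.re - n * (1 + √2)); nlinarith
  · rw [loopIdx_one, e1, e2]
    rw [loopMid_one] at h2 h3
    rw [circ_one]
    rw [ht_one] at h1
    rcases hn' with h | h
    · have := sub_le_segDist (w.re - n * (2 + √2) - (1 + √2 / 2)); nlinarith
    · have := neg_le_segDist (w.re - n * (2 + √2) - (1 + √2 / 2)); nlinarith

lemma near_loopMid {j : Fin 2} {w : ℂ} (hw : w ∈ strip j) (h : loopIdx j w ≤ 1 / 4) :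
    |w.re - loopMid j| < 1 := by
  obtain ⟨h0, h1⟩ := hw
  obtain rfl | rfl := fin_two j
  · rw [loopIdx_zero] at h
    rw [loopMid_zero, sub_zero]; linarith
  · rw [loopIdx_one] at h
    rw [ht_one] at h1
    rw [loopMid_one, abs_lt]
    have := sub_le_segDist (w.re - (1 + √2 / 2))
    have := neg_le_segDist (w.re - (1 + √2 / 2))
    constructor <;> linarith

lemma loopPar_mem {j : Fin 2} {w : ℂ} (hw : w ∈ strip j) :
    -loopIdx j w ≤ loopPar j w ∧ loopPar j w ≤ 1 + 3 * loopIdx j w := by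
  obtain ⟨h0, h1⟩ := hw
  obtain rfl | rfl := fin_two j
  · rw [loopPar_zero, loopIdx_zero]
    have := neg_abs_le w.re
    have := le_abs_self w.re
    constructor <;> linarith
  · rw [loopPar_one, loopIdx_one]
    rw [ht_one] at h1
    have := sub_le_segDist (w.re - (1 + √2 / 2))
    have := neg_le_segDist (w.re - (1 + √2 / 2))
    have := segDist_nonneg (w.re - (1 + √2 / 2))
    constructor <;> linarith

lemma loopDev_loopPar {j : Fin 2} {w : ℂ} (hw : w ∈ strip j) :
    loopDev (loopPar j w) (loopIdx j w) = w + loopConst j := by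
  have hρ := loopIdx_nonneg hw
  obtain ⟨h0, h1⟩ := hw
  obtain rfl | rfl := fin_two j
  · have h2 := neg_abs_le w.re
    have h3 := le_abs_self w.re
    rw [loopDev_par hρ 0 (by rw [loopPar_zero, loopIdx_zero]; push_cast; linarith)
      (by rw [loopPar_zero, loopIdx_zero]; push_cast; linarith)]
    have e : 1 + 2 * loopIdx 0 w - (loopPar 0 w - ((0 : ℤ) : ℝ) * (1 + 4 * loopIdx 0 w)) = w.re := by
      rw [loopPar_zero]; push_cast; ring
    rw [parPos, e, loopIdx_zero, loopConst_zero]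
    apply Complex.ext <;> simp
  · rw [ht_one] at h1
    have := sub_le_segDist (w.re - (1 + √2 / 2))
    have := neg_le_segDist (w.re - (1 + √2 / 2))
    rw [loopDev_hex hρ 0 (by rw [loopPar_one, loopIdx_one]; push_cast; linarith)
      (by rw [loopPar_one, loopIdx_one]; push_cast; linarith)]
    have e : loopPar 1 w - ((0 : ℤ) : ℝ) * (1 + 4 * loopIdx 1 w) = w.re - (1 + √2 / 2) := by
      rw [loopPar_one]; push_cast; ring
    rw [e, hexPos, loopIdx_one, loopConst_one]
    apply Complex.ext <;> simp <;> ring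

namespace Cyl

variable {Y Y' : Gluing} {q r q' r' : ℝ}

lemma loop_loopPar (C : Cyl Y q r) {j : Fin 2} {w : ℂ} (hw : w ∈ strip j) (h : loopIdx j w ≤ 1 / 4) :
    C.loop (loopPar j w) (loopIdx j w) = C.G j w := by
  have hρ := loopIdx_nonneg hw
  obtain ⟨h0, h1⟩ := hw
  obtain rfl | rfl := fin_two j
  · have h2 := neg_abs_le w.re
    have h3 := le_abs_self w.re
    rw [C.loop_par hρ (by linarith) 0 (by rw [loopPar_zero, loopIdx_zero]; push_cast; linarith)
      (by rw [loopPar_zero, loopIdx_zero]; push_cast; linarith)]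
    have e : 1 + 2 * loopIdx 0 w - (loopPar 0 w - ((0 : ℤ) : ℝ) * (1 + 4 * loopIdx 0 w)) = w.re := by
      rw [loopPar_zero]; push_cast; ring
    rw [parPos, e, loopIdx_zero]
    congr 1
    apply Complex.ext <;> simp
  · rw [ht_one] at h1
    have := sub_le_segDist (w.re - (1 + √2 / 2))
    have := neg_le_segDist (w.re - (1 + √2 / 2))
    rw [C.loop_hex hρ 0 (by rw [loopPar_one, loopIdx_one]; push_cast; linarith)
      (by rw [loopPar_one, loopIdx_one]; push_cast; linarith)]
    have e : loopPar 1 w - ((0 : ℤ) : ℝ) * (1 + 4 * loopIdx 1 w) = w.re - (1 + √2 / 2) := by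
      rw [loopPar_one]; push_cast; ring
    rw [e, hexPos, loopIdx_one]
    congr 1
    apply Complex.ext <;> simp

lemma exists_loopPar {b ρ : ℝ} (hρ : 0 ≤ ρ) (hρ' : ρ ≤ 1 / 4) (h : -ρ ≤ b) (h' : b ≤ 1 + 3 * ρ) :
    ∃ j, ∃ w ∈ strip j, loopPar j w = b ∧ loopIdx j w = ρ := by
  have hs := sqrt_two_bounds
  rcases le_total b (1 + ρ) with h1 | h1
  · have h2 := segDist_le hρ h h1
    have h3 := segDist_nonneg b
    refine ⟨1, ⟨1 + √2 / 2 + b, √2 / 2 + (segDist b - ρ)⟩, ⟨?_, ?_⟩, ?_, ?_⟩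
    · simp only; linarith
    · simp only [ht_one]; linarith
    · rw [loopPar_one]; simp
    · rw [loopIdx_one]; simp
  · have h2 : |1 + 2 * ρ - b| ≤ ρ := abs_le.2 ⟨by linarith, by linarith⟩
    have h3 := abs_nonneg (1 + 2 * ρ - b)
    refine ⟨0, ⟨1 + 2 * ρ - b, ρ - |1 + 2 * ρ - b|⟩, ⟨?_, ?_⟩, ?_, ?_⟩
    · simp only; linarith
    · simp only [ht_zero]; linarith
    · rw [loopPar_zero, loopIdx_zero]; simp
    · rw [loopIdx_zero]; simp

/-- The rotation of the loops by which the loop with index `ρ ∈ [0, 1/4]` makes `σ * (1 - 4 * ρ)`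
turns, together with the displacement. -/
def loopTurn (C : Cyl Y q r) (σ : ℤ) (a ρ : ℝ) : Y.Pt × ℂ :=
  (C.loop (a + σ * (1 - 4 * ρ)) ρ, loopDev (a + σ * (1 - 4 * ρ)) ρ - loopDev a ρ)

lemma loopTurn_add (C : Cyl Y q r) (σ : ℤ) {a ρ : ℝ} (hρ : 0 ≤ ρ) (n : ℤ) :
    C.loopTurn σ (a + n * (1 + 4 * ρ)) ρ = C.loopTurn σ a ρ := by
  rw [loopTurn, add_right_comm, C.loop_add hρ, loopDev_add hρ, loopDev_add hρ, loopTurn]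
  congr 1; ring

lemma loopTurn_quarter (C : Cyl Y q r) (σ : ℤ) (a : ℝ) :
    C.loopTurn σ a (1 / 4) = (C.loop a (1 / 4), 0) := by
  simp [loopTurn]

lemma loopTurn_zero (C : Cyl Y q r) (σ : ℤ) (a : ℝ) :
    C.loopTurn σ a 0 = (C.loop a 0, (σ : ℂ)) := by
  have h := C.loop_add (a := a) (ρ := 0) le_rfl σ
  have h' := loopDev_add (a := a) (ρ := 0) le_rfl σ
  simp only [mul_zero, add_zero, mul_one] at h h'
  simp only [loopTurn, mul_zero, sub_zero, mul_one, h, h', add_sub_cancel_left]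

open Classical in
/-- The Dehn twist about the unit saddle connection, combined with a shear of the strips, with values
in a surface presented with other parameters; the second component is the displacement. -/
def twist (C : Cyl Y q r) (σ : ℤ) (j : Fin 2) (w : ℂ) : Y.Pt × ℂ :=
  if h : ∃ k : ℤ, loopIdx j (w - k * circ j) ≤ 1 / 4 then
    C.loopTurn σ (loopPar j (w - h.choose * circ j)) (loopIdx j (w - h.choose * circ j))
  else (C.G j (w + (σ * shear j w : ℝ)), (σ * shear j w : ℝ))

section

variable {j : Fin 2} {w : ℂ}

lemma sub_mem_strip (hw : w ∈ strip j) (k : ℤ) : w - k * circ j ∈ strip j := by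
  have := strip_add_real hw (-(k * circ j))
  push_cast at this
  rwa [← sub_eq_add_neg] at this

lemma near_unique (hw : w ∈ strip j) {k k' : ℤ} (h : loopIdx j (w - k * circ j) ≤ 1 / 4)
    (h' : |w.re - k' * circ j - loopMid j| < 2) : k = k' := by
  by_contra hne
  have := lt_loopIdx_of_ne (sub_mem_strip hw k') (by simpa using h') (sub_ne_zero.2 hne)
  have e : w - (k' : ℂ) * circ j - ((k - k' : ℤ) : ℂ) * circ j = w - k * circ j := by
    push_cast; ring
  rw [e] at this
  linarith

/-- The choice of the translate in the definition of `twist` does not matter. -/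
lemma twist_near (C : Cyl Y q r) (σ : ℤ) (hw : w ∈ strip j) (k : ℤ)
    (h : loopIdx j (w - k * circ j) ≤ 1 / 4) :
    C.twist σ j w = C.loopTurn σ (loopPar j (w - k * circ j)) (loopIdx j (w - k * circ j)) := by
  have hex : ∃ k : ℤ, loopIdx j (w - k * circ j) ≤ 1 / 4 := ⟨k, h⟩
  have : hex.choose = k := by
    refine near_unique hw hex.choose_spec ?_
    have := near_loopMid (sub_mem_strip hw k) h
    simp at this
    linarith
  rw [twist, dif_pos hex, this]

/-- On the boundary between the two cases both formulas agree. -/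
lemma twist_far (C : Cyl Y q r) (σ : ℤ) (hw : w ∈ strip j)
    (h : ∀ k : ℤ, 1 / 4 ≤ loopIdx j (w - k * circ j)) :
    C.twist σ j w = (C.G j (w + (σ * shear j w : ℝ)), ((σ * shear j w : ℝ) : ℂ)) := by
  by_cases hex : ∃ k : ℤ, loopIdx j (w - k * circ j) ≤ 1 / 4
  · obtain ⟨k, hk⟩ := hex
    have hk' := le_antisymm hk (h k)
    have h0 : shear j w = 0 := by
      by_contra h0
      have := lt_loopIdx_of_shear h0 (w' := w - k * circ j) (by simp)
      linarith
    rw [C.twist_near σ hw k hk, h0, hk', loopTurn_quarter, ← hk',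
      C.loop_loopPar (sub_mem_strip hw k) hk, ← C.resp.per_int j (sub_mem_strip hw k) k]
    simp
  · rw [twist, dif_neg hex]

lemma far_of_mid (hw : w ∈ strip j) (k : ℤ) (h : |w.re - k * circ j - loopMid j| < 2)
    (h' : 1 / 4 ≤ loopIdx j (w - k * circ j)) (k' : ℤ) : 1 / 4 ≤ loopIdx j (w - k' * circ j) := by
  by_contra! hc
  obtain rfl := near_unique hw hc.le h
  linarith

end

end Cyl

namespace Cyl

variable {Y Y' : Gluing} {q r q' r' : ℝ}

/-- The twist displaces the strips continuously, and the displacement is the second component of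
`twist`. The bound on `σ` keeps the loop parameters in the range `loopSet`. -/
lemma locDisp_twist (C : Cyl Y q r) {σ : ℤ} (hσ : |(σ : ℝ)| ≤ 1) (j : Fin 2) :
    LocDisp Y (strip j) (fun w => (C.twist σ j w).1) fun w => w + (C.twist σ j w).2 := by
  have hs := sqrt_two_bounds
  refine LocDisp.of_nhds fun w₀ hw₀ => ?_
  obtain ⟨k, hk⟩ := exists_near_loopMid j w₀.re
  refine ⟨{w : ℂ | |w.re - k * circ j - loopMid j| < 2},
    (isOpen_lt (f := fun w : ℂ => |w.re - k * circ j - loopMid j|) (by fun_prop)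
      (by fun_prop)).mem_nhds hk, ?_⟩
  have hI : Continuous fun w : ℂ => loopIdx j (w - k * circ j) :=
    (continuous_loopIdx j).comp (by fun_prop)
  have hP : Continuous fun w : ℂ => loopPar j (w - k * circ j) :=
    (continuous_loopPar j).comp (by fun_prop)
  have hS := continuous_shear j
  refine LocDisp.of_pieces (fun b : Bool => if b then {w : ℂ | loopIdx j (w - k * circ j) ≤ 1 / 4}
    else {w : ℂ | 1 / 4 ≤ loopIdx j (w - k * circ j)}) ?_ ?_ ?_
  · rintro (_ | _)
    · exact isClosed_le continuous_const hI
    · exact isClosed_le hI continuous_const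
  · intro w _
    rcases le_total (loopIdx j (w - k * circ j)) (1 / 4) with h | h
    · exact mem_iUnion.2 ⟨true, h⟩
    · exact mem_iUnion.2 ⟨false, h⟩
  · rintro (_ | _)
    · refine ((C.locDisp j).comp (u := fun w => w + (σ * shear j w : ℝ)) ?_ ?_).congr 0 ?_ ?_
      · exact Continuous.continuousOn (by fun_prop)
      · exact fun w hw => strip_add_real hw.1.1 _
      · rintro w ⟨⟨hw, hm⟩, h⟩
        exact congrArg Prod.fst (C.twist_far σ hw (far_of_mid hw k hm h))
      · rintro w ⟨⟨hw, hm⟩, h⟩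
        have := congrArg Prod.snd (C.twist_far σ hw (far_of_mid hw k hm h))
        simp only at this
        rw [this]
        simp
    · refine (C.locDisp_loop.comp (u := fun w => (loopPar j (w - k * circ j) +
        σ * (1 - 4 * loopIdx j (w - k * circ j)), loopIdx j (w - k * circ j))) ?_ ?_).congr
        (k * circ j - loopConst j) ?_ ?_
      · exact Continuous.continuousOn (by fun_prop)
      · rintro w ⟨⟨hw, hm⟩, h⟩
        have h : loopIdx j (w - k * circ j) ≤ 1 / 4 := h
        have h0 := loopIdx_nonneg (sub_mem_strip hw k)
        obtain ⟨h1, h2⟩ := loopPar_mem (sub_mem_strip hw k)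
        obtain ⟨h3, h4⟩ := abs_le.1 hσ
        refine ⟨⟨h0, h⟩, ?_, ?_⟩
        · simp only; nlinarith
        · simp only; nlinarith
      · rintro w ⟨⟨hw, hm⟩, h⟩
        exact congrArg Prod.fst (C.twist_near σ hw k h)
      · rintro w ⟨⟨hw, hm⟩, h⟩
        have := congrArg Prod.snd (C.twist_near σ hw k h)
        simp only [loopTurn, loopDev_loopPar (sub_mem_strip hw k)] at this
        rw [this]
        simp only [Function.comp]
        ring

/-- The twist descends to the surface: the lower side of strip `1` and the upper side of strip `0`
move by `σ`, so does the unit saddle connection on the upper side of strip `1`, by a full turn of its loop, and near the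
rest of the boundary the twist is the rotation of the loops. -/
lemma respects_twist (C : Cyl Y q' r') {σ : ℤ} (hq : q' = q + σ) (hr : r' = r + σ) :
    Respects q r (C.twist σ) := by
  have hs := sqrt_two_bounds
  -- the lower side of strip `1` and the upper side of strip `0` move as a whole
  have hlow : ∀ x : ℝ, C.twist σ 1 ⟨x, 0⟩ = (C.G 1 ⟨x + σ, 0⟩, (σ : ℂ)) := by
    intro x
    rw [C.twist_far σ (mk_zero_mem 1 x) fun k => ?_]
    · have : shear 1 ⟨x, 0⟩ = 1 := by rw [shear_one]; simp
      rw [this]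
      refine Prod.ext (congrArg (C.G 1) ?_) ?_
      · apply Complex.ext <;> simp
      · simp
    · rw [loopIdx_one]
      have := segDist_nonneg (((⟨x, 0⟩ : ℂ) - k * circ 1).re - (1 + √2 / 2))
      have e : ((⟨x, 0⟩ : ℂ) - k * circ 1).im = 0 := by simp
      rw [e]; linarith
  have hup : ∀ x : ℝ, C.twist σ 0 ⟨x, 1⟩ = (C.G 0 ⟨x + σ, 1⟩, (σ : ℂ)) := by
    intro x
    refine (C.twist_far σ (mk_ht_mem 0 x) fun k => ?_).trans ?_
    rotate_left
    · have : shear 0 ⟨x, 1⟩ = 1 := by rw [shear_zero]; norm_num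
      simp only [ht_zero]
      rw [this]
      refine Prod.ext (congrArg (C.G 0) ?_) ?_
      · apply Complex.ext <;> simp
      · simp
    · rw [loopIdx_zero]
      have := abs_nonneg ((⟨x, ht 0⟩ : ℂ) - k * circ 0).re
      have e : ((⟨x, ht 0⟩ : ℂ) - k * circ 0).im = 1 := by simp
      rw [e]; linarith
  constructor
  · intro j w hw
    have hw' := strip_add_real hw (circ j)
    have e : ∀ k : ℤ, w + circ j - ((k + 1 : ℤ) : ℂ) * circ j = w - k * circ j := fun k => by
      push_cast; ring
    by_cases h : ∃ k : ℤ, loopIdx j (w - k * circ j) ≤ 1 / 4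
    · obtain ⟨k, hk⟩ := h
      rw [C.twist_near σ hw k hk, C.twist_near σ hw' (k + 1) (by rwa [e]), e]
    · push Not at h
      have h1 := C.twist_far σ hw fun k => (h k).le
      have h2 := C.twist_far σ hw' fun k => by
        have := e (k - 1)
        rw [sub_add_cancel] at this
        rw [this]
        exact (h _).le
      have h3 : shear j (w + circ j) = shear j w := shear_congr (by simp)
      rw [h1, h2, h3, add_right_comm, C.resp.per j _ (strip_add_real hw _)]
  · intro u hu
    have hB : (⟨1 + √2 / 2 + u, √2 / 2⟩ : ℂ) - ((0 : ℤ) : ℂ) * circ 1 = ⟨1 + √2 / 2 + u, √2 / 2⟩ := by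
      simp
    have hI : loopIdx 1 ⟨1 + √2 / 2 + u, √2 / 2⟩ = 0 := by
      rw [loopIdx_one]
      have h1 := segDist_le le_rfl (by simpa using hu.1) (by simpa using hu.2) (t := u)
      have h2 := segDist_nonneg u
      simp; linarith
    have hP : loopPar 1 ⟨1 + √2 / 2 + u, √2 / 2⟩ = u := by rw [loopPar_one]; simp
    have hm : (⟨1 + √2 / 2 + u, √2 / 2⟩ : ℂ) ∈ strip 1 := mk_ht_mem 1 _
    rw [hlow, C.twist_near σ hm 0 (by rw [hB, hI]; norm_num), hB, hI, hP, loopTurn_zero]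
    have h1 := C.loop_loopPar hm (by rw [hI]; norm_num)
    rw [hI, hP] at h1
    rw [h1, ← C.resp.mid u hu, show q' + u = q + u + σ by rw [hq]; ring]
  · intro u hu
    rw [hlow, hup]
    have := C.resp.top u hu
    rw [show q' + 1 + u = q + 1 + u + σ by rw [hq]; ring,
      show r' + u = r + u + σ by rw [hr]; ring] at this
    rw [this]
  · intro u hu
    have hm : (⟨2 + √2 / 2 + u, √2 / 2⟩ : ℂ) ∈ strip 1 := mk_ht_mem 1 _
    have hm' : (⟨u, 0⟩ : ℂ) ∈ strip 0 := mk_zero_mem 0 _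
    have e1 : ∀ k : ℤ, (⟨2 + √2 / 2 + u, √2 / 2⟩ : ℂ) - k * circ 1 =
        ⟨2 + √2 / 2 + u - k * (2 + √2), √2 / 2⟩ := fun k => by apply Complex.ext <;> simp
    have e2 : ∀ k : ℤ, (⟨u, 0⟩ : ℂ) - k * circ 0 = ⟨u - k * (1 + √2), 0⟩ := fun k => by
      apply Complex.ext <;> simp
    have i1 : ∀ x : ℝ, loopIdx 1 ⟨x, √2 / 2⟩ = segDist (x - (1 + √2 / 2)) := fun x => by
      rw [loopIdx_one]; simp
    have i2 : ∀ x : ℝ, loopIdx 0 ⟨x, 0⟩ = |x| := fun x => by rw [loopIdx_zero]; simp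
    have far : ∀ k : ℤ, |(2 + √2 / 2 + u) - k * circ 1 - loopMid 1| < 2 → |u - k * circ 0 - loopMid 0| < 2 →
        1 / 4 ≤ loopIdx 1 ((⟨2 + √2 / 2 + u, √2 / 2⟩ : ℂ) - k * circ 1) →
        1 / 4 ≤ loopIdx 0 ((⟨u, 0⟩ : ℂ) - k * circ 0) →
        C.twist σ 1 ⟨2 + √2 / 2 + u, √2 / 2⟩ = C.twist σ 0 ⟨u, 0⟩ := by
      intro k h1 h2 h3 h4
      rw [C.twist_far σ hm (far_of_mid hm k h1 h3), C.twist_far σ hm' (far_of_mid hm' k h2 h4)]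
      have s1 : shear 1 ⟨2 + √2 / 2 + u, √2 / 2⟩ = 0 := by
        rw [shear_one, max_eq_left]
        rw [sub_nonpos, le_div_iff₀ (by linarith)]
        simp
      have s2 : shear 0 ⟨u, 0⟩ = 0 := by
        rw [shear_zero, max_eq_left]
        norm_num
      rw [s1, s2]
      simp only [mul_zero, Complex.ofReal_zero, add_zero]
      rw [C.resp.bot u hu]
    obtain ⟨hu0, hu1⟩ := hu
    rcases le_total u ((1 + √2) / 2) with h | h
    · have a1 : segDist (2 + √2 / 2 + u - ((0 : ℤ) : ℝ) * (2 + √2) - (1 + √2 / 2)) = u := by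
        refine Eq.trans ?_ (segDist_right hu0); congr 1; push_cast; ring
      have a2 : |u - ((0 : ℤ) : ℝ) * (1 + √2)| = u := by
        rw [← abs_of_nonneg hu0]; congr 1; push_cast; rw [abs_of_nonneg hu0]; ring
      rcases le_total u (1 / 4) with h' | h'
      · rw [C.twist_near σ hm 0 (by rw [e1, i1, a1]; exact h'),
          C.twist_near σ hm' 0 (by rw [e2, i2, a2]; exact h'), loopPar_zero, loopPar_one, e1, e2, i1,
          i2, a1, a2]
        congr 1; push_cast; ring
      · refine far 0 ?_ ?_ (by rw [e1, i1, a1]; exact h') (by rw [e2, i2, a2]; exact h')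
        · rw [abs_lt, circ_one, loopMid_one]; push_cast; constructor <;> linarith
        · rw [abs_lt, circ_zero, loopMid_zero]; push_cast; constructor <;> linarith
    · have hv : 0 ≤ 1 + √2 - u := by linarith
      have a1 : segDist (2 + √2 / 2 + u - ((1 : ℤ) : ℝ) * (2 + √2) - (1 + √2 / 2)) = 1 + √2 - u := by
        refine Eq.trans ?_ (segDist_left hv); congr 1; push_cast; ring
      have a2 : |u - ((1 : ℤ) : ℝ) * (1 + √2)| = 1 + √2 - u := by
        rw [abs_of_nonpos (by push_cast; linarith)]; push_cast; ring
      rcases le_total (1 + √2 - u) (1 / 4) with h' | h'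
      · rw [C.twist_near σ hm 1 (by rw [e1, i1, a1]; exact h'),
          C.twist_near σ hm' 1 (by rw [e2, i2, a2]; exact h'), loopPar_zero, loopPar_one, e1, e2, i1,
          i2, a1, a2, ← C.loopTurn_add σ hv 1]
        congr 1; push_cast; ring
      · refine far 1 ?_ ?_ (by rw [e1, i1, a1]; exact h') (by rw [e2, i2, a2]; exact h')
        · rw [abs_lt, circ_one, loopMid_one]; push_cast; constructor <;> linarith
        · rw [abs_lt, circ_zero, loopMid_zero]; push_cast; constructor <;> linarith

/-- The twist in the opposite direction is the inverse. -/
lemma twist_inverse (C : Cyl Y q r) (C' : Cyl Y' q' r') {σ : ℤ} {f' : Y'.Pt → Y.Pt}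
    (hf' : ∀ j, ∀ w ∈ strip j, f' (C'.G j w) = (C.twist (-σ) j w).1) {j : Fin 2} {w : ℂ}
    (hw : w ∈ strip j) : f' (C'.twist σ j w).1 = C.G j w := by
  have hloop : ∀ {a ρ : ℝ}, 0 ≤ ρ → ρ ≤ 1 / 4 →
      f' (C'.loop a ρ) = C.loop (a - σ * (1 - 4 * ρ)) ρ := by
    intro a ρ h0 h1
    obtain ⟨h2, h3⟩ := rest_mem a h0
    obtain ⟨j, w, hw, h4, h5⟩ := exists_loopPar h0 h1 h2 h3.le
    have e : a = loopPar j w + turn a ρ * (1 + 4 * ρ) := by rw [h4, rest]; ring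
    have e' : C'.loop a ρ = C'.G j w := by
      rw [← C'.loop_loopPar hw (by rw [h5]; exact h1), h5,
        ← C'.loop_add (a := loopPar j w) h0 (turn a ρ), ← e]
    have hk : w - ((0 : ℤ) : ℂ) * circ j = w := by simp
    rw [e', hf' j w hw, C.twist_near (-σ) hw 0 (by rw [hk, h5]; exact h1), hk, loopTurn, h5]
    have e2 : a - σ * (1 - 4 * ρ) = loopPar j w + ((-σ : ℤ) : ℝ) * (1 - 4 * ρ) +
        turn a ρ * (1 + 4 * ρ) := by
      push_cast; linarith
    rw [e2, C.loop_add h0]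
  by_cases h : ∃ k : ℤ, loopIdx j (w - k * circ j) ≤ 1 / 4
  · obtain ⟨k, hk⟩ := h
    have hm := sub_mem_strip hw k
    rw [C'.twist_near σ hw k hk, loopTurn, hloop (loopIdx_nonneg hm) hk, add_sub_cancel_right,
      C.loop_loopPar hm hk, ← C.resp.per_int j hm k, sub_add_cancel]
  · push Not at h
    have hm := strip_add_real hw (σ * shear j w)
    have e : shear j (w + (σ * shear j w : ℝ)) = shear j w := shear_congr (by simp)
    rw [C'.twist_far σ hw fun k => (h k).le, hf' j _ hm, C.twist_far (-σ) hm fun k => ?_, e]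
    · simp only
      congr 1
      push_cast; ring
    · by_cases h0 : shear j w = 0
      · rw [h0, mul_zero, Complex.ofReal_zero, add_zero]; exact (h k).le
      · exact (lt_loopIdx_of_shear h0 (by simp)).le

/-- Moving both parameters by one unit does not change the absolute periods. -/
theorem isoperiodic_add_one (C : Cyl Y q r) (C' : Cyl Y' (q + 1) (r + 1)) : Isoperiodic Y Y' := by
  have hr : Respects q r (C'.twist 1) :=
    C'.respects_twist (by push_cast; rfl) (by push_cast; rfl)
  have hr' : Respects (q + 1) (r + 1) (C.twist (-1)) :=
    C.respects_twist (by push_cast; ring) (by push_cast; ring)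
  obtain ⟨f, hf⟩ := C.univ _ hr
  obtain ⟨f', hf'⟩ := C'.univ _ hr'
  have h1 : ∀ p, (f' (f p).1).1 = p := fun p => by
    obtain ⟨j, w, hw, rfl⟩ := C.surj p
    rw [hf j w hw]
    exact twist_inverse C C' (f' := fun p => (f' p).1) (fun j w hw => by rw [hf' j w hw]) hw
  have h2 : ∀ p, (f (f' p).1).1 = p := fun p => by
    obtain ⟨j, w, hw, rfl⟩ := C'.surj p
    rw [hf' j w hw]
    exact twist_inverse C' C (f' := fun p => (f p).1) (σ := -1)
      (fun j w hw => by rw [hf j w hw]; simp) hw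
  refine C.isoperiodic_of_locDisp ⟨fun p => (f p).1, fun p => (f' p).1, h1, h2⟩ (fun p => (f p).2)
    fun j => ?_
  refine (C'.locDisp_twist (σ := 1) (by simp) j).congr 0 (fun w hw => ?_) fun w hw => ?_
  · simp [hf j w hw]
  · simp [hf j w hw]

end Cyl

/-! ### The two cylinders of the octagon -/

lemma oct_vtx (k : Fin 8) : octagon.1.vtx (octSide k) =
    (![⟨0, 0⟩, ⟨1, 0⟩, ⟨1 + √2 / 2, √2 / 2⟩, ⟨1 + √2 / 2, 1 + √2 / 2⟩, ⟨1, 1 + √2⟩, ⟨0, 1 + √2⟩,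
      ⟨-(√2 / 2), 1 + √2 / 2⟩, ⟨-(√2 / 2), √2 / 2⟩] : Fin 8 → ℂ) k := octagonVtx_eq k

lemma oct_vtx_next (k : Fin 8) : octagon.1.vtx (octagon.1.1.next (octSide k)) =
    (![⟨0, 0⟩, ⟨1, 0⟩, ⟨1 + √2 / 2, √2 / 2⟩, ⟨1 + √2 / 2, 1 + √2 / 2⟩, ⟨1, 1 + √2⟩, ⟨0, 1 + √2⟩,
      ⟨-(√2 / 2), 1 + √2 / 2⟩, ⟨-(√2 / 2), √2 / 2⟩] : Fin 8 → ℂ) (k + 1) :=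
  (congrArg _ (octagon_next k)).trans (oct_vtx (k + 1))

lemma oct_mem (k : Fin 8) {x : ℂ} (h : x = octagon.1.vtx (octSide k)) :
    x ∈ octagon.1.poly (0 : Fin 1) := h ▸ octagon.1.vtx_mem (octSide k)

/-- A linear inequality that holds at the vertices of a polygon holds on the polygon. -/
lemma poly_le {Y : Gluing} {i : Fin Y.1.n} (α β c : ℝ)
    (h : ∀ k, α * (Y.vtx ⟨i, k⟩).re + β * (Y.vtx ⟨i, k⟩).im ≤ c) {x : ℂ} (hx : x ∈ Y.poly i) :
    α * x.re + β * x.im ≤ c := by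
  have hc : Convex ℝ {x : ℂ | (α • Complex.reLm + β • Complex.imLm) x ≤ c} :=
    convex_halfSpace_le (LinearMap.isLinear _) c
  exact convexHull_min (range_subset_iff.2 h) hc hx

lemma oct_le (α β c : ℝ) (h : ∀ k : Fin 8, α * (octagon.1.vtx (octSide k)).re +
    β * (octagon.1.vtx (octSide k)).im ≤ c) {x : ℂ} (hx : x ∈ octagon.1.poly (0 : Fin 1)) :
    α * x.re + β * x.im ≤ c := poly_le α β c h hx

instance : Nonempty octagon.1.Pt := ⟨start _ (octSide 0)⟩

/-- The lower strip consists of the lower and the upper trapezoid of the octagon. -/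
def octHex : Slab octagon.1 (√2 / 2) (2 + √2) where
  m := 2
  lo k := if k = 0 then 0 else if k = 1 then 1 else 2 + √2
  hi k := if k = 0 then -(√2 / 2) else if k = 1 then 1 + √2 / 2 else 2 + √2 / 2
  idx _ := (0 : Fin 1)
  τ k := if k = 0 then 0 else ⟨1 + √2 / 2, -(1 + √2 / 2)⟩
  m_pos := two_pos
  lo_le k hk := by
    have := sqrt_two_bounds
    obtain rfl | rfl : k = 0 ∨ k = 1 := by omega
    · norm_num
    · norm_num; linarith
  hi_le k hk := by
    have := sqrt_two_bounds
    obtain rfl | rfl : k = 0 ∨ k = 1 := by omega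
    · norm_num; linarith
    · norm_num
  lo_wrap := by norm_num
  hi_wrap := by norm_num; ring
  corner k hk := by
    obtain rfl | rfl : k = 0 ∨ k = 1 := by omega
    · refine ⟨⟨oct_mem 0 ?_, oct_mem 1 ?_⟩, oct_mem 7 ?_, oct_mem 2 ?_⟩ <;> rw [oct_vtx] <;> simp
    · refine ⟨⟨oct_mem 6 ?_, oct_mem 3 ?_⟩, oct_mem 5 ?_, oct_mem 4 ?_⟩ <;> rw [oct_vtx] <;>
        apply Complex.ext <;> simp <;> ring
  seam k hk w hw := by
    obtain rfl : k = 0 := by omega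
    refine pt_glue_eq (X := octagon.1) (octSide 1) (s' := octSide 5) rfl ?_ ?_
    · rw [oct_vtx, oct_vtx_next]
      simpa using hw
    · rw [oct_vtx, oct_vtx_next]
      apply Complex.ext <;> simp <;> ring
  wrap w hw := by
    refine (pt_glue_eq (X := octagon.1) (octSide 7) (s' := octSide 3) rfl ?_ ?_).symm
    · rw [oct_vtx, oct_vtx_next, segment_symm]
      simpa using hw
    · rw [oct_vtx, oct_vtx_next]
      apply Complex.ext <;> simp <;> ring

lemma mem_octHex_zero {w : ℂ} : w ∈ octHex.trap 0 ↔
    (0 ≤ w.im ∧ w.im ≤ √2 / 2) ∧ -w.im ≤ w.re ∧ w.re ≤ 1 + w.im := by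
  have e : √2 / 2 * (w.im / (√2 / 2)) = w.im := by field_simp
  simp [Slab.trap, Slab.line, octHex, e]

lemma mem_octHex_one {w : ℂ} : w ∈ octHex.trap 1 ↔
    (0 ≤ w.im ∧ w.im ≤ √2 / 2) ∧ 1 + w.im ≤ w.re ∧ w.re ≤ 2 + √2 - w.im := by
  have e : √2 / 2 * (w.im / (√2 / 2)) = w.im := by field_simp
  have e2 : 2 + √2 + (√2 / 2 - √2) * (w.im / (√2 / 2)) = 2 + √2 - w.im := by
    rw [show √2 / 2 - √2 = -(√2 / 2) by ring, neg_mul, e, sub_eq_add_neg]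
  simp [Slab.trap, Slab.line, octHex, e2, e]

/-- The upper strip is the rectangle in the middle of the octagon. -/
def octPar : Slab octagon.1 1 (1 + √2) :=
  Slab.one (0 : Fin 1) 0 0 ⟨√2 / 2, -(√2 / 2)⟩ circ_pos'.le
    (by
      refine ⟨⟨oct_mem 7 ?_, oct_mem 2 ?_⟩, oct_mem 6 ?_, oct_mem 3 ?_⟩ <;> rw [oct_vtx] <;>
        apply Complex.ext <;> simp <;> ring)
    (by
      intro w hw
      refine (pt_glue_eq (X := octagon.1) (octSide 6) (s' := octSide 2) rfl ?_ ?_).symm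
      · rw [oct_vtx, oct_vtx_next, segment_symm]
        have := (mem_segment_translate ℝ (⟨-(√2 / 2), √2 / 2⟩ : ℂ)).2 hw
        have e1 : (⟨-(√2 / 2), √2 / 2⟩ : ℂ) + w = w - ⟨√2 / 2, -(√2 / 2)⟩ := by
          apply Complex.ext <;> simp <;> ring
        have e2 : (⟨-(√2 / 2), √2 / 2⟩ : ℂ) + ⟨0, 0⟩ = ⟨-(√2 / 2), √2 / 2⟩ := by
          apply Complex.ext <;> simp
        have e3 : (⟨-(√2 / 2), √2 / 2⟩ : ℂ) + ⟨0, 1⟩ = ⟨-(√2 / 2), 1 + √2 / 2⟩ := by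
          apply Complex.ext <;> simp; ring
        rw [e1, e2, e3] at this
        exact this
      · rw [oct_vtx, oct_vtx_next]
        apply Complex.ext <;> simp <;> ring)

lemma mem_octPar {w : ℂ} : w ∈ octPar.trap 0 ↔
    (0 ≤ w.im ∧ w.im ≤ 1) ∧ 0 ≤ w.re ∧ w.re ≤ 1 + √2 := by
  refine Slab.mem_one_trap.trans ?_
  simp

lemma seg_elim {a b a' b' : ℝ} {x : ℂ} (hx : x ∈ segment ℝ (⟨a, b⟩ : ℂ) ⟨a', b'⟩) :
    ∃ t ∈ Icc (0 : ℝ) 1, x = ⟨a + t * (a' - a), b + t * (b' - b)⟩ := by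
  rw [segment_eq_image'] at hx
  obtain ⟨t, ht, rfl⟩ := hx
  exact ⟨t, ht, by apply Complex.ext <;> simp⟩

section

variable {T : Type} {g : Fin 2 → ℂ → T}

/-- A map on the strips, put together to a map on the octagon. -/
lemma exists_octagon_map (hg : Respects 0 0 g) : ∃ F : ℂ → T, (∀ x : ℂ, x.im ≤ √2 / 2 → F x = g 1 x) ∧
    (∀ u ∈ Icc (0 : ℝ) (1 + √2), ∀ y ∈ Icc (0 : ℝ) 1, F ⟨u - √2 / 2, y + √2 / 2⟩ = g 0 ⟨u, y⟩) ∧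
    ∀ x ∈ octHex.trap 1, F (x - ⟨1 + √2 / 2, -(1 + √2 / 2)⟩) = g 1 x := by
  have hs := sqrt_two_bounds
  let F : ℂ → T := fun x => if x.im ≤ √2 / 2 then g 1 x else
    if x.im ≤ 1 + √2 / 2 then g 0 (x + ⟨√2 / 2, -(√2 / 2)⟩)
    else g 1 (x + ⟨1 + √2 / 2, -(1 + √2 / 2)⟩)
  have f0 : ∀ x : ℂ, x.im ≤ √2 / 2 → F x = g 1 x := fun x h => if_pos h
  have f1 : ∀ u ∈ Icc (0 : ℝ) (1 + √2), ∀ y ∈ Icc (0 : ℝ) 1, F ⟨u - √2 / 2, y + √2 / 2⟩ =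
      g 0 ⟨u, y⟩ := by
    intro u hu y hy
    rcases hy.1.eq_or_lt with rfl | h
    · rw [f0 _ (by simp), zero_add]
      exact hg.bot_mod u (-1) 0 hu.1 hu.2 (by push_cast; ring) (by simp)
    · have h1 : ¬ y + √2 / 2 ≤ √2 / 2 := by linarith
      have h2 : y + √2 / 2 ≤ 1 + √2 / 2 := by linarith [hy.2]
      simp only [F, if_neg h1, if_pos h2]
      congr 1
      apply Complex.ext <;> simp
  refine ⟨F, f0, f1, fun x hx => ?_⟩
  obtain ⟨⟨h1, h2⟩, h3, h4⟩ := mem_octHex_one.1 hx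
  rcases h1.eq_or_lt with h | h
  · rw [← h] at h3 h4
    have := f1 (x.re - 1) ⟨by linarith, by linarith⟩ 1 ⟨zero_le_one, le_rfl⟩
    have e := hg.top (x.re - 1) ⟨by linarith, by linarith⟩
    rw [zero_add, zero_add] at e
    rw [← e] at this
    convert this using 2
    · apply Complex.ext <;> simp [← h]; ring
    · apply Complex.ext <;> simp [← h]
  · have h5 : ¬ x.im + (1 + √2 / 2) ≤ √2 / 2 := by linarith
    have h6 : ¬ x.im + (1 + √2 / 2) ≤ 1 + √2 / 2 := by linarith
    have e : (x - ⟨1 + √2 / 2, -(1 + √2 / 2)⟩).im = x.im + (1 + √2 / 2) := by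
      simp only [Complex.sub_im]; ring
    simp only [F, e, if_neg h5, if_neg h6, sub_add_cancel]

variable {F : ℂ → T}

/-- A map on the octagon that agrees with a family `g` respecting the identifications on the three
pieces of the octagon is compatible with the gluing of its sides. -/
lemma octagon_compat (hg : Respects 0 0 g) (f0 : ∀ x : ℂ, x.im ≤ √2 / 2 → F x = g 1 x)
    (f1 : ∀ u ∈ Icc (0 : ℝ) (1 + √2), ∀ y ∈ Icc (0 : ℝ) 1, F ⟨u - √2 / 2, y + √2 / 2⟩ = g 0 ⟨u, y⟩)
    (f2 : ∀ x ∈ octHex.trap 1, F (x - ⟨1 + √2 / 2, -(1 + √2 / 2)⟩) = g 1 x)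
    (s : octagon.1.1.Side) : ∀ x ∈ segment ℝ (octagon.1.vtx s) (octagon.1.vtx (octagon.1.1.next s)),
      F x = F (x - octagon.1.vtx s + octagon.1.vtx (octagon.1.1.next (octagon.1.1.glue s))) := by
  have hs := sqrt_two_bounds
  have hV := oct_vtx
  have hN := oct_vtx_next
  have hl : ∀ s : octagonPattern.Side, s ∈ [octSide 0, octSide 1, octSide 2, octSide 3] ∨
      octagonPattern.glue s ∈ [octSide 0, octSide 1, octSide 2, octSide 3] := by decide
  refine compat_of_half (X := octagon.1) (F := fun _ => F)
    [octSide 0, octSide 1, octSide 2, octSide 3] hl ?_ s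
  refine List.forall_mem_cons.2 ⟨?_, List.forall_mem_cons.2 ⟨?_, List.forall_mem_cons.2 ⟨?_,
    List.forall_mem_cons.2 ⟨?_, fun _ h => absurd h List.not_mem_nil⟩⟩⟩⟩
  · refine compat_add (X := octagon.1) (F := fun _ => F) (s := octSide 0)
      (s' := octSide 4) rfl (hV 0) (hN 0) (d := ⟨0, 1 + √2⟩)
      ((hN 4).trans ?_) fun x hx => ?_
    · change (⟨0, 1 + √2⟩ : ℂ) = ⟨0, 0⟩ + ⟨0, 1 + √2⟩
      apply Complex.ext <;> simp
    · obtain ⟨t, ht, rfl⟩ := seg_elim hx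
      have h1 := f2 ⟨1 + √2 / 2 + t, √2 / 2⟩ (mem_octHex_one.2 ⟨⟨by linarith, le_rfl⟩,
        by simp only; linarith [ht.1], by simp only; linarith [ht.2]⟩)
      refine (f0 _ ?_).trans (Eq.trans ?_ (h1.symm.trans (congrArg F ?_)))
      · simp only; linarith
      · convert hg.mid t ht using 2; apply Complex.ext <;> simp
      · apply Complex.ext <;> simp; ring
  · refine compat_add (X := octagon.1) (F := fun _ => F) (s := octSide 1)
      (s' := octSide 5) rfl (hV 1) (hN 1) (d := -⟨1 + √2 / 2, -(1 + √2 / 2)⟩)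
      ((hN 5).trans ?_) fun x hx => ?_
    · change (⟨-(√2 / 2), 1 + √2 / 2⟩ : ℂ) = ⟨1, 0⟩ + -⟨1 + √2 / 2, -(1 + √2 / 2)⟩
      apply Complex.ext <;> simp
    · obtain ⟨t, ht, rfl⟩ := seg_elim hx
      refine (f0 _ ?_).trans ((f2 _ (mem_octHex_one.2 ⟨⟨?_, ?_⟩, ?_, ?_⟩)).symm.trans
        (congrArg F (sub_eq_add_neg _ _))) <;> simp only <;> nlinarith [ht.1, ht.2]
  · refine compat_add (X := octagon.1) (F := fun _ => F) (s := octSide 2)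
      (s' := octSide 6) rfl (hV 2) (hN 2) (d := ⟨-(1 + √2), 0⟩)
      ((hN 6).trans ?_) fun x hx => ?_
    · change (⟨-(√2 / 2), √2 / 2⟩ : ℂ) = ⟨1 + √2 / 2, √2 / 2⟩ + ⟨-(1 + √2), 0⟩
      apply Complex.ext <;> simp; ring
    · obtain ⟨t, ht, rfl⟩ := seg_elim hx
      have h1 := f1 (1 + √2) ⟨circ_pos'.le, le_rfl⟩ t ht
      have h2 := f1 0 ⟨le_rfl, circ_pos'.le⟩ t ht
      have h3 := hg.per 0 ⟨0, t⟩ ht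
      have e : (⟨0, t⟩ : ℂ) + circ 0 = ⟨1 + √2, t⟩ := by apply Complex.ext <;> simp
      rw [e] at h3
      refine Eq.trans (congrArg F ?_) ((h1.trans (h3.trans h2.symm)).trans (congrArg F ?_))
      · apply Complex.ext <;> simp <;> ring
      · apply Complex.ext <;> simp <;> ring
  · refine compat_add (X := octagon.1) (F := fun _ => F) (s := octSide 3)
      (s' := octSide 7) rfl (hV 3) (hN 3) (d := -⟨1 + √2 / 2, 1 + √2 / 2⟩)
      ((hN 7).trans ?_) fun x hx => ?_
    · change (⟨0, 0⟩ : ℂ) = ⟨1 + √2 / 2, 1 + √2 / 2⟩ + -⟨1 + √2 / 2, 1 + √2 / 2⟩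
      apply Complex.ext <;> simp
    · obtain ⟨t, ht, rfl⟩ := seg_elim hx
      have e : (⟨-(t * (√2 / 2)), t * (√2 / 2)⟩ : ℂ) + circ 1 =
          ⟨2 + √2 - t * (√2 / 2), t * (√2 / 2)⟩ := by apply Complex.ext <;> simp; ring
      have h0 : 0 ≤ t * (√2 / 2) := mul_nonneg ht.1 (by linarith)
      have h0' : t * (√2 / 2) ≤ √2 / 2 := mul_le_of_le_one_left (by linarith) ht.2
      have h1 := hg.per 1 ⟨-(t * (√2 / 2)), t * (√2 / 2)⟩ ⟨h0, h0'⟩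
      rw [e] at h1
      have h2 := f0 ⟨-(t * (√2 / 2)), t * (√2 / 2)⟩ h0'
      have h3 := f2 ⟨2 + √2 - t * (√2 / 2), t * (√2 / 2)⟩ (mem_octHex_one.2 ⟨⟨h0, h0'⟩,
        by simp only; linarith, by simp only; linarith⟩)
      refine Eq.trans (congrArg F ?_) ((h3.trans (h1.trans h2.symm)).trans (congrArg F ?_))
      · apply Complex.ext <;> simp <;> ring
      · apply Complex.ext <;> simp <;> ring

end

/-- The two strips of the octagon. -/
def octSlab : ∀ j, Slab octagon.1 (ht j) (circ j) := Fin.cons octPar (Fin.cons octHex finZeroElim)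

/-- The two cylinders of the octagon: strip `1` is made of the lower and the upper trapezoid, strip `0`
is the rectangle between them, and both parameters vanish. -/
def octagonCyl : Cyl octagon.1 0 0 := by
  have hs := sqrt_two_bounds
  have hh : (0 : ℝ) < √2 / 2 := by linarith
  have hlow : ∀ u ∈ Icc (0 : ℝ) 1, octHex.G ⟨u, 0⟩ = octagon.1.pt (0 : Fin 1) ⟨u, 0⟩ := by
    intro u hu
    rw [octHex.G_eq_zero hh circ_pos (k := 0) two_pos (mem_octHex_zero.2 (by simpa using ⟨by linarith, hu⟩))]
    simp [octHex]
  have hlow' : ∀ u ∈ Icc (0 : ℝ) (1 + √2), octHex.G ⟨1 + u, 0⟩ =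
      octagon.1.pt (0 : Fin 1) ⟨u - √2 / 2, 1 + √2 / 2⟩ := by
    intro u hu
    rw [octHex.G_eq_zero hh circ_pos (k := 1) one_lt_two (mem_octHex_one.2 ⟨⟨le_rfl, hh.le⟩, by
      simpa using hu.1, by simp; linarith [hu.2]⟩)]
    refine congrArg (octagon.1.pt (0 : Fin 1)) ?_
    apply Complex.ext <;> simp [octHex]
  have hup : ∀ u ∈ Icc (0 : ℝ) 1, octHex.G ⟨1 + √2 / 2 + u, √2 / 2⟩ =
      octagon.1.pt (0 : Fin 1) ⟨u, 1 + √2⟩ := by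
    intro u hu
    rw [octHex.G_eq_zero hh circ_pos (k := 1) one_lt_two (mem_octHex_one.2 ⟨⟨hh.le, le_rfl⟩, by
      simpa using hu.1, by simp only; linarith [hu.2]⟩)]
    refine congrArg (octagon.1.pt (0 : Fin 1)) ?_
    apply Complex.ext <;> simp [octHex]; ring
  have hup' : ∀ u ∈ Icc (0 : ℝ) (1 + √2), octHex.G ⟨2 + √2 / 2 + u, √2 / 2⟩ =
      octagon.1.pt (0 : Fin 1) ⟨u - √2 / 2, √2 / 2⟩ := by
    intro u hu
    have e : (⟨2 + √2 / 2 + u, √2 / 2⟩ : ℂ) = ⟨u - √2 / 2, √2 / 2⟩ + (2 + √2 : ℝ) := by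
      rw [add_ofReal]; congr 1; ring
    rw [e, octHex.G_per hh circ_pos hh.le le_rfl,
      octHex.G_eq_zero hh circ_pos (k := 0) two_pos (mem_octHex_zero.2 ⟨⟨hh.le, le_rfl⟩, by
      simp only; linarith [hu.1], by simp only; linarith [hu.2]⟩)]
    refine congrArg (octagon.1.pt (0 : Fin 1)) ?_
    simp [octHex]
  have hpar : ∀ u ∈ Icc (0 : ℝ) (1 + √2), ∀ y ∈ Icc (0 : ℝ) 1, octPar.G ⟨u, y⟩ =
      octagon.1.pt (0 : Fin 1) ⟨u - √2 / 2, y + √2 / 2⟩ := by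
    intro u hu y hy
    rw [octPar.G_eq_zero one_pos circ_pos' (k := 0) one_pos (w := ⟨u, y⟩)
      (mem_octPar.2 ⟨hy, hu⟩)]
    refine congrArg (octagon.1.pt (0 : Fin 1)) ?_
    apply Complex.ext <;> simp [octPar, Slab.one]
  refine Cyl.ofSlabs octSlab ?_ ?_ ?_ ?_ ?_
  · intro u hu
    change octHex.G _ = octHex.G _
    rw [hup u hu, zero_add, hlow u hu]
    refine pt_glue_eq (X := octagon.1) (octSide 0) (s' := octSide 4) rfl ?_ ?_
    · rw [oct_vtx, oct_vtx_next]
      exact mem_hseg (Or.inl hu)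
    · rw [oct_vtx, oct_vtx_next]
      apply Complex.ext <;> simp
  · intro u hu
    change octHex.G _ = octPar.G _
    rw [zero_add, zero_add, hlow' u hu, hpar u hu 1 ⟨zero_le_one, le_rfl⟩]
  · intro u hu
    change octHex.G _ = octPar.G _
    rw [hup' u hu, hpar u hu 0 ⟨le_rfl, zero_le_one⟩, zero_add]
  · intro (i : Fin 1) x hx
    obtain rfl : i = 0 := Subsingleton.elim _ _
    have half : ∀ α β c : ℝ, (∀ k : Fin 8, α * (octagon.1.vtx (octSide k)).re +
        β * (octagon.1.vtx (octSide k)).im ≤ c) → α * x.re + β * x.im ≤ c := fun α β c h =>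
      oct_le α β c h hx
    simp only [oct_vtx] at half
    have b0 := half 0 (-1) 0 (by intro k; fin_cases k <;> simp <;> linarith)
    have b1 := half 1 (-1) 1 (by intro k; fin_cases k <;> simp <;> linarith)
    have b2 := half 1 0 (1 + √2 / 2) (by intro k; fin_cases k <;> simp <;> linarith)
    have b3 := half 1 1 (2 + √2) (by intro k; fin_cases k <;> simp <;> linarith)
    have b4 := half 0 1 (1 + √2) (by intro k; fin_cases k <;> simp <;> linarith)
    have b5 := half (-1) 1 (1 + √2) (by intro k; fin_cases k <;> simp <;> linarith)
    have b6 := half (-1) 0 (√2 / 2) (by intro k; fin_cases k <;> simp <;> linarith)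
    have b7 := half (-1) (-1) 0 (by intro k; fin_cases k <;> simp <;> linarith)
    rcases le_total x.im (√2 / 2) with h1 | h1
    · refine ⟨1, 0, two_pos, rfl, ?_⟩
      change x + 0 ∈ octHex.trap 0
      rw [add_zero, mem_octHex_zero]
      exact ⟨⟨by linarith, h1⟩, by linarith, by linarith⟩
    rcases le_total x.im (1 + √2 / 2) with h2 | h2
    · refine ⟨0, 0, one_pos, rfl, ?_⟩
      change x + ⟨√2 / 2, -(√2 / 2)⟩ ∈ octPar.trap 0
      rw [mem_octPar]
      simp
      exact ⟨⟨by linarith, by linarith⟩, by linarith, by linarith⟩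
    · refine ⟨1, 1, one_lt_two, rfl, ?_⟩
      change x + ⟨1 + √2 / 2, -(1 + √2 / 2)⟩ ∈ octHex.trap 1
      rw [mem_octHex_one]
      simp
      exact ⟨⟨by linarith, by linarith⟩, by linarith, by linarith⟩
  · intro T g hg
    obtain ⟨F, f0, f1, f2⟩ := exists_octagon_map hg
    refine ⟨fun _ => F, ?_, octagon_compat hg f0 f1 f2⟩
    intro j
    obtain rfl | rfl := fin_two j
    · intro k hk w hw
      obtain rfl : k = 0 := Nat.lt_one_iff.1 hk
      obtain ⟨h1, h2⟩ := mem_octPar.1 hw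
      refine Eq.trans (congrArg F ?_) (f1 w.re h2 w.im h1)
      change w - ⟨√2 / 2, -(√2 / 2)⟩ = _
      apply Complex.ext <;> simp
    · intro k hk w hw
      have hk : k < 2 := hk
      obtain rfl | rfl : k = 0 ∨ k = 1 := by omega
      · change F (w - 0) = _
        rw [sub_zero]
        exact f0 w (mem_octHex_zero.1 hw).1.2
      · exact f2 w hw

/-! ### Systoles -/

namespace Cyl

variable {Y Y' : Gluing} {q r q' r' : ℝ}

/-- `x` and `y` are the horizontal positions of a vertex on the lower and on the upper side of strip
`1`. -/
def Across (q x y : ℝ) : Prop :=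
  (x = q ∨ x = q + 1) ∧ ∃ k : ℤ, y = 1 + √2 / 2 + k * (2 + √2) ∨ y = 2 + √2 / 2 + k * (2 + √2)

/-- The image of the segment that crosses strip `1` from `x` to `y`. -/
def crossing (C : Cyl Y q r) (x y : ℝ) : Set Y.Pt :=
  (fun t : ℝ => C.G 1 (⟨x, 0⟩ + t * ⟨y - x, √2 / 2⟩)) '' Icc 0 1

lemma orb_iff_across {x : ℝ} (hx : x = q ∨ x = q + 1) {v : ℂ} (hv : v.im = √2 / 2) :
    (Orb 1 ⟨1 + √2 / 2, √2 / 2⟩ 1 (⟨x, 0⟩ + v) ∨ Orb 1 ⟨2 + √2 / 2, √2 / 2⟩ 1 (⟨x, 0⟩ + v)) ↔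
      Across q x (x + v.re) := by
  have e : (⟨x, 0⟩ : ℂ) + v = ⟨x + v.re, √2 / 2⟩ := by apply Complex.ext <;> simp [hv]
  rw [e, orb_mk, orb_mk, Across]
  simp only [true_and, hx, circ_one, ← exists_or, sub_eq_iff_eq_add']

lemma saddle_of_across (C : Cyl Y q r) {x y : ℝ} (h : Across q x y) :
    Y.IsSaddleConnection ⟨y - x, √2 / 2⟩ fun t => C.G 1 (⟨x, 0⟩ + t * ⟨y - x, √2 / 2⟩) := by
  refine C.exists_saddle h.1 rfl ((orb_iff_across h.1 rfl).2 ?_)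
  simpa using h

lemma across_of_short (C : Cyl Y q r) {v : ℂ} {c : ℝ → Y.Pt} (hc : Y.IsSaddleConnection v c)
    (h1 : ‖v‖ < 1) : ∃ x y, Across q x y ∧ ‖(⟨y - x, √2 / 2⟩ : ℂ)‖ = ‖v‖ ∧
      c '' Icc 0 1 = C.crossing x y := by
  obtain ⟨v', x, h2, h3, h4, h5, h6⟩ := C.saddle_short hc h1
  have e : v' = ⟨x + v'.re - x, √2 / 2⟩ := by apply Complex.ext <;> simp [h3]
  refine ⟨x, x + v'.re, (orb_iff_across h4 h3).1 h5, by rw [← e, h2], ?_⟩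
  rw [h6, crossing, ← e]

lemma norm_mk (a : ℝ) : ‖(⟨a, √2 / 2⟩ : ℂ)‖ = √(a ^ 2 + 1 / 2) := by
  rw [Complex.norm_def, Complex.normSq_mk]
  congr 1
  have := sqrt_two_sq
  nlinarith

lemma norm_mk_le {a b : ℝ} : ‖(⟨a, √2 / 2⟩ : ℂ)‖ ≤ ‖(⟨b, √2 / 2⟩ : ℂ)‖ ↔ |a| ≤ |b| := by
  rw [norm_mk, norm_mk, Real.sqrt_le_sqrt_iff (by positivity), add_le_add_iff_right, sq_le_sq]

lemma norm_mk_lt {a : ℝ} : ‖(⟨a, √2 / 2⟩ : ℂ)‖ < 1 ↔ |a| < √2 / 2 := by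
  rw [norm_mk, Real.sqrt_lt' one_pos, ← abs_of_pos (show 0 < √2 / 2 by positivity), ← sq_lt_sq]
  have := sqrt_two_sq
  constructor <;> intro h <;> nlinarith

/-- When the surface has a saddle connection of length less than `1`, its systoles are the shortest
segments that cross strip `1` from vertex to vertex. -/
lemma systoles_eq (C : Cyl Y q r) {d : ℝ} (hd : d < √2 / 2) {S : Set (Set Y.Pt)} (hS : S.Nonempty)
    (h : ∀ x y, Across q x y → |y - x| < √2 / 2 → d ≤ |y - x| ∧ (|y - x| = d → C.crossing x y ∈ S))
    (h' : ∀ T ∈ S, ∃ x y, Across q x y ∧ |y - x| = d ∧ T = C.crossing x y) : Y.systoles = S := by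
  have hex : ∀ T ∈ S, ∃ v c, Y.IsSaddleConnection v c ∧ T = c '' Icc 0 1 ∧
      ∃ a : ℝ, v = ⟨a, √2 / 2⟩ ∧ |a| = d := by
    intro T hT
    obtain ⟨x, y, h1, h2, h3⟩ := h' T hT
    exact ⟨_, _, C.saddle_of_across h1, h3, _, rfl, h2⟩
  ext T
  constructor
  · rintro ⟨v, c, hc, rfl, hm⟩
    obtain ⟨T₀, hT₀⟩ := hS
    obtain ⟨v₀, c₀, hc₀, -, a, rfl, ha⟩ := hex T₀ hT₀
    have hv := hm _ _ hc₀
    have hv1 : ‖v‖ < 1 := hv.trans_lt (norm_mk_lt.2 (ha ▸ hd))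
    obtain ⟨x, y, h1, h2, h3⟩ := C.across_of_short hc hv1
    rw [← h2] at hv hv1
    obtain ⟨h4, h5⟩ := h x y h1 (norm_mk_lt.1 hv1)
    rw [h3]
    exact h5 (le_antisymm (ha ▸ norm_mk_le.1 hv) h4)
  · intro hT
    obtain ⟨v, c, hc, rfl, a, rfl, ha⟩ := hex T hT
    refine ⟨_, c, hc, rfl, fun v' c' hc' => ?_⟩
    rcases lt_or_ge ‖v'‖ 1 with h1 | h1
    · obtain ⟨x, y, h2, h3, -⟩ := C.across_of_short hc' h1
      rw [← h3] at h1 ⊢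
      rw [norm_mk_le, ha]
      exact (h x y h2 (norm_mk_lt.1 h1)).1
    · exact (norm_mk_lt.2 (ha ▸ hd)).le.trans h1

lemma crossing_ne (C : Cyl Y q r) {x y x' y' : ℝ}
    (h : ∀ k : ℤ, x' + y' ≠ x + y + k * (2 * (2 + √2))) : C.crossing x y ≠ C.crossing x' y' := by
  intro he
  have hs := sqrt_two_bounds
  have hm : C.G 1 (⟨x, 0⟩ + ((1 / 2 : ℝ) : ℂ) * ⟨y - x, √2 / 2⟩) ∈ C.crossing x' y' :=
    he ▸ ⟨1 / 2, ⟨by norm_num, by norm_num⟩, rfl⟩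
  obtain ⟨t, ht, h1⟩ := hm
  have e1 : ∀ (x a t : ℝ), (⟨x, 0⟩ + (t : ℂ) * ⟨a, √2 / 2⟩ : ℂ) = ⟨x + t * a, t * (√2 / 2)⟩ :=
    fun x a t => by apply Complex.ext <;> simp
  simp only [e1] at h1
  have hst : (⟨x' + t * (y' - x'), t * (√2 / 2)⟩ : ℂ) ∈ strip 1 :=
    ⟨by simp only; nlinarith [ht.1], by simp only [ht_one]; nlinarith [ht.2]⟩
  obtain ⟨-, h3, k, hk⟩ := orb_mk.1 (C.interior_orb (j := 1) (w := ⟨x + 1 / 2 * (y - x), 1 / 2 * (√2 / 2)⟩)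
    (by simp) (by simp only [ht_one]; linarith) hst h1.symm)
  have ht2 : t = 1 / 2 := mul_right_cancel₀ (b := √2 / 2) (by positivity) h3
  refine h k ?_
  rw [ht2, circ_one] at hk
  linarith

end Cyl

lemma mem_trapezoid_bot {h L a b x : ℝ} (hh : 0 < h) (h0 : a ≤ x) (h1 : x ≤ a + L) :
    (⟨x, 0⟩ : ℂ) ∈ trapezoid h L a b := ⟨⟨le_rfl, hh.le⟩, by simpa using h0, by simpa using h1⟩

lemma mem_trapezoid_top {h L a b x : ℝ} (hh : 0 < h) (h0 : b ≤ x) (h1 : x ≤ b + L) :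
    (⟨x, h⟩ : ℂ) ∈ trapezoid h L a b := by
  have : h / h = 1 := div_self hh.ne'
  refine ⟨⟨hh.le, le_rfl⟩, ?_, ?_⟩ <;> simp only [this] <;> linarith

/-- A chord of the hexagon as a segment that crosses strip `1`. -/
lemma chord_eq_crossing {q r x y : ℝ} (k l : Fin 6) (hk : (⟨x, 0⟩ : ℂ) = figVtx q r (hexSide k))
    (hl : (⟨y, √2 / 2⟩ : ℂ) = figVtx q r (hexSide l)) (h1 : q ≤ x) (h2 : x ≤ q + (2 + √2))
    (h3 : 1 + √2 / 2 ≤ y) (h4 : y ≤ 1 + √2 / 2 + (2 + √2)) :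
    (fig q r).1.chord (1 : Fin 2) (x : ℂ) ⟨y, √2 / 2⟩ = (figCyl q r).crossing x y := by
  have hs : 0 < √2 / 2 := by positivity
  have hx : (x : ℂ) = ⟨x, 0⟩ := rfl
  rw [hx, chord_eq _ _ (fig_mem_hex k hk) (fig_mem_hex l hl), Cyl.crossing]
  refine image_congr fun t ht => ?_
  have e : (⟨y, √2 / 2⟩ - ⟨x, 0⟩ : ℂ) = ⟨y - x, √2 / 2⟩ := by apply Complex.ext <;> simp
  rw [e, figCyl_hex]
  refine (convex_trapezoid _ _ _ _).segment_subset (mem_trapezoid_bot hs h1 h2)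
    (mem_trapezoid_top hs h3 h4) ?_
  rw [segment_eq_image']
  exact ⟨t, ht, by simp [e]⟩

section

variable (n : ℤ)

lemma segQB_eq : segQB n = (figCyl (posP (n - 1)) (posP' n)).crossing (posP (n - 1)) (1 + √2 / 2) :=
  chord_eq_crossing 0 5 rfl rfl le_rfl (by linarith [circ_pos]) le_rfl (by linarith [circ_pos])

lemma segQC_eq : segQC n = (figCyl (posP (n - 1)) (posP' n)).crossing (posP (n - 1)) (2 + √2 / 2) :=
  chord_eq_crossing 0 4 rfl rfl le_rfl (by linarith [circ_pos]) (by linarith)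
    (by linarith [circ_pos'])

lemma segPB_eq : segPB n =
    (figCyl (posP (n - 1)) (posP' n)).crossing (posP (n - 1) + 1) (1 + √2 / 2) :=
  chord_eq_crossing 1 5 rfl rfl (by linarith) (by linarith [circ_pos']) le_rfl
    (by linarith [circ_pos])

lemma segPC_eq : segPC n =
    (figCyl (posP (n - 1)) (posP' n)).crossing (posP (n - 1) + 1) (2 + √2 / 2) :=
  chord_eq_crossing 1 4 rfl rfl (by linarith) (by linarith [circ_pos']) (by linarith)
    (by linarith [circ_pos'])

lemma posP_eq {n k : ℤ} (h0 : 0 ≤ (n + 1 : ℝ) - k * (2 + √2))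
    (h1 : (n + 1 : ℝ) - k * (2 + √2) < 2 + √2) : posP n = n + 1 - k * (2 + √2) := by
  have := toIcoMod_sub_zsmul circ_pos 0 (n + 1 : ℝ) k
  rw [posP, ← this, zsmul_eq_mul]
  exact (toIcoMod_eq_self circ_pos).2 ⟨h0, by simpa using h1⟩

lemma posP_zero : posP 0 = 1 := by
  have := sqrt_two_bounds
  rw [posP_eq (k := 0)] <;> norm_num; linarith

lemma posP_one : posP 1 = 2 := by
  have := sqrt_two_bounds
  rw [posP_eq (k := 0)] <;> norm_num

lemma posP_two : posP 2 = 3 := by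
  have := sqrt_two_bounds
  rw [posP_eq (k := 0)] <;> norm_num; linarith

lemma posP_three : posP 3 = 2 - √2 := by
  have := sqrt_two_bounds
  rw [posP_eq (k := 1)] <;> norm_num <;> linarith

end

/-- Segments of length less than `1` that cross strip `1` stay in the hexagon when its lower side is not
too far away. -/
lemma across_cases {q x y : ℝ} (hq : 1 ≤ q) (hq' : q ≤ 3) (h : Cyl.Across q x y)
    (hxy : |y - x| < √2 / 2) : (x = q ∨ x = q + 1) ∧ (y = 1 + √2 / 2 ∨ y = 2 + √2 / 2) := by
  have hs := sqrt_two_bounds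
  obtain ⟨hx, k, hk⟩ := h
  refine ⟨hx, ?_⟩
  obtain ⟨h1, h2⟩ := abs_lt.1 hxy
  have hk0 : k = 0 := by
    have a1 : (k : ℝ) < 1 := by
      by_contra! hc
      have : (2 + √2) ≤ k * (2 + √2) := le_mul_of_one_le_left circ_pos.le hc
      rcases hx with rfl | rfl <;> rcases hk with rfl | rfl <;> linarith
    have a2 : (-1 : ℝ) < k := by
      by_contra! hc
      have : k * (2 + √2) ≤ -1 * (2 + √2) := mul_le_mul_of_nonneg_right hc circ_pos.le
      rcases hx with rfl | rfl <;> rcases hk with rfl | rfl <;> linarith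
    have a1' : k < 1 := by exact_mod_cast a1
    have a2' : -1 < k := by exact_mod_cast a2
    omega
  subst hk0
  simpa using hk

lemma across_B (q x : ℝ) (hx : x = q ∨ x = q + 1) : Cyl.Across q x (1 + √2 / 2) :=
  ⟨hx, 0, Or.inl (by simp)⟩

lemma across_C (q x : ℝ) (hx : x = q ∨ x = q + 1) : Cyl.Across q x (2 + √2 / 2) :=
  ⟨hx, 0, Or.inr (by simp)⟩

section

variable {q r : ℝ}

lemma systoles_of_eq_one (hq : q = 1) :
    (fig q r).1.systoles = {(figCyl q r).crossing (q + 1) (1 + √2 / 2)} := by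
  have hs := sqrt_two_bounds
  refine (figCyl q r).systoles_eq (d := 1 - √2 / 2) (by linarith) (singleton_nonempty _) ?_ ?_
  · intro x y h h1
    obtain ⟨hx, hy⟩ := across_cases hq.ge (by linarith) h h1
    obtain ⟨h2, h3⟩ := abs_lt.1 h1
    rcases hx with rfl | rfl <;> rcases hy with rfl | rfl
    · linarith
    · linarith
    · rw [abs_of_neg (by linarith)]
      exact ⟨by linarith, fun _ => rfl⟩
    · linarith
  · rintro T rfl
    refine ⟨_, _, across_B _ _ (Or.inr rfl), ?_, rfl⟩
    rw [abs_of_neg (by linarith)]; linarith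

lemma systoles_of_eq_two (hq : q = 2) : (fig q r).1.systoles =
    {(figCyl q r).crossing q (1 + √2 / 2), (figCyl q r).crossing (q + 1) (2 + √2 / 2)} := by
  have hs := sqrt_two_bounds
  refine (figCyl q r).systoles_eq (d := 1 - √2 / 2) (by linarith) (insert_nonempty _ _) ?_ ?_
  · intro x y h h1
    obtain ⟨hx, hy⟩ := across_cases (by linarith) (by linarith) h h1
    obtain ⟨h2, h3⟩ := abs_lt.1 h1
    rcases hx with rfl | rfl <;> rcases hy with rfl | rfl
    · rw [abs_of_neg (by linarith)]
      exact ⟨by linarith, fun _ => Or.inl rfl⟩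
    · linarith
    · linarith
    · rw [abs_of_neg (by linarith)]
      exact ⟨by linarith, fun _ => Or.inr rfl⟩
  · rintro T (rfl | rfl)
    · refine ⟨_, _, across_B _ _ (Or.inl rfl), ?_, rfl⟩
      rw [abs_of_neg (by linarith)]; linarith
    · refine ⟨_, _, across_C _ _ (Or.inr rfl), ?_, rfl⟩
      rw [abs_of_neg (by linarith)]; linarith

lemma systoles_of_eq_three (hq : q = 3) :
    (fig q r).1.systoles = {(figCyl q r).crossing q (2 + √2 / 2)} := by
  have hs := sqrt_two_bounds
  refine (figCyl q r).systoles_eq (d := 1 - √2 / 2) (by linarith) (singleton_nonempty _) ?_ ?_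
  · intro x y h h1
    obtain ⟨hx, hy⟩ := across_cases (by linarith) hq.le h h1
    obtain ⟨h2, h3⟩ := abs_lt.1 h1
    rcases hx with rfl | rfl <;> rcases hy with rfl | rfl
    · linarith
    · rw [abs_of_neg (by linarith)]
      exact ⟨by linarith, fun _ => rfl⟩
    · linarith
    · linarith
  · rintro T rfl
    refine ⟨_, _, across_C _ _ (Or.inl rfl), ?_, rfl⟩
    rw [abs_of_neg (by linarith)]; linarith

end

lemma exists_systole_PB : ∃ n : ℤ, posP n ∈ Ioo 1 (1 + (1 + √2) / 2) ∧
    (Oct n).1.systoles = {segPB n} := by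
  have hs := sqrt_two_bounds
  refine ⟨1, by rw [posP_one]; constructor <;> linarith, ?_⟩
  rw [segPB_eq]
  exact systoles_of_eq_one posP_zero

lemma exists_systole_QB_PC : ∃ n : ℤ, posP n ∈ Ioo (1 + (1 + √2) / 2) (2 + (1 + √2) / 2) ∧
    segQB n ≠ segPC n ∧ (Oct n).1.systoles = {segQB n, segPC n} := by
  have hs := sqrt_two_bounds
  refine ⟨2, by rw [posP_two]; constructor <;> linarith, ?_⟩
  rw [segQB_eq, segPC_eq]
  refine ⟨Cyl.crossing_ne _ fun k hk => ?_, systoles_of_eq_two posP_one⟩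
  have h1 : (k : ℝ) * (2 + √2) = 1 := by linarith
  have h2 : (0 : ℝ) < k := by by_contra! h; nlinarith
  have h3 : (1 : ℝ) ≤ k := by exact_mod_cast (by exact_mod_cast h2 : (0 : ℤ) < k)
  nlinarith

lemma exists_systole_QC : ∃ n : ℤ, posP n ∈ Ioo 0 1 ∪ Ioo (2 + (1 + √2) / 2) (2 + √2) ∧
    (Oct n).1.systoles = {segQC n} := by
  have hs := sqrt_two_bounds
  refine ⟨3, Or.inl (by rw [posP_three]; constructor <;> linarith), ?_⟩
  rw [segQC_eq]
  exact systoles_of_eq_three posP_two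

/-! ### The family of surfaces -/

lemma oct_zero : (Oct 0).cls = octagon.cls :=
  Quotient.sound (((octCyl 0).cast Int.cast_zero Int.cast_zero).iso octagonCyl)

lemma isoperiodic_octagon (n : ℕ) : octagon.1.Isoperiodic (Oct n).1 := by
  induction n with
  | zero => exact Iso.isoperiodic (Quotient.exact oct_zero.symm)
  | succ n ih =>
    exact ih.trans ((octCyl n).isoperiodic_add_one
      ((octCyl (n + 1 : ℕ)).cast (by push_cast; rfl) (by push_cast; rfl)))

lemma irrational_circ : Irrational (2 + √2) := by
  exact_mod_cast irrational_sqrt_two.natCast_add 2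

lemma dense_posP : DenseRange (fun n : ℤ => (posP n : AddCircle (2 + √2))) := by
  have h : DenseRange (· • ((1 : ℝ) : AddCircle (2 + √2)) : ℤ → AddCircle (2 + √2)) := by
    rw [AddCircle.denseRange_zsmul_coe_iff, one_div]
    exact irrational_circ.inv
  have e : (fun n : ℤ => (posP n : AddCircle (2 + √2))) =
      (· • ((1 : ℝ) : AddCircle (2 + √2))) ∘ fun n : ℤ => n + 1 := by
    funext n
    have h1 := toIcoMod_add_toIcoDiv_zsmul circ_pos 0 (n + 1 : ℝ)
    have h2 : (posP n : AddCircle (2 + √2)) = ((n + 1 : ℝ) : AddCircle (2 + √2)) := by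
      rw [← h1, posP, AddCircle.coe_add, AddCircle.coe_zsmul, AddCircle.coe_period, smul_zero,
        add_zero]
    rw [h2, Function.comp, ← AddCircle.coe_zsmul]
    congr 1
    simp
  rw [e]
  exact h.comp (Function.Surjective.denseRange fun n => ⟨n - 1, by simp⟩) continuous_of_discreteTopology

/-! ### The surfaces of the family are distinguished by their short saddle connections -/

/-- The real parts of the saddle connections of length less than `1` that point upwards. -/
def shortRe (Y : Gluing) : Set ℝ :=
  {a | |a| < √2 / 2 ∧ ∃ c, Y.IsSaddleConnection ⟨a, √2 / 2⟩ c}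

lemma shortRe_congr {X Y : Gluing} (h : Iso X Y) : shortRe X = shortRe Y := by
  have key : ∀ {X Y : Gluing}, Iso X Y → shortRe X ⊆ shortRe Y := by
    rintro X Y ⟨f, hf⟩ a ⟨h1, c, hc⟩
    exact ⟨h1, _, IsTranslation.saddle hf hc⟩
  exact (key h).antisymm (key h.symm)

namespace Cyl

variable {Y Y' : Gluing} {q r q' r' : ℝ}

/-- The short upward saddle connections lead from one of `q`, `q + 1` to one of the points `B`, `C`,
modulo the period. -/
lemma mem_shortRe (C : Cyl Y q r) {a : ℝ} : a ∈ shortRe Y ↔ |a| < √2 / 2 ∧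
    ∃ d k : ℤ, |d| ≤ 1 ∧ a = 1 + √2 / 2 - q + d + k * (2 + √2) := by
  have hs := sqrt_two_bounds
  constructor
  · rintro ⟨h1, c, hc⟩
    refine ⟨h1, ?_⟩
    obtain ⟨-, x, hx, ho, -⟩ := C.saddle_up hc (by simp only; positivity) (by simp only; linarith)
    obtain ⟨-, k, hk⟩ := (orb_iff_across hx rfl).1 ho
    simp only at hk
    rcases hx with rfl | rfl <;> rcases hk with hk | hk
    · exact ⟨0, k, by simp, by push_cast; linarith⟩
    · exact ⟨1, k, by simp, by push_cast; linarith⟩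
    · exact ⟨-1, k, by simp, by push_cast; linarith⟩
    · exact ⟨0, k, by simp, by push_cast; linarith⟩
  · rintro ⟨h1, d, k, hd, ha⟩
    refine ⟨h1, ?_⟩
    obtain ⟨x, y, h, rfl⟩ : ∃ x y, Across q x y ∧ a = y - x := by
      have : d = -1 ∨ d = 0 ∨ d = 1 := by rw [abs_le] at hd; omega
      rcases this with rfl | rfl | rfl <;> push_cast at ha
      · exact ⟨q + 1, _, ⟨Or.inr rfl, k, Or.inl rfl⟩, by linarith⟩
      · exact ⟨q, _, ⟨Or.inl rfl, k, Or.inl rfl⟩, by linarith⟩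
      · exact ⟨q, _, ⟨Or.inl rfl, k, Or.inr rfl⟩, by linarith⟩
    exact ⟨_, C.saddle_of_across h⟩

lemma shortRe_nonempty (C : Cyl Y q r) (hq : ∀ k : ℤ, q ≠ k * (2 + √2)) : (shortRe Y).Nonempty := by
  have hs := sqrt_two_bounds
  obtain ⟨k, u, h0, h1, h2⟩ := exists_residue q 0 circ_pos
  have hu : 0 < u := h0.lt_of_ne fun h => hq k (by rw [← h2, ← h]; ring)
  rcases lt_or_ge u √2 with h | h
  · refine ⟨√2 / 2 - u, C.mem_shortRe.2 ⟨abs_lt.2 ⟨by linarith, by linarith⟩, -1, k, by simp, ?_⟩⟩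
    push_cast; linarith
  rcases lt_or_ge u (1 + √2) with h' | h'
  · refine ⟨1 + √2 / 2 - u, C.mem_shortRe.2 ⟨abs_lt.2 ⟨by linarith, by linarith⟩, 0, k, by simp, ?_⟩⟩
    push_cast; linarith
  · refine ⟨2 + √2 / 2 - u, C.mem_shortRe.2 ⟨abs_lt.2 ⟨by linarith, by linarith⟩, 1, k, by simp, ?_⟩⟩
    push_cast; linarith

/-- The octagon has no saddle connections of length less than `1`. -/
lemma shortRe_empty (C : Cyl Y 0 r) : shortRe Y = ∅ := by
  have hs := sqrt_two_bounds
  refine eq_empty_of_forall_notMem fun a ha => ?_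
  obtain ⟨h1, d, k, hd, rfl⟩ := C.mem_shortRe.1 ha
  obtain ⟨h2, h3⟩ := abs_lt.1 h1
  have hd' : (-1 : ℝ) ≤ d ∧ (d : ℝ) ≤ 1 := by
    obtain ⟨a, b⟩ := abs_le.1 hd
    exact ⟨by exact_mod_cast a, by exact_mod_cast b⟩
  have hk : k = 0 ∨ k = -1 := by
    have a1 : (k : ℝ) < 1 := by by_contra! hc; nlinarith
    have a2 : (-2 : ℝ) < k := by by_contra! hc; nlinarith
    have a1' : k < 1 := by exact_mod_cast a1
    have a2' : -2 < k := by exact_mod_cast a2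
    omega
  rcases hk with rfl | rfl <;> push_cast at h2 h3 <;> linarith [hd'.1, hd'.2]

/-- A small shift of the lower side of strip `1` changes the surface. -/
lemma exists_not_iso (C : Cyl Y q r) : ∃ ε > 0, ∀ (Y' : Gluing) (δ r' : ℝ), 0 < |δ| → |δ| < ε →
    Nonempty (Cyl Y' (q + δ) r') → ¬ Iso Y Y' := by
  have hs := sqrt_two_bounds
  by_cases hne : (shortRe Y).Nonempty
  · obtain ⟨a, ha⟩ := hne
    obtain ⟨h1, d, k, hd, hk⟩ := C.mem_shortRe.1 ha
    refine ⟨min (1 / 4) (√2 / 2 - |a|), lt_min (by norm_num) (by linarith), ?_⟩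
    rintro Y' δ r' h0 hδ ⟨C'⟩ hi
    obtain ⟨hδ1, hδ2⟩ := lt_min_iff.1 hδ
    have hb : a - δ ∈ shortRe Y := by
      rw [shortRe_congr hi, C'.mem_shortRe]
      exact ⟨by linarith [abs_sub a δ], d, k, hd, by rw [hk]; ring⟩
    obtain ⟨-, d', k', hd', hk'⟩ := C.mem_shortRe.1 hb
    -- both shifts are integral combinations of `1` and `2 + √2`, and the small ones vanish
    have e : δ = ((d - d' : ℤ) : ℝ) + ((k - k' : ℤ) : ℝ) * (2 + √2) := by push_cast; linarith
    have hm : |d - d'| ≤ 2 := by rw [abs_le] at hd hd' ⊢; omega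
    generalize d - d' = m at e hm
    generalize k - k' = l at e
    obtain ⟨h3, h4⟩ := abs_lt.1 hδ1
    have hm' : (-2 : ℝ) ≤ m ∧ (m : ℝ) ≤ 2 := by
      obtain ⟨a, b⟩ := abs_le.1 hm
      exact ⟨by exact_mod_cast a, by exact_mod_cast b⟩
    have hl : l = 0 := by
      have a1 : (l : ℝ) < 1 := by by_contra! hc; nlinarith
      have a2 : (-1 : ℝ) < l := by by_contra! hc; nlinarith
      have a1' : l < 1 := by exact_mod_cast a1
      have a2' : -1 < l := by exact_mod_cast a2
      omega
    subst hl
    simp only [Int.cast_zero, zero_mul, add_zero] at e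
    have hm0 : m = 0 := by
      have a1 : (m : ℝ) < 1 := by linarith
      have a2 : (-1 : ℝ) < m := by linarith
      have a1' : m < 1 := by exact_mod_cast a1
      have a2' : -1 < m := by exact_mod_cast a2
      omega
    rw [e, hm0] at h0
    simp at h0
  · refine ⟨1, one_pos, ?_⟩
    rintro Y' δ r' h0 hδ ⟨C'⟩ hi
    refine hne (shortRe_congr hi ▸ C'.shortRe_nonempty fun k hk => ?_)
    -- the parameter of a surface without short saddle connections is a multiple of the period
    have hq : ∃ k : ℤ, q = k * (2 + √2) := by
      by_contra! hq
      exact hne (C.shortRe_nonempty hq)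
    obtain ⟨l, hl⟩ := hq
    have e : δ = ((k - l : ℤ) : ℝ) * (2 + √2) := by push_cast; linarith
    obtain ⟨h3, h4⟩ := abs_lt.1 hδ
    generalize k - l = m at e
    have hm0 : m = 0 := by
      have a1 : (m : ℝ) < 1 := by by_contra! hc; nlinarith
      have a2 : (-1 : ℝ) < m := by by_contra! hc; nlinarith
      have a1' : m < 1 := by exact_mod_cast a1
      have a2' : -1 < m := by exact_mod_cast a2
      omega
    rw [e, hm0] at h0
    simp at h0

end Cyl

/-- For `n > 0` the surface has a saddle connection of length less than `1`, unlike the octagon, since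
`n` is not a multiple of `2 + √2`. -/
lemma isFake_oct {n : ℕ} (hn : n ≠ 0) : Gluing.IsFake octagon.1 (Oct n).1 := by
  refine ⟨fun h => ?_, isoperiodic_octagon n, (octCyl n).existsUnique_singular⟩
  have h1 := (octCyl n).shortRe_nonempty fun k hk => by
    have hk0 : k ≠ 0 := by
      rintro rfl
      simp at hk
      exact hn hk
    have := (irrational_circ.intCast_mul hk0)
    rw [← hk] at this
    exact this ⟨n, by simp⟩
  rw [← shortRe_congr h, octagonCyl.shortRe_empty] at h1
  exact not_nonempty_empty h1

/-! ### Recurrence -/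

/-- The period coordinates of `fig q r` depend continuously on the parameters. -/
lemma continuous_fig : Continuous fun p : ℝ × ℝ => fig p.1 p.2 := by
  refine Continuous.subtype_mk ?_ _
  refine continuous_sigmaMk.comp (g := Sigma.mk (β := fun c : Pattern =>
    {V : c.Side → ℂ // Admissible c V}) figPattern)
    (f := fun p : ℝ × ℝ => ⟨figVtx p.1 p.2, fig_admissible p.1 p.2⟩) ?_
  refine Continuous.subtype_mk (continuous_pi fun s => ?_) _
  have hm : ∀ f g : ℝ × ℝ → ℝ, Continuous f → Continuous g →
      Continuous fun p => (⟨f p, g p⟩ : ℂ) := fun f g hf hg =>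
    Complex.equivRealProdCLM.symm.continuous.comp (hf.prodMk hg)
  obtain ⟨i, k⟩ := s
  obtain rfl | rfl := fin_two i
  · change Fin 4 at k
    change Continuous fun p : ℝ × ℝ => figVtx p.1 p.2 (parSide k)
    simp only [figVtx_par]
    fin_cases k
    · exact continuous_const
    · exact continuous_const
    · exact continuous_const.add (hm _ _ (by fun_prop) (by fun_prop))
    · exact continuous_const.add (hm _ _ (by fun_prop) (by fun_prop))
  · change Fin 6 at k
    change Continuous fun p : ℝ × ℝ => figVtx p.1 p.2 (hexSide k)
    simp only [figVtx_hex]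
    fin_cases k
    · exact hm _ _ (by fun_prop) (by fun_prop)
    · exact hm _ _ (by fun_prop) (by fun_prop)
    · exact hm _ _ (by fun_prop) (by fun_prop)
    · exact continuous_const
    · exact continuous_const
    · exact continuous_const

/-- Large integers that are close to multiples of `2 + √2` and of `1 + √2`. -/
lemma exists_almost_period (K : ℕ) {ε : ℝ} (hε : 0 < ε) : ∃ (N k l : ℤ) (δ δ' : ℝ), (K : ℤ) < N ∧
    0 < |δ| ∧ |δ| < ε ∧ |δ'| < ε ∧ (N : ℝ) = δ + k * (2 + √2) ∧ (N : ℝ) = δ' + l * (1 + √2) := by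
  have hs := sqrt_two_bounds
  -- `M * √2 - j = η` is small, and `N = 2 * M = M * (2 - √2) * (2 + √2) = M * (2 * √2 - 2) * (1 + √2)`;
  -- the factor `K + 1` makes `N` exceed `K`
  obtain ⟨n, hn⟩ := exists_nat_gt (8 * (K + 1 : ℝ) / ε)
  have hn' : 8 * (K + 1 : ℝ) < n * ε := by rwa [div_lt_iff₀ hε] at hn
  have hn0 : 0 < n := by
    rcases Nat.eq_zero_or_pos n with rfl | h
    · exfalso
      have : (0 : ℝ) ≤ K := Nat.cast_nonneg K
      simp at hn'; linarith
    · exact h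
  obtain ⟨j, M, hM0, hM1, hM2⟩ := Real.exists_int_int_abs_mul_sub_le √2 hn0
  set η := M * √2 - j with hη
  have hη0 : η ≠ 0 := by
    have := (irrational_sqrt_two.intCast_mul hM0.ne').sub_intCast j
    exact this.ne_zero
  have hK : (0 : ℝ) < K + 1 := by positivity
  have hsmall : (K + 1) * |η| * 8 < ε := by
    have h1 : |η| * (n + 1) ≤ 1 := by
      rwa [le_div_iff₀ (by positivity)] at hM2
    have h2 : |η| * n ≤ 1 := by nlinarith [abs_nonneg η]
    have hn1 : (0 : ℝ) < n := by exact_mod_cast hn0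
    have h3 : (K + 1) * |η| * 8 * n ≤ 8 * (K + 1) := by nlinarith
    by_contra! hc
    nlinarith
  refine ⟨2 * ((K + 1) * M), (K + 1) * (2 * M - j), (K + 1) * (2 * j - 2 * M),
    -((K + 1) * η * (2 + √2)), (K + 1) * η * (2 * (1 + √2)), ?_, ?_, ?_, ?_, ?_, ?_⟩
  · nlinarith
  · rw [abs_neg, abs_pos]
    positivity
  · rw [abs_neg, abs_mul, abs_mul, abs_of_pos hK, abs_of_pos circ_pos]
    nlinarith [mul_nonneg hK.le (abs_nonneg η)]
  · rw [abs_mul, abs_mul, abs_of_pos hK, abs_of_pos (show 0 < 2 * (1 + √2) by positivity)]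
    nlinarith [mul_nonneg hK.le (abs_nonneg η)]
  · rw [hη]; push_cast
    linear_combination ((K + 1 : ℝ) * M) * sqrt_two_sq
  · rw [hη]; push_cast
    linear_combination (-2 * (K + 1 : ℝ) * M) * sqrt_two_sq

/-- Replacing `m` by `m + N` for an almost period `N` changes both parameters only slightly modulo the
circumferences; the change of the first one does not vanish, so the surface is a different one. -/
lemma exists_fake (m : ℤ) {U : Set Moduli} (hU : U ∈ 𝓝 (Oct m).cls) : ∃ n : ℤ, n ≠ m ∧
    (Oct n).cls ≠ (Oct m).cls ∧ Gluing.IsFake octagon.1 (Oct n).1 ∧ (Oct n).cls ∈ U := by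
  have hc : Continuous fun p : ℝ × ℝ => (fig p.1 p.2).cls := continuous_quot_mk.comp continuous_fig
  have hU' := hc.continuousAt (x := (posP (m - 1), posP' m)) hU
  obtain ⟨ε, hε, hb⟩ := Metric.mem_nhds_iff.1 (mem_map.1 hU')
  obtain ⟨ε', hε', hiso⟩ := (octCyl m).exists_not_iso
  obtain ⟨N, k, l, δ, δ', hN, h0, h1, h2, h3, h4⟩ := exists_almost_period m.natAbs (lt_min hε hε')
  obtain ⟨n, hn⟩ : ∃ n : ℕ, m + N = n := Int.eq_ofNat_of_zero_le (by omega)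
  have hn0 : n ≠ 0 := by omega
  have hmN : ((m + N : ℤ) : ℝ) = m + δ + k * (2 + √2) := by push_cast; linarith
  have hmN' : ((m + N : ℤ) : ℝ) = m + δ' + l * (1 + √2) := by push_cast; linarith
  refine ⟨m + N, by omega, ?_, hn ▸ isFake_oct hn0, ?_⟩
  · intro h
    refine hiso _ δ _ h0 (h1.trans_le (min_le_right _ _))
      ⟨((octCyl (m + N)).shift (-k) 0).cast (by rw [hmN]; push_cast; ring) rfl⟩ (Quotient.exact h.symm)
  · have e : (Oct (m + N)).cls = (fig (posP (m - 1) + δ) (posP' m + δ')).cls := by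
      refine Quotient.sound ((octCyl (m + N)).iso ?_)
      refine ((figCyl (posP (m - 1) + δ) (posP' m + δ')).shift (toIcoDiv circ_pos 0 (m : ℝ) + k)
        (toIcoDiv circ_pos' 0 (m : ℝ) + l)).cast ?_ ?_
      · rw [hmN]; push_cast; linarith [posP_pred m]
      · rw [hmN']; push_cast; linarith [posP'_eq m]
    rw [e]
    refine @hb (posP (m - 1) + δ, posP' m + δ') ?_
    rw [Metric.mem_ball, Prod.dist_eq, max_lt_iff, Real.dist_eq, Real.dist_eq]
    simp only [add_sub_cancel_left]
    exact ⟨h1.trans_le (min_le_left _ _), h2.trans_le (min_le_left _ _)⟩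

end TranslationSurface

end

theorem mainTheorem2 :
    -- `Oct n` is obtained from the octagon by `n` left surgeries (right surgeries for `n < 0`)
    ((Oct 0).cls = octagon.cls ∧
      (∀ n : ℤ, 0 ≤ n → Gluing.LeftSurgery (Oct n).1 (Oct (n + 1)).1) ∧
      (∀ n : ℤ, n ≤ 0 → Gluing.RightSurgery (Oct n).1 (Oct (n - 1)).1)) ∧
    -- the positions of `Pₙ` modulo `2 + √2` are dense
    DenseRange (fun n : ℤ => (posP n : AddCircle (2 + √2))) ∧
    -- the three systole configurations occur
    (∃ n : ℤ, posP n ∈ Ioo 1 (1 + (1 + √2) / 2) ∧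
      (Oct n).1.systoles = {segPB n}) ∧
    (∃ n : ℤ, posP n ∈ Ioo (1 + (1 + √2) / 2) (2 + (1 + √2) / 2) ∧
      segQB n ≠ segPC n ∧ (Oct n).1.systoles = {segQB n, segPC n}) ∧
    (∃ n : ℤ, posP n ∈ Ioo 0 1 ∪ Ioo (2 + (1 + √2) / 2) (2 + √2) ∧
      (Oct n).1.systoles = {segQC n}) ∧
    -- fakes accumulate at every surface of the family
    (∀ m : ℤ, ∀ U ∈ 𝓝 (Oct m).cls, ∃ n : ℤ, n ≠ m ∧ (Oct n).cls ≠ (Oct m).cls ∧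
      Gluing.IsFake octagon.1 (Oct n).1 ∧ (Oct n).cls ∈ U) ∧
    (∀ U ∈ 𝓝 octagon.cls, ∃ n : ℤ, Gluing.IsFake octagon.1 (Oct n).1 ∧ (Oct n).cls ∈ U) := by
  refine ⟨⟨oct_zero, fun n _ => leftSurgery_oct n, fun n _ => rightSurgery_oct n⟩, dense_posP,
    exists_systole_PB, exists_systole_QB_PC, exists_systole_QC, fun m U hU => exists_fake m hU,
    fun U hU => ?_⟩
  rw [← oct_zero] at hU
  obtain ⟨n, -, -, h1, h2⟩ := exists_fake 0 hU
  exact ⟨n, h1, h2⟩
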